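/- **Notation.** Let $G$ be a group. An involution is an element of order 2; a translation is a product $rs$ of two distinct involutions; $D_{r,s}=\langle r,s\rangle$. Let $p$ be a prime with $p\equiv 3 \pmod 4$. A pair $(r,s)$ of distinct involutions is of *$p$-minimal type* if $|rs|=p$ and $N_G(\langle rs\rangle)=D_{r,s}$, and of *$p$-affine type* if $D_{r,s}$ lies in a subgroup of $G$ isomorphic to $\mathrm{AGL}(1,\mathbb F_p)$. Let $q_1,q_2$ be odd positive integers. Call $G$ *weakly sharply 2-transitive of characteristic $p$ and of $(q_1,q_2)$-almost bounded exponent* if 1. every translation has order $p$ or infinite order, and each pair $(r,s)$ of distinct involutions with $|rs|=p$ is of $p$-minimal or of $p$-affine type; 2. there are pairs of $p$-affine type, and $G$ acts transitively on them by conjugation; 3. the centralizer of every translation is cyclic and generated by a translation; 4. every finite subgroup $E\le G$ embeds into $\mathrm{AGL}(1,\mathbb F_p)$, or lies in a subgroup isomorphic to $C_{q_1}$ with no non-trivial element of $E$ centralizing an involution, or lies in a subgroup isomorphic to $C_{2q_2}$. The group $G$ is in $\mathcal{WST}(p,q_1,q_2)$ if moreover all its elements have finite order. Let $\Gamma$ act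 by automorphisms on a simplicial tree, and hence by isometries on its geometric realization $X$ (edges of length 1). For $H\le\Gamma$ let $\partial H$ be the set of accumulation points of an orbit of $H$ in the Gromov boundary $\partial X$. Then $H$ is elementary if $|\partial H|\le 2$, and elliptic if its orbits are bounded; an element $g$ is loxodromic if $|\partial\langle g\rangle|=2$, and then $E(g)$ is the setwise stabilizer of $\partial\langle g\rangle$, the maximal loxodromic subgroup containing $g$. Let $[g]=\inf_{x\in X} d(x,gx)$ be the translation length and $A_g=\{x\in X: d(x,gx)=[g]\}$. The action is *acylindrical* if for every $\varepsilon\ge0$ there are $M,L>0$ such that at most $M$ elements $g$ satisfy $d(x,gx)\le\varepsilon$ and $d(y,gy)\le\varepsilon$ whenever $d(x,y)\ge L$. It is *tame* if $\Gamma$ has no subgroup of order 4 and, for every loxodromic $g$, the maximal finite normal subgroup of $E(g)$ has order at most 2. Let $\nu$ be the smallest positive integer $m$ such that for all $g,h\in\Gamma$ with $h$ loxodromic, if $g,h^{-1}gh,\dots,h^{-m}gh^m$ generate an elliptic subgroup, then $\langle g,h\rangle$ is elementary ($\nu=\infty$ if there is none). Let $\tau=\max\{\nu,3\}$. If $\tau<\infty$,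 let $\Omega$ be the supremum of $\operatorname{diam}(A_{g_0}\cap\dots\cap A_{g_\tau})$ over all tuples $(g_0,\dots,g_\tau)$ with all $[g_j]=0$ that generate a non-elementary subgroup (suprema and diameters over empty sets are 0). Fix an integer $N\ge4$. The pair $(\Gamma,X)$ is in $\mathcal{WST}'(p,q_1,q_2)$ (with threshold $N$) if $\Gamma$ acts without inversion of edges, $\Gamma$ is weakly sharply 2-transitive of characteristic $p$ and of $(q_1,q_2)$-almost bounded exponent, the action is non-elementary, acylindrical and tame with $\tau\le5$ and $\Omega=0$, the integers $p,q_1,q_2$ are at least $N$, and every element of infinite order of $\Gamma$ is loxodromic. **Proposition.** Let $p,q_1,q_2\ge N$ and let $G$ be a group in $\mathcal{WST}(p,q_1,q_2)$. (1) Let $G^*=G*\mathbb Z$, and let $X$ be the Bass–Serre tree of $G^*$ as an HNN-extension of $G$ with trivial associated subgroups. Then $(G^*,X)$ is in $\mathcal{WST}'(p,q_1,q_2)$. Moreover, $G^*$ contains a translation of infinite order and translation length at most 2, and an element of infinite order that is not a translation, has translation length 1 and centralizes no involution. (2) Let $(r,s)$ and $(r',s')$ be pairs of distinct involutions of $G$,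 of $p$-affine and of $p$-minimal type respectively. Then there is a (necessarily unique) isomorphism $D_{r',s'}\to D_{r,s}$ with $r'\mapsto r$ and $s'\mapsto s$. Let $G^*=\langle G,t\mid t^{-1}rt=r',\ t^{-1}st=s'\rangle$ be the corresponding HNN-extension and $X$ its Bass–Serre tree. Then $(G^*,X)$ is in $\mathcal{WST}'(p,q_1,q_2)$. Moreover, if $|D_{r,s}\cap D_{r',s'}|=2$, then $G^*$ contains an element of infinite order that is not a translation, has translation length 1 and centralizes an involution. -/

import Mathlib

open scoped Pointwise ENNReal
open Filter

noncomputable section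

namespace SharpTwo

/-! ### Involutions, translations, pairs of involutions -/

section Groups

variable {G : Type*} [Group G]

/-- An involution is an element of order two. -/
def IsInvolution (g : G) : Prop := orderOf g = 2

/-- `(r, s)` is an ordered pair of distinct involutions. -/
def IsInvolutionPair (r s : G) : Prop := IsInvolution r ∧ IsInvolution s ∧ r ≠ s

/-- A translation is a product of two distinct involutions. -/
def IsTranslation (g : G) : Prop := ∃ r s : G, IsInvolutionPair r s ∧ g = r * s

/-- The subgroup `D_{r,s}` generated by `r` and `s`. -/
def dihedral (r s : G) : Subgroup G := Subgroup.closure {r, s}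

lemma left_mem_dihedral (r s : G) : r ∈ dihedral r s := Subgroup.subset_closure (by simp)

lemma right_mem_dihedral (r s : G) : s ∈ dihedral r s := Subgroup.subset_closure (by simp)

/-- The isomorphism `φ` from `D_{r',s'}` to `D_{r,s}` maps `r'` to `r` and `s'` to `s`. (There is at
most one such isomorphism.) -/
def MapsPair {r s r' s' : G} (φ : dihedral r' s' ≃* dihedral r s) : Prop :=
  φ ⟨r', left_mem_dihedral r' s'⟩ = ⟨r, left_mem_dihedral r s⟩ ∧
    φ ⟨s', right_mem_dihedral r' s'⟩ = ⟨s, right_mem_dihedral r s⟩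

/-- The group `AGL(1, 𝔽_p)` of affine permutations of the affine line over `ℤ/p`. -/
abbrev AGL1 (p : ℕ) : Type := ZMod p ≃ᵃ[ZMod p] ZMod p

/-- The pair of distinct involutions `(r, s)` is of `p`-minimal type. -/
def IsPMinimal (p : ℕ) (r s : G) : Prop :=
  IsInvolutionPair r s ∧ orderOf (r * s) = p ∧
    Subgroup.normalizer (Subgroup.zpowers (r * s) : Set G) = dihedral r s

/-- The pair of distinct involutions `(r, s)` is of `p`-affine type. -/
def IsPAffine (p : ℕ) (r s : G) : Prop :=
  IsInvolutionPair r s ∧ ∃ H : Subgroup G, dihedral r s ≤ H ∧ Nonempty (H ≃* AGL1 p)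

variable (G) in
/-- `G` is weakly sharply 2-transitive of characteristic `p`. -/
structure IsWeaklySharplyTwoTransitive (p : ℕ) : Prop where
  prime : p.Prime
  mod_four : p % 4 = 3
  order_translation : ∀ r s : G, IsInvolutionPair r s →
    orderOf (r * s) = p ∨ ¬ IsOfFinOrder (r * s)
  minimal_or_affine : ∀ r s : G, IsInvolutionPair r s → orderOf (r * s) = p →
    IsPMinimal p r s ∨ IsPAffine p r s
  exists_affine : ∃ r s : G, IsPAffine p r s
  transitive_affine : ∀ r s r' s' : G, IsPAffine p r s → IsPAffine p r' s' →
    ∃ g : G, g⁻¹ * r * g = r' ∧ g⁻¹ * s * g = s'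
  centralizer_translation : ∀ r s : G, IsInvolutionPair r s →
    ∃ z : G, IsTranslation z ∧ Subgroup.centralizer {r * s} = Subgroup.zpowers z

variable (G) in
/-- `G` is of `(q₁, q₂)`-almost bounded exponent (relative to the prime `p`). In the case of
`C_{q₁}` the identity of `E`, which centralizes everything, is disregarded. -/
structure IsAlmostBoundedExponent (p q₁ q₂ : ℕ) : Prop where
  odd_left : Odd q₁
  odd_right : Odd q₂
  finite_subgroups : ∀ E : Subgroup G, Finite E →
    (∃ f : E →* AGL1 p, Function.Injective f) ∨
    ((∃ C : Subgroup G, E ≤ C ∧ Nonempty (C ≃* Multiplicative (ZMod q₁))) ∧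
      ∀ e ∈ E, e ≠ 1 → ∀ i : G, IsInvolution i → ¬ Commute e i) ∨
    (∃ C : Subgroup G, E ≤ C ∧ Nonempty (C ≃* Multiplicative (ZMod (2 * q₂))))

variable (G) in
/-- The class `WST(p, q₁, q₂)`. -/
structure WST (p q₁ q₂ : ℕ) : Prop where
  weakly : IsWeaklySharplyTwoTransitive G p
  bounded : IsAlmostBoundedExponent G p q₁ q₂
  torsion : ∀ g : G, IsOfFinOrder g

end Groups

/-! ### The boundary at infinity of a metric space -/

section Boundary

variable {X : Type*} [MetricSpace X]

/-- The Gromov product `⟨x, y⟩_z`. -/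
def gromovProduct (x y z : X) : ℝ := (dist x z + dist y z - dist x y) / 2

/-- The sequence `u` converges to infinity. -/
def ConvergesToInfinity (u : ℕ → X) : Prop :=
  ∀ x : X, Tendsto (fun m : ℕ × ℕ => gromovProduct (u m.1) (u m.2) x) atTop atTop

variable (X) in
/-- The sequences converging to infinity. -/
def SeqInfinity : Type _ := {u : ℕ → X // ConvergesToInfinity u}

/-- Two sequences converging to infinity are related if their Gromov products tend to infinity. In
a hyperbolic space this is an equivalence relation. -/
def SeqInfinity.Rel (u v : SeqInfinity X) : Prop :=
  ∀ x : X, Tendsto (fun n : ℕ => gromovProduct (u.1 n) (v.1 n) x) atTop atTop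

variable (X) in
/-- The boundary at infinity `∂X`. -/
def Boundary : Type _ := Quot (SeqInfinity.Rel (X := X))

/-- The set `∂Y` of the points of the boundary that are limits of sequences of points of `Y`. -/
def boundaryOf (Y : Set X) : Set (Boundary X) :=
  {ξ | ∃ u : SeqInfinity X, (∀ n, u.1 n ∈ Y) ∧ Quot.mk _ u = ξ}

lemma gromovProduct_map (f : X ≃ᵢ X) (x y z : X) :
    gromovProduct (f x) (f y) z = gromovProduct x y (f.symm z) := by
  have h : ∀ a : X, dist (f a) z = dist a (f.symm z) := fun a => by
    conv_lhs => rw [← f.apply_symm_apply z]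
    exact f.dist_eq _ _
  simp [gromovProduct, h, f.dist_eq]

/-- Isometries act on the sequences converging to infinity. -/
def SeqInfinity.map (f : X ≃ᵢ X) (u : SeqInfinity X) : SeqInfinity X :=
  ⟨fun n => f (u.1 n), fun x => by
    simpa only [gromovProduct_map] using u.2 (f.symm x)⟩

/-- The action of the isometries of `X` on `∂X`: `f • [(x_m)] = [(f x_m)]`. -/
instance : MulAction (X ≃ᵢ X) (Boundary X) where
  smul f := Quot.map (SeqInfinity.map f) fun u v h x => by
    simpa only [SeqInfinity.map, gromovProduct_map] using h (f.symm x)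
  one_smul ξ := by
    induction ξ using Quot.ind
    rfl
  mul_smul f g ξ := by
    induction ξ using Quot.ind
    rfl

end Boundary

/-! ### Groups acting by isometries

An action of `Γ` by isometries on `X` is a homomorphism `ρ : Γ →* (X ≃ᵢ X)`. -/

section Actions

variable {Γ : Type*} [Group Γ] {X : Type*} [MetricSpace X] (ρ : Γ →* (X ≃ᵢ X))

/-- The orbit of a point under a subgroup. -/
def orbitOf (H : Subgroup Γ) (x : X) : Set X := (fun h => ρ h x) '' (H : Set Γ)

/-- The set `∂H` of the accumulation points in `∂X` of the orbits of `H` (in a hyperbolic space all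
the orbits have the same accumulation points). -/
def limitSet (H : Subgroup Γ) : Set (Boundary X) := ⋃ x : X, boundaryOf (orbitOf ρ H x)

/-- `H` is elementary: `∂H` has at most two points. -/
def IsElementary (H : Subgroup Γ) : Prop := (limitSet ρ H).encard ≤ 2

/-- `H` is elliptic: its orbits are bounded. -/
def IsEllipticSubgroup (H : Subgroup Γ) : Prop := ∀ x : X, Bornology.IsBounded (orbitOf ρ H x)

/-- `g` is loxodromic: `∂⟨g⟩` has exactly two points. -/
def IsLoxodromic (g : Γ) : Prop := (limitSet ρ (Subgroup.zpowers g)).encard = 2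

/-- The translation length of `g`. -/
def translationLength (g : Γ) : ℝ := ⨅ x : X, dist x (ρ g x)

/-- The action is acylindrical. -/
def IsAcylindrical : Prop :=
  ∀ ε : ℝ, 0 ≤ ε → ∃ (M : ℕ) (L : ℝ), 0 < M ∧ 0 < L ∧ ∀ x y : X, L ≤ dist x y →
    {g : Γ | dist x (ρ g x) ≤ ε ∧ dist y (ρ g y) ≤ ε}.encard ≤ M

/-- The maximal loxodromic subgroup `E(g)` containing the loxodromic element `g`, that is, the
setwise stabilizer of `∂⟨g⟩`. -/
def maximalLoxodromic (g : Γ) : Subgroup Γ :=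
  (MulAction.stabilizer (X ≃ᵢ X) (limitSet ρ (Subgroup.zpowers g))).comap ρ

/-- The action is tame: `Γ` has no subgroup of order four, and for every loxodromic `g` the finite
normal subgroups of `E(g)` (equivalently, the largest of them) have order at most two. -/
def IsTame : Prop :=
  (∀ H : Subgroup Γ, Nat.card H ≠ 4) ∧
  ∀ g : Γ, IsLoxodromic ρ g → ∀ F : Subgroup (maximalLoxodromic ρ g), F.Normal → Finite F →
    Nat.card F ≤ 2

/-- The parameter `ν`: the smallest positive integer `m` such that for all `g` and all loxodromic
`h`, if `g, h⁻¹gh, …, h⁻ᵐghᵐ` generate an elliptic subgroup, then `g` and `h` generate an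
elementary subgroup. It is `⊤` if there is no such integer. -/
def nu : ℕ∞ :=
  sInf ((fun m : ℕ => (m : ℕ∞)) '' {m : ℕ | 0 < m ∧ ∀ g h : Γ, IsLoxodromic ρ h →
    IsEllipticSubgroup ρ (Subgroup.closure {x | ∃ i : ℕ, i ≤ m ∧ x = (h ^ i)⁻¹ * g * h ^ i}) →
    IsElementary ρ (Subgroup.closure {g, h})})

/-- The parameter `τ = max {ν, 3}`. -/
def tau : ℕ∞ := max (nu ρ) 3

/-- The axis of `g`, for an action on a `0`-hyperbolic space. -/
def axis (g : Γ) : Set X := {x | dist x (ρ g x) = translationLength ρ g}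

/-- The parameter `Ω`, for an action with finite `τ` on a `0`-hyperbolic space: the supremum of the
diameters of the sets `A_{g_0} ∩ ⋯ ∩ A_{g_τ}`, over all the tuples `(g_0, …, g_τ)` of elements of
translation length zero that generate a non-elementary subgroup. -/
def Omega : ℝ≥0∞ :=
  ⨆ a ∈ {a : Fin ((tau ρ).toNat + 1) → Γ |
      ¬ IsElementary ρ (Subgroup.closure (Set.range a)) ∧ ∀ j, translationLength ρ (a j) ≤ 0},
    Metric.ediam (⋂ j, axis ρ (a j))

end Actions

/-! ### The geometric realization of a simplicial tree -/

section Realization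

variable {V : Type*} (T : SimpleGraph V)

/-- The function that records the distances to the vertices from the point at distance `t` from `u`
on the edge `uv` of a tree. (In a tree the distances from `u` and from `v` to a given vertex differ
by exactly one.) -/
def edgePoint (u v : V) (t : ℝ) : V → ℝ := fun w => (1 - t) * T.dist u w + t * T.dist v w

/-- The geometric realization of the tree `T`, all of whose edges have length one. A point is
represented by the function that records its distances to the vertices. -/
@[ext]
structure Realization {T : SimpleGraph V} (hT : T.IsTree) where
  val : V → ℝ
  exists_edge : ∃ (u v : V) (t : ℝ), (u = v ∨ T.Adj u v) ∧ 0 ≤ t ∧ t ≤ 1 ∧ val = edgePoint T u v t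

variable {T} (hT : T.IsTree)

lemma Realization.lip (x : Realization hT) (w w' : V) : x.1 w ≤ x.1 w' + T.dist w' w := by
  obtain ⟨x, u, v, t, -, h0, h1, rfl⟩ := x
  have h : ∀ a : V, (T.dist a w : ℝ) ≤ T.dist a w' + T.dist w' w := fun a => by
    exact_mod_cast hT.connected.dist_triangle
  simp only [edgePoint]
  nlinarith [h u, h v]

lemma Realization.tri (x : Realization hT) (w w' : V) : (T.dist w' w : ℝ) ≤ x.1 w' + x.1 w := by
  obtain ⟨x, u, v, t, -, h0, h1, rfl⟩ := x
  have h : ∀ a : V, (T.dist w' w : ℝ) ≤ T.dist a w' + T.dist a w := fun a => by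
    rw [T.dist_comm (u := a) (v := w')]
    exact_mod_cast hT.connected.dist_triangle
  simp only [edgePoint]
  nlinarith [h u, h v]

lemma Realization.abs_le (x y : Realization hT) (w w' : V) :
    |x.1 w - y.1 w| ≤ x.1 w' + y.1 w' := by
  rw [_root_.abs_le]
  constructor <;>
  linarith [x.lip hT w w', y.lip hT w w', x.tri hT w w', y.tri hT w w']

lemma Realization.bdd (x y : Realization hT) : BddAbove (Set.range fun w => |x.1 w - y.1 w|) := by
  obtain ⟨w'⟩ := hT.connected.nonempty
  exact ⟨_, by rintro _ ⟨w, rfl⟩; exact x.abs_le hT y w w'⟩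

/-- The path metric of the realization: the distance between two points is the largest difference
between their distances to the vertices (it is attained at a vertex in whose direction the geodesic
from one point to the other can be prolonged). -/
instance : MetricSpace (Realization hT) where
  dist x y := ⨆ w, |x.1 w - y.1 w|
  dist_self x := by simp
  dist_comm x y := by simp only [abs_sub_comm]
  dist_triangle x y z := by
    have := hT.connected.nonempty
    refine ciSup_le fun w => (abs_sub_le _ (y.1 w) _).trans ?_
    exact add_le_add (le_ciSup (x.bdd hT y) w) (le_ciSup (y.bdd hT z) w)
  eq_of_dist_eq_zero {x y} h := by
    refine Realization.ext (funext fun w => ?_)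
    have h1 : |x.1 w - y.1 w| ≤ 0 := (le_ciSup (x.bdd hT y) w).trans h.le
    exact sub_eq_zero.1 (abs_nonpos_iff.1 h1)

/-- The vertex `u` as a point of the realization. -/
def Realization.vertex (u : V) : Realization hT :=
  ⟨fun w => T.dist u w, u, u, 0, Or.inl rfl, le_rfl, zero_le_one, by ext; simp [edgePoint]⟩

lemma Realization.dist_def (x y : Realization hT) : dist x y = ⨆ w, |x.1 w - y.1 w| := rfl

/-- A point is indeed represented by its distances to the vertices. -/
lemma Realization.dist_vertex (x : Realization hT) (u : V) :
    dist x (Realization.vertex hT u) = x.1 u := by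
  have := hT.connected.nonempty
  have hx : 0 ≤ x.1 u := by have := x.tri hT u u; simp at this; linarith
  rw [Realization.dist_def]
  apply le_antisymm
  · refine ciSup_le fun w => ?_
    simpa [Realization.vertex] using x.abs_le hT (Realization.vertex hT u) w u
  · refine le_trans ?_ (le_ciSup (x.bdd hT (Realization.vertex hT u)) u)
    simp [Realization.vertex, le_abs_self]

/-- Every edge is isometric to the unit interval. -/
lemma Realization.dist_edge {u v : V} (h : T.Adj u v) (x y : Realization hT) (s t : ℝ)
    (hx : x.1 = edgePoint T u v s) (hy : y.1 = edgePoint T u v t) : dist x y = |s - t| := by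
  have := hT.connected.nonempty
  have key : ∀ w, x.1 w - y.1 w = (s - t) * ((T.dist v w : ℝ) - T.dist u w) := fun w => by
    rw [hx, hy]; simp only [edgePoint]; ring
  have huv : T.dist u v = 1 := SimpleGraph.dist_eq_one_iff_adj.2 h
  have hvu : T.dist v u = 1 := SimpleGraph.dist_eq_one_iff_adj.2 h.symm
  rw [Realization.dist_def]
  apply le_antisymm
  · refine ciSup_le fun w => ?_
    have h1 : (T.dist v w : ℝ) ≤ T.dist v u + T.dist u w := by
      exact_mod_cast hT.connected.dist_triangle
    have h2 : (T.dist u w : ℝ) ≤ T.dist u v + T.dist v w := by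
      exact_mod_cast hT.connected.dist_triangle
    rw [huv] at h2
    rw [hvu] at h1
    rw [key, abs_mul]
    refine mul_le_of_le_one_right (abs_nonneg _) (_root_.abs_le.2 ⟨?_, ?_⟩) <;> push_cast at * <;>
      linarith
  · refine le_trans ?_ (le_ciSup (x.bdd hT y) u)
    rw [key, hvu]
    simp

lemma dist_iso {V : Type*} {T : SimpleGraph V} (hT : T.IsTree) (σ : T ≃g T) (u v : V) :
    T.dist (σ u) (σ v) = T.dist u v := by
  have key : ∀ (τ : T ≃g T) (a b : V), T.dist (τ a) (τ b) ≤ T.dist a b := fun τ a b => by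
    obtain ⟨p, hp⟩ := hT.connected.exists_walk_length_eq_dist a b
    rw [← hp, ← SimpleGraph.Walk.length_map τ.toHom p]
    exact SimpleGraph.dist_le _
  refine le_antisymm (key σ u v) ?_
  simpa using key σ.symm (σ u) (σ v)

/-- The map of realizations induced by an automorphism of the tree. -/
def Realization.map (σ : T ≃g T) (x : Realization hT) : Realization hT :=
  ⟨fun w => x.1 (σ.symm w), by
    obtain ⟨x, u, v, t, h, h0, h1, rfl⟩ := x
    refine ⟨σ u, σ v, t, h.imp (congrArg σ) σ.map_adj_iff.2, h0, h1, ?_⟩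
    ext w
    have e : ∀ a : V, T.dist (σ a) w = T.dist a (σ.symm w) := fun a => by
      rw [← dist_iso hT σ a (σ.symm w), RelIso.apply_symm_apply]
    simp only [edgePoint, e]⟩

/-- Automorphisms of the tree act by isometries on its realization. -/
def realizationHom : (T ≃g T) →* (Realization hT ≃ᵢ Realization hT) where
  toFun σ :=
    { toFun := Realization.map hT σ
      invFun := Realization.map hT σ.symm
      left_inv := fun x => Realization.ext (funext fun w => by simp [Realization.map])
      right_inv := fun x => Realization.ext (funext fun w => by simp [Realization.map])
      isometry_toFun := Isometry.of_dist_eq fun x y =>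
        σ.symm.toEquiv.iSup_comp (g := fun w => |x.1 w - y.1 w|) }
  map_one' := rfl
  map_mul' _ _ := rfl

/-- An automorphism moves the vertices of the realization as it moves those of the tree. -/
lemma realizationHom_vertex (σ : T ≃g T) (u : V) :
    realizationHom hT σ (Realization.vertex hT u) = Realization.vertex hT (σ u) := by
  refine Realization.ext (funext fun w => ?_)
  change (T.dist u (σ.symm w) : ℝ) = T.dist (σ u) w
  rw [← dist_iso hT σ u (σ.symm w), RelIso.apply_symm_apply]

end Realization

/-! ### The class `WST'` -/

section WST'

variable {Γ : Type*} [Group Γ] {V : Type*} {T : SimpleGraph V}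

/-- The action by isometries on the realization of the tree `T` given by an action of `Γ` on `T`. -/
def treeAction (hT : T.IsTree) (α : Γ →* (T ≃g T)) : Γ →* (Realization hT ≃ᵢ Realization hT) :=
  (realizationHom hT).comp α

/-- The class `WST'(p, q₁, q₂)`, where `N` is the lower bound imposed on `p`, `q₁` and `q₂`, for an
action `α` of `Γ` on the simplicial tree `T`. -/
structure WST' (N p q₁ q₂ : ℕ) (hT : T.IsTree) (α : Γ →* (T ≃g T)) : Prop where
  no_inversion : ∀ (g : Γ) (x y : V), T.Adj x y → ¬ (α g x = y ∧ α g y = x)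
  weakly : IsWeaklySharplyTwoTransitive Γ p
  bounded : IsAlmostBoundedExponent Γ p q₁ q₂
  nonelementary : ¬ IsElementary (treeAction hT α) ⊤
  acylindrical : IsAcylindrical (treeAction hT α)
  tame : IsTame (treeAction hT α)
  tau_le : tau (treeAction hT α) ≤ 5
  omega_eq : Omega (treeAction hT α) = 0
  le_p : N ≤ p
  le_left : N ≤ q₁
  le_right : N ≤ q₂
  loxodromic : ∀ g : Γ, ¬ IsOfFinOrder g → IsLoxodromic (treeAction hT α) g

end WST'

/-! ### The Bass–Serre tree of an HNN-extension -/

section BassSerre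

variable {Γ : Type*} [Group Γ] (B : Subgroup Γ) (t : Γ)

/-- The Bass–Serre tree of a group `Γ` that is an HNN-extension with base group `B` and stable
letter `t`: its vertices are the cosets `gB`, and its edges join `gB` to `gtB`. -/
def bassSerreGraph : SimpleGraph (Γ ⧸ B) :=
  SimpleGraph.fromRel fun x y => ∃ g : Γ, x = (g : Γ ⧸ B) ∧ y = ((g * t : Γ) : Γ ⧸ B)

/-- The action of `Γ` on the Bass–Serre tree by left multiplication. -/
def bassSerreAction : Γ →* (bassSerreGraph B t ≃g bassSerreGraph B t) where
  toFun γ :=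
    { toEquiv := MulAction.toPerm γ
      map_rel_iff' := by
        have key : ∀ (δ : Γ) (x y : Γ ⧸ B),
            (∃ g : Γ, x = (g : Γ ⧸ B) ∧ y = ((g * t : Γ) : Γ ⧸ B)) →
            ∃ g : Γ, δ • x = (g : Γ ⧸ B) ∧ δ • y = ((g * t : Γ) : Γ ⧸ B) := by
          rintro δ _ _ ⟨g, rfl, rfl⟩
          exact ⟨δ * g, rfl, by rw [mul_assoc]; rfl⟩
        have key' : ∀ (δ : Γ) (x y : Γ ⧸ B),
            (∃ g : Γ, δ • x = (g : Γ ⧸ B) ∧ δ • y = ((g * t : Γ) : Γ ⧸ B)) ↔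
            ∃ g : Γ, x = (g : Γ ⧸ B) ∧ y = ((g * t : Γ) : Γ ⧸ B) := fun δ x y =>
          ⟨fun h => by simpa using key δ⁻¹ _ _ h, key δ x y⟩
        intro x y
        simp only [bassSerreGraph, SimpleGraph.fromRel_adj, MulAction.toPerm_apply, key', ne_eq,
          smul_left_cancel_iff] }
  map_one' := by
    ext x
    exact one_smul Γ x
  map_mul' γ δ := by
    ext x
    exact mul_smul γ δ x

end BassSerre

end SharpTwo

end

open SharpTwo

/-!
Both groups act on a tree with one orbit of vertices, whose vertex stabilizers are the conjugates of
`G` and whose edge stabilizers are conjugates of a group `A` that is trivial in the case of the free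
product and dihedral of order `2 * p` in the other case. Two features of the action imply that the
extension is in `WST'` (`IsDihedralSplitting.wst'`):

* the nontrivial elements of an edge stabilizer are involutions or translations;
* an element `z` with `z ^ 2 ≠ 1` fixes no two vertices at distance three.

Finite subgroups fix a vertex, so the conditions on them are inherited from `G`. The normalizer of a
translation of finite order acts on the fixed point set of the translation, which is bounded, and
therefore fixes a vertex as well; so the distinction of pairs of minimal and of affine type and the
centralizers of these translations are also inherited. A translation of infinite order has no fixed
vertex, and its centralizer acts freely on the tree, so that it is cyclic
(`IsDihedralSplitting.free_of_commute`, `IsHeight.isCyclic_centralizer`).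

As for the dynamics, an acylindrical action is obtained from the bound on the edge stabilizers. An
element that fixes five consecutive points `v`, `k v`, …, `k ^ 4 v` of the orbit of a loxodromic
element `k` is trivial or an involution that commutes with `k`; otherwise it and its conjugate by
`k` would yield a translation that fixes points too far from each other. Hence `ν ≤ 4`. A finite
normal subgroup of `E(g)` fixes an edge and contains no translation, so that it is of order at most
two. Elements with a common fixed point generate a group with empty limit set, so `Ω = 0`.

The tree of the HNN-extension is obtained from Britton's lemma (`IsHNN.isTree`). In the second case,
the two features above hold because the normalizer of a translation subgroup of minimal type is the
dihedral group `A`, while the normalizer of one of affine type has at least `p * (p - 1) > 2 * p`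
elements, so that the two are not conjugate in `G` (`IsPAffine.not_conj`).

The exponent sum of the stable letter gives a height function on the tree. It bounds translation
lengths from below, and it shows that elements with exponent sum one are loxodromic and not products
of two involutions; an element of the form `d * t` that centralizes an involution exists in the
second case because all the involutions of `G` are conjugate (`WST.exists_conj_eq`).
-/

namespace SharpTwo

/-! ### The metric of a tree -/

section TreeMetric

variable {V : Type*} {T : SimpleGraph V} (hT : T.IsTree)
include hT

lemma tree_dist_triangle (x y z : V) : T.dist x z ≤ T.dist x y + T.dist y z :=
  hT.connected.dist_triangle

lemma tree_dist_eq_zero {x y : V} : T.dist x y = 0 ↔ x = y :=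
  hT.connected.dist_eq_zero_iff

lemma length_eq_dist_of_isPath {x y : V} {p : T.Walk x y} (hp : p.IsPath) :
    p.length = T.dist x y := by
  obtain ⟨q, hq, hl⟩ := hT.connected.exists_path_of_dist x y
  have := congrArg Subtype.val ((hT.isAcyclic.subsingleton_path x y).elim ⟨p, hp⟩ ⟨q, hq⟩)
  simp only at this
  rw [this, hl]

/-- The vertices of a path of a tree are those that lie between its ends. -/
lemma mem_support_iff_dist_add {x y : V} {p : T.Walk x y} (hp : p.IsPath) (m : V) :
    m ∈ p.support ↔ T.dist x m + T.dist m y = T.dist x y := by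
  constructor
  · intro hm
    obtain ⟨q, r, -, -, rfl⟩ := hp.mem_support_iff_exists_append.1 hm
    have h1 := length_eq_dist_of_isPath hT hp
    rw [SimpleGraph.Walk.length_append] at h1
    have h2 := SimpleGraph.dist_le q
    have h3 := SimpleGraph.dist_le r
    have h4 := tree_dist_triangle hT x m y
    omega
  · intro h
    obtain ⟨q, hq⟩ := hT.connected.exists_walk_length_eq_dist x m
    obtain ⟨r, hr⟩ := hT.connected.exists_walk_length_eq_dist m y
    have hqr : (q.append r).IsPath := by
      apply SimpleGraph.Walk.isPath_of_length_eq_dist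
      rw [SimpleGraph.Walk.length_append, hq, hr, h]
    have := congrArg Subtype.val ((hT.isAcyclic.subsingleton_path x y).elim ⟨p, hp⟩ ⟨_, hqr⟩)
    simp only at this
    rw [this, SimpleGraph.Walk.mem_support_append_iff]
    exact Or.inl (SimpleGraph.Walk.end_mem_support q)

/-- A side of a triangle is contained in the union of the other two. -/
lemma between_or_between {x y m : V} (h : T.dist x m + T.dist m y = T.dist x y) (z : V) :
    T.dist x m + T.dist m z = T.dist x z ∨ T.dist z m + T.dist m y = T.dist z y := by
  classical
  obtain ⟨p, hp, -⟩ := hT.connected.exists_path_of_dist x z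
  obtain ⟨q, hq, -⟩ := hT.connected.exists_path_of_dist z y
  rw [← mem_support_iff_dist_add hT (p.append q).bypass_isPath] at h
  have := SimpleGraph.Walk.support_bypass_subset_support _ h
  rw [SimpleGraph.Walk.mem_support_append_iff] at this
  rwa [mem_support_iff_dist_add hT hp, mem_support_iff_dist_add hT hq] at this

lemma exists_dist_eq_of_le {x y : V} {k : ℕ} (hk : k ≤ T.dist x y) :
    ∃ m, T.dist x m = k ∧ T.dist m y = T.dist x y - k := by
  obtain ⟨p, hp⟩ := hT.connected.exists_walk_length_eq_dist x y
  refine ⟨p.getVert k, ?_⟩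
  have h1 := SimpleGraph.dist_le (p.take k)
  have h2 := SimpleGraph.dist_le (p.drop k)
  have h3 := tree_dist_triangle hT x (p.getVert k) y
  rw [SimpleGraph.Walk.take_length] at h1
  rw [SimpleGraph.Walk.drop_length] at h2
  omega

/-- Three vertices of a tree have a median. -/
lemma exists_median (x y z : V) : ∃ m, T.dist x m + T.dist m y = T.dist x y ∧
    T.dist x m + T.dist m z = T.dist x z ∧ T.dist y m + T.dist m z = T.dist y z := by
  classical
  -- the median is the point of the geodesic from `x` to `y` that is closest to `z`
  have hne : ∃ n, ∃ m, T.dist x m + T.dist m y = T.dist x y ∧ T.dist z m = n :=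
    ⟨_, x, by simp, rfl⟩
  obtain ⟨m, hm, hmn⟩ := Nat.find_spec hne
  have hmin : ∀ u, T.dist x u + T.dist u y = T.dist x y → T.dist z m ≤ T.dist z u := fun u hu =>
    hmn ▸ Nat.find_min' hne ⟨u, hu, rfl⟩
  have key : ∀ a, (∀ u, T.dist a u + T.dist u m = T.dist a m → T.dist z m ≤ T.dist z u) →
      T.dist a m + T.dist m z = T.dist a z := by
    intro a ha
    -- the median `u` of `a`, `m`, `z` is found on the path from `z` to `a`
    by_contra hcon
    have hne : ∃ n, ∃ u, T.dist a u + T.dist u m = T.dist a m ∧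
        T.dist a u + T.dist u z = T.dist a z ∧ T.dist u m = n := ⟨_, a, by simp, by simp, rfl⟩
    obtain ⟨u, h1, h2, hun⟩ := Nat.find_spec hne
    have hum : u ≠ m := by
      rintro rfl
      exact hcon h2
    have hpos : 0 < T.dist u m := hT.connected.pos_dist_of_ne hum
    obtain ⟨w, hw1, hw2⟩ := exists_dist_eq_of_le hT (show 1 ≤ T.dist u m from hpos)
    have hw3 : T.dist a w + T.dist w m = T.dist a m := by
      have := tree_dist_triangle hT a u w
      have := tree_dist_triangle hT a w m
      omega
    have hw4 : ¬ T.dist a w + T.dist w z = T.dist a z := by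
      intro h
      have := Nat.find_min' hne ⟨w, hw3, h, rfl⟩
      omega
    have hw5 := (between_or_between hT hw3 z).resolve_left hw4
    -- `w` is one step closer to `m` than `u`, and not on the way from `u` to `z`
    have h6 := hT.dist_eq_dist_add_one_of_adj z (SimpleGraph.dist_eq_one_iff_adj.1 hw1)
    simp only [T.dist_comm (u := z)] at h6 hw5
    have h7 := ha u h1
    have h8 := tree_dist_triangle hT a u w
    have h9 := tree_dist_triangle hT a w m
    rw [T.dist_comm (u := z), T.dist_comm (u := z) (v := u)] at h7
    omega
  have hx := key x fun u hu => hmin u (by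
    have := tree_dist_triangle hT x u y
    have := tree_dist_triangle hT u m y
    omega)
  have hy := key y fun u hu => hmin u (by
    have := tree_dist_triangle hT x u y
    have := tree_dist_triangle hT x m u
    rw [T.dist_comm (u := y) (v := u), T.dist_comm (u := u) (v := m),
      T.dist_comm (u := y) (v := m)] at hu
    omega)
  exact ⟨m, hm, hx, hy⟩

/-- The four-point condition: trees are `0`-hyperbolic. -/
lemma tree_four_point (x y z w : V) : T.dist x z + T.dist y w ≤
    max (T.dist x y + T.dist z w) (T.dist x w + T.dist y z) := by
  obtain ⟨m, h1, h2, h3⟩ := exists_median hT x y z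
  have a1 := between_or_between hT h1 w
  have a2 := between_or_between hT h2 w
  have a3 := between_or_between hT h3 w
  have b1 := tree_dist_triangle hT x m w
  have b2 := tree_dist_triangle hT y m w
  have b3 := tree_dist_triangle hT z m w
  simp only [T.dist_comm (u := m) (v := y), T.dist_comm (u := m) (v := z),
    T.dist_comm (u := w) (v := m), T.dist_comm (u := w) (v := y), T.dist_comm (u := w) (v := z)]
    at *
  omega

/-- Two geodesics that overlap in a nondegenerate segment form a geodesic. -/
lemma dist_eq_of_overlap {x y z w : V} (h1 : T.dist x y + T.dist y z = T.dist x z)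
    (h2 : T.dist y z + T.dist z w = T.dist y w) (hyz : y ≠ z) :
    T.dist x w = T.dist x y + T.dist y z + T.dist z w := by
  have h3 := tree_four_point hT x y z w
  have h4 := hT.connected.pos_dist_of_ne hyz
  have h5 := tree_dist_triangle hT x y w
  omega

lemma eq_of_between_of_dist_eq {x y m m' : V} (h : T.dist x m + T.dist m y = T.dist x y)
    (h' : T.dist x m' + T.dist m' y = T.dist x y) (he : T.dist x m = T.dist x m') : m = m' := by
  have h3 := tree_four_point hT x m y m'
  rw [← tree_dist_eq_zero hT]
  rw [T.dist_comm (u := y) (v := m')] at h3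
  omega

end TreeMetric

/-! ### Group actions on trees -/

section TreeActions

variable {Γ : Type*} [Group Γ] {V : Type*} {T : SimpleGraph V}

/-- A height function for an action on a tree: a function on the vertices that changes by `±1` along
each edge and on which the group acts by translations, through a character `χ`. Such a function
exists whenever the action preserves an orientation of the edges, for instance for HNN-extensions. -/
structure IsHeight (α : Γ →* (T ≃g T)) (χ : Γ →* Multiplicative ℤ) (η : V → ℤ) : Prop where
  equivariant : ∀ g v, η (α g v) = η v + (χ g).toAdd
  adj : ∀ u v, T.Adj u v → η u = η v + 1 ∨ η v = η u + 1

lemma act_mul (α : Γ →* (T ≃g T)) (g h : Γ) (v : V) : α (g * h) v = α g (α h v) := by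
  rw [map_mul]; rfl

lemma act_one (α : Γ →* (T ≃g T)) (v : V) : α 1 v = v := by
  rw [map_one]; rfl

lemma act_inv_act (α : Γ →* (T ≃g T)) (g : Γ) (v : V) : α g⁻¹ (α g v) = v := by
  rw [← act_mul, inv_mul_cancel, act_one]

lemma act_act_inv (α : Γ →* (T ≃g T)) (g : Γ) (v : V) : α g (α g⁻¹ v) = v := by
  rw [← act_mul, mul_inv_cancel, act_one]

lemma act_eq_iff (α : Γ →* (T ≃g T)) (g : Γ) (v w : V) : α g v = w ↔ v = α g⁻¹ w := by
  constructor
  · rintro rfl; rw [act_inv_act]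
  · rintro rfl; rw [act_act_inv]

lemma act_zpow_of_fixed (α : Γ →* (T ≃g T)) {g : Γ} {v : V} (h : α g v = v) (n : ℤ) :
    α (g ^ n) v = v := by
  induction n using Int.induction_on with
  | zero => simp
  | succ n ih => rw [zpow_add_one, act_mul, h, ih]
  | pred n ih => rw [zpow_sub_one, act_mul, ← (act_eq_iff α g v v).1 h, ih]

/-- The stabilizer of a vertex. -/
def vertexStabilizer (α : Γ →* (T ≃g T)) (v : V) : Subgroup Γ where
  carrier := {g | α g v = v}
  one_mem' := act_one α v
  mul_mem' {a b} ha hb := by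
    simp only [Set.mem_ofPred_eq] at *
    rw [act_mul, hb, ha]
  inv_mem' {a} ha := ((act_eq_iff α a v v).1 ha).symm

lemma mem_vertexStabilizer {α : Γ →* (T ≃g T)} {v : V} {g : Γ} :
    g ∈ vertexStabilizer α v ↔ α g v = v := Iff.rfl

variable (hT : T.IsTree) (α : Γ →* (T ≃g T))

include hT in
lemma dist_act (g : Γ) (u v : V) : T.dist (α g u) (α g v) = T.dist u v := dist_iso hT (α g) u v

include hT in
lemma dist_act_inv (g : Γ) (u v : V) : T.dist (α g⁻¹ u) v = T.dist u (α g v) := by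
  rw [← dist_act hT α g, act_act_inv]

include hT in
lemma dist_act_pow_le (g : Γ) (x : V) (n : ℕ) :
    T.dist x (α (g ^ n) x) ≤ n * T.dist x (α g x) := by
  induction n with
  | zero => simp
  | succ n ih =>
    have h1 := tree_dist_triangle hT x (α (g ^ n) x) (α (g ^ (n + 1)) x)
    have h2 : T.dist (α (g ^ n) x) (α (g ^ (n + 1)) x) = T.dist x (α g x) := by
      rw [pow_succ, act_mul, dist_act hT α]
    rw [Nat.succ_mul]
    omega

include hT in
/-- An element that fixes two vertices fixes the geodesic between them. -/
lemma act_eq_of_between (g : Γ) {x y m : V} (hx : α g x = x) (hy : α g y = y)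
    (hm : T.dist x m + T.dist m y = T.dist x y) : α g m = m := by
  have h1 := dist_act hT α g x m
  have h2 := dist_act hT α g m y
  rw [hx] at h1
  rw [hy] at h2
  exact eq_of_between_of_dist_eq hT (by omega) hm h1

include hT in
/-- Elements that fix two distinct vertices fix an edge. -/
lemma exists_adj_fixed {x y : V} (hxy : x ≠ y) :
    ∃ m, T.Adj x m ∧ ∀ g, α g x = x → α g y = y → α g m = m := by
  obtain ⟨m, h1, h2⟩ := exists_dist_eq_of_le hT (hT.connected.pos_dist_of_ne hxy)
  exact ⟨m, SimpleGraph.dist_eq_one_iff_adj.1 h1, fun g hx hy => act_eq_of_between hT α g hx hy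
    (by have := hT.connected.pos_dist_of_ne hxy; omega)⟩

include hT in
lemma mul_le_dist_pow {h : Γ} {v : V} {L : ℕ}
    (hd : ∀ i j : ℤ, (T.dist (α (h ^ i) v) (α (h ^ j) v) : ℤ) = |i - j| * L) (x : V) (n : ℕ) :
    n * L ≤ T.dist x (α (h ^ n) x) := by
  by_contra! hlt
  -- compare `x` with `v` at a large power of `h ^ n`
  set k := 2 * T.dist v x + 1
  have h1 := dist_act_pow_le hT α (h ^ n) x k
  have h2 := hd 0 ((n * k : ℕ) : ℤ)
  rw [zpow_zero, act_one, zpow_natCast, pow_mul] at h2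
  have h3 := tree_dist_triangle hT v x (α ((h ^ n) ^ k) v)
  have h4 := tree_dist_triangle hT x (α ((h ^ n) ^ k) x) (α ((h ^ n) ^ k) v)
  rw [dist_act hT α, T.dist_comm (u := x) (v := v)] at h4
  have h5 : k * T.dist x (α (h ^ n) x) + k ≤ n * L * k := by nlinarith
  have h6 : n * L * k = T.dist v (α ((h ^ n) ^ k) v) := by
    zify
    rw [h2]
    simp only [zero_sub, abs_neg, Nat.abs_cast]
    push_cast
    ring
  omega

section Height

variable {α} {χ : Γ →* Multiplicative ℤ} {η : V → ℤ} (hη : IsHeight α χ η)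
include hη

lemma IsHeight.abs_sub_le (hT : T.IsTree) (u v : V) : |η u - η v| ≤ T.dist u v := by
  obtain ⟨p, hp⟩ := hT.connected.exists_walk_length_eq_dist u v
  rw [← hp]
  clear hp
  induction p with
  | nil => simp
  | cons h p ih =>
    rw [SimpleGraph.Walk.length_cons]
    push_cast
    rcases hη.adj _ _ h with h | h <;> rw [_root_.abs_le] at * <;> omega

lemma IsHeight.abs_le_dist (hT : T.IsTree) (g : Γ) (v : V) :
    |(χ g).toAdd| ≤ T.dist v (α g v) := by
  have := hη.abs_sub_le hT (α g v) v
  rw [hη.equivariant, T.dist_comm] at this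
  simpa using this

lemma IsHeight.no_inversion (g : Γ) {x y : V} (h : T.Adj x y) : ¬ (α g x = y ∧ α g y = x) := by
  rintro ⟨h1, h2⟩
  have h3 := hη.equivariant g x
  have h4 := hη.equivariant g y
  rw [h1] at h3
  rw [h2] at h4
  rcases hη.adj _ _ h with h | h <;> omega

lemma IsHeight.eq_zero_of_bounded (hT : T.IsTree) (H : Subgroup Γ) {v : V} {C : ℕ}
    (hC : ∀ h ∈ H, T.dist v (α h v) ≤ C) {k : Γ} (hk : k ∈ H) : (χ k).toAdd = 0 := by
  by_contra h0
  have h1 := hη.abs_le_dist hT (k ^ (C + 1)) v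
  have h2 := hC _ (H.pow_mem hk (C + 1))
  rw [map_pow, toAdd_pow, nsmul_eq_mul, abs_mul] at h1
  have h3 : 1 ≤ |(χ k).toAdd| := Int.one_le_abs h0
  have h4 : ((C + 1 : ℕ) : ℤ) ≤ |((C + 1 : ℕ) : ℤ)| * |(χ k).toAdd| := by
    rw [abs_of_nonneg (by positivity)]
    exact le_mul_of_one_le_right (by positivity) h3
  push_cast at *
  omega

/-- A subgroup with a bounded orbit fixes a vertex, namely the center of the orbit. -/
lemma IsHeight.exists_fixed_of_bounded (hT : T.IsTree) (H : Subgroup Γ) {v : V} {C : ℕ}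
    (hC : ∀ h ∈ H, T.dist v (α h v) ≤ C) : ∃ x, ∀ h ∈ H, α h x = x := by
  classical
  have hne : ∃ n, ∃ x, ∀ h ∈ H, T.dist x (α h v) ≤ n := ⟨C, v, hC⟩
  obtain ⟨x, hx⟩ := Nat.find_spec hne
  refine ⟨x, fun k hk => ?_⟩
  by_contra hkx
  have hkx' : ∀ h ∈ H, T.dist (α k x) (α h v) ≤ Nat.find hne := fun h hh => by
    have := hx _ (H.mul_mem (H.inv_mem hk) hh)
    rwa [act_mul, T.dist_comm, dist_act_inv hT α, T.dist_comm] at this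
  have hpos := hT.connected.pos_dist_of_ne (Ne.symm hkx)
  by_cases h1 : T.dist x (α k x) = 1
  · -- adjacent centers would differ in height, but `k` preserves heights
    have h2 := hη.eq_zero_of_bounded hT H hC hk
    have h3 := hη.equivariant k x
    rcases hη.adj _ _ (SimpleGraph.dist_eq_one_iff_adj.1 h1) with h | h <;> omega
  · -- a vertex strictly between two centers has smaller eccentricity
    obtain ⟨m, hm1, hm2⟩ := exists_dist_eq_of_le hT (show 1 ≤ T.dist x (α k x) from hpos)
    have key : ∀ h ∈ H, T.dist m (α h v) + 1 ≤ Nat.find hne := fun h hh => by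
      have h3 := tree_four_point hT x m (α k x) (α h v)
      have h4 := hx h hh
      have h5 := hkx' h hh
      omega
    have h1' := key 1 H.one_mem
    have := Nat.find_min' hne (m := Nat.find hne - 1) ⟨m, fun h hh => by have := key h hh; omega⟩
    omega

lemma IsHeight.exists_fixed_of_finite (hT : T.IsTree) (H : Subgroup Γ) [Finite H] :
    ∃ x, ∀ h ∈ H, α h x = x := by
  obtain ⟨v⟩ := hT.connected.nonempty
  obtain ⟨C, hC⟩ := (Set.finite_range fun h : H => T.dist v (α h v)).bddAbove
  exact hη.exists_fixed_of_bounded hT H (v := v) (C := C) fun h hh => hC ⟨⟨h, hh⟩, rfl⟩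

lemma IsHeight.exists_fixed_of_isOfFinOrder (hT : T.IsTree) {g : Γ} (hg : IsOfFinOrder g) :
    ∃ x, α g x = x := by
  have : Finite (Subgroup.zpowers g) := by
    rwa [← SetLike.coe_sort_coe, Set.finite_coe_iff, finite_zpowers]
  obtain ⟨x, hx⟩ := hη.exists_fixed_of_finite hT (Subgroup.zpowers g)
  exact ⟨x, hx g (Subgroup.mem_zpowers g)⟩

lemma IsHeight.eq_zero_of_isOfFinOrder (hT : T.IsTree) {g : Γ} (hg : IsOfFinOrder g) :
    (χ g).toAdd = 0 := by
  obtain ⟨x, hx⟩ := hη.exists_fixed_of_isOfFinOrder hT hg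
  have := hη.equivariant g x
  rw [hx] at this
  omega

/-- An element without fixed vertices has an axis, on which it acts as a translation of positive
length: a vertex `v` of minimal displacement `L` lies on it. -/
lemma IsHeight.exists_axis (hT : T.IsTree) {h : Γ} (hh : ∀ x, α h x ≠ x) :
    ∃ (v : V) (L : ℕ), 0 < L ∧ (∀ x, L ≤ T.dist x (α h x)) ∧
      ∀ i j : ℤ, (T.dist (α (h ^ i) v) (α (h ^ j) v) : ℤ) = |i - j| * L := by
  classical
  obtain ⟨v₀⟩ := hT.connected.nonempty
  have hne : ∃ n, ∃ x, T.dist x (α h x) = n := ⟨_, v₀, rfl⟩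
  obtain ⟨v, hv⟩ := Nat.find_spec hne
  have hmin : ∀ x, Nat.find hne ≤ T.dist x (α h x) := fun x => Nat.find_min' hne ⟨x, rfl⟩
  generalize Nat.find hne = L at hv hmin
  have hL : 0 < L := hv ▸ hT.connected.pos_dist_of_ne (hh v).symm
  have hh1 : ∀ x y, T.dist (α h x) (α h y) = T.dist x y := dist_act hT α h
  have h2 : T.dist v (α h (α h v)) = 2 * L := by
    have hu := tree_dist_triangle hT v (α h v) (α h (α h v))
    rw [hh1, hv] at hu
    rcases Nat.lt_or_ge 1 L with h1 | h1
    · obtain ⟨w, hw1, hw2⟩ := exists_dist_eq_of_le hT (show 1 ≤ T.dist v (α h v) by omega)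
      have a1 := hmin w
      have a2 := tree_dist_triangle hT w (α h v) (α h w)
      rw [hh1] at a2
      have hne1 : α h v ≠ α h w := by
        intro he
        rw [← tree_dist_eq_zero hT, hh1] at he
        omega
      have a3 := dist_eq_of_overlap hT (x := w) (y := α h v) (z := α h w) (w := α h (α h v))
        (by rw [hh1]; omega) (by rw [hh1, hh1, hh1]; omega) hne1
      rw [hh1, hh1] at a3
      have hne2 : w ≠ α h v := by
        intro he
        rw [← tree_dist_eq_zero hT] at he
        omega
      have a4 := dist_eq_of_overlap hT (x := v) (y := w) (z := α h v) (w := α h (α h v))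
        (by omega) (by rw [hh1]; omega) hne2
      rw [hh1] at a4
      omega
    · have h3 : T.Adj v (α h v) := SimpleGraph.dist_eq_one_iff_adj.1 (by omega)
      have h4 := hη.equivariant h v
      have h5 := hη.equivariant h (α h v)
      have h6 := hη.abs_sub_le hT v (α h (α h v))
      rw [_root_.abs_le] at h6
      rcases hη.adj _ _ h3 with h | h <;> omega
  have hnat : ∀ n : ℕ, T.dist v (α (h ^ n) v) = n * L ∧
      T.dist v (α (h ^ (n + 1)) v) = (n + 1) * L := by
    intro n
    induction n with
    | zero => simp [hv]
    | succ n ih =>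
      refine ⟨ih.2, ?_⟩
      have e1 : ∀ m, α (h ^ (m + 1)) v = α (h ^ m) (α h v) := fun m => by rw [pow_succ, act_mul]
      have e2 : T.dist (α (h ^ n) v) (α (h ^ (n + 1)) v) = L := by
        rw [e1, dist_act hT α, hv]
      have e3 : T.dist (α (h ^ (n + 1)) v) (α (h ^ (n + 1 + 1)) v) = L := by
        rw [e1 (n + 1), dist_act hT α, hv]
      have e4 : T.dist (α (h ^ n) v) (α (h ^ (n + 1 + 1)) v) = 2 * L := by
        rw [e1 (n + 1), pow_succ, act_mul, dist_act hT α, h2]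
      have := dist_eq_of_overlap hT (x := v) (y := α (h ^ n) v) (z := α (h ^ (n + 1)) v)
        (w := α (h ^ (n + 1 + 1)) v) (by rw [ih.1, ih.2, e2]; ring) (by rw [e2, e3, e4]; ring)
        (by intro he; rw [← tree_dist_eq_zero hT] at he; omega)
      rw [this, ih.1, e2, e3]
      ring
  have hle : ∀ i j : ℤ, i ≤ j →
      (T.dist (α (h ^ i) v) (α (h ^ j) v) : ℤ) = |i - j| * L := by
    intro i j hij
    obtain ⟨n, rfl⟩ := Int.le.dest hij
    rw [zpow_add, act_mul, dist_act hT α, zpow_natCast, (hnat n).1]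
    simp
  refine ⟨v, L, hL, hmin, fun i j => ?_⟩
  rcases le_total i j with hij | hij
  · exact hle i j hij
  · rw [T.dist_comm, hle j i hij, abs_sub_comm]

/-- An element without fixed vertices moves the vertices away linearly. -/
lemma IsHeight.le_dist_pow (hT : T.IsTree) {h : Γ} (hh : ∀ x, α h x ≠ x) (x : V) (n : ℕ) :
    n ≤ T.dist x (α (h ^ n) x) := by
  obtain ⟨v, L, hL, -, hd⟩ := hη.exists_axis hT hh
  exact (Nat.le_mul_of_pos_right n hL).trans (mul_le_dist_pow hT α hd x n)

end Height

include hT in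
/-- A point in the middle of a geodesic also lies on a geodesic between points close to its ends. -/
lemma between_of_dist_lt {a b c d m : V} (h : T.dist a m + T.dist m d = T.dist a d)
    (h1 : T.dist a b < T.dist a m) (h2 : T.dist c d < T.dist m d) :
    T.dist b m + T.dist m c = T.dist b c := by
  rcases between_or_between hT h b with h3 | h3
  · omega
  · rcases between_or_between hT h3 c with h4 | h4
    · exact h4
    · omega

include hT in
/-- The vertices of minimal displacement of an element with an axis lie on a line, on which the
element acts as a translation. -/
lemma exists_axis_coordinate {h : Γ} {v : V} {L : ℕ} (hL : 0 < L)
    (hd : ∀ i j : ℤ, (T.dist (α (h ^ i) v) (α (h ^ j) v) : ℤ) = |i - j| * L) :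
    ∃ κ : V → ℤ, (∀ x y, T.dist x (α h x) = L → T.dist y (α h y) = L →
        (T.dist x y : ℤ) = |κ x - κ y|) ∧
      ∀ x, T.dist x (α h x) = L → κ (α h x) = κ x + L := by
  -- the coordinate is the Busemann function at the repelling end
  let b : ℕ → V → ℤ := fun n x => T.dist (α (h ^ (-n : ℤ)) v) x - n * L
  have hline : ∀ x, T.dist x (α h x) = L → ∀ n : ℕ, T.dist v x < n →
      T.dist (α (h ^ (-n : ℤ)) v) x + T.dist x (α (h ^ (n : ℤ)) v)
        = T.dist (α (h ^ (-n : ℤ)) v) (α (h ^ (n : ℤ)) v) := by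
    intro x hx n hn
    have e2 : T.dist x (α (h ^ n) x) = n * L :=
      le_antisymm (hx ▸ dist_act_pow_le hT α h x n) (mul_le_dist_pow hT α hd x n)
    have e1 : T.dist (α (h ^ n)⁻¹ x) x = n * L := by rw [dist_act_inv hT α, e2]
    have e3 : T.dist (α (h ^ n)⁻¹ x) (α (h ^ n) x) = (n + n) * L := by
      rw [dist_act_inv hT α, ← act_mul, ← pow_add]
      exact le_antisymm (hx ▸ dist_act_pow_le hT α h x (n + n)) (mul_le_dist_pow hT α hd x (n + n))
    have e4 : n ≤ n * L := Nat.le_mul_of_pos_right n hL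
    rw [zpow_neg, zpow_natCast]
    refine between_of_dist_lt hT (a := α (h ^ n)⁻¹ x) (d := α (h ^ n) x) ?_ ?_ ?_
    · rw [e1, e2, e3]; ring
    · rw [e1, dist_act hT α, T.dist_comm]; omega
    · rw [e2, dist_act hT α]; omega
  have hstab : ∀ x, T.dist x (α h x) = L → ∀ n : ℕ, T.dist v x < n → b (n + 1) x = b n x := by
    intro x hx n hn
    have h1 := hline x hx n hn
    have h2 := tree_dist_triangle hT (α (h ^ (-(n + 1 : ℕ) : ℤ)) v) x (α (h ^ (n : ℤ)) v)
    have h3 := tree_dist_triangle hT (α (h ^ (-(n + 1 : ℕ) : ℤ)) v) (α (h ^ (-n : ℤ)) v) x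
    zify at h1 h2 h3
    have a1 : |-(n : ℤ) - n| = n + n := by rw [abs_of_nonpos] <;> omega
    have a2 : |-((n : ℤ) + 1) - n| = n + n + 1 := by rw [abs_of_nonpos] <;> omega
    have a3 : |-((n : ℤ) + 1) - -n| = 1 := by rw [abs_of_nonpos] <;> omega
    rw [hd, a1] at h1
    rw [hd] at h2 h3
    rw [a2] at h2
    rw [a3] at h3
    simp only [b]
    push_cast
    linarith
  let κ : V → ℤ := fun x => b (T.dist v x + 1) x
  have hκ : ∀ x, T.dist x (α h x) = L → ∀ n : ℕ, T.dist v x + 1 ≤ n → κ x = b n x := by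
    intro x hx n hn
    induction n, hn using Nat.le_induction with
    | base => rfl
    | succ n hn ih => rw [ih, hstab x hx n hn]
  refine ⟨κ, fun x y hx hy => ?_, fun x hx => ?_⟩
  · set n := T.dist v x + T.dist v y + 1
    rw [hκ x hx n (by omega), hκ y hy n (by omega)]
    have h1 := hline x hx n (by omega)
    have h2 := hline y hy n (by omega)
    have h3 := tree_four_point hT (α (h ^ (-n : ℤ)) v) x (α (h ^ (n : ℤ)) v) y
    have h4 := tree_dist_triangle hT (α (h ^ (-n : ℤ)) v) x y
    have h5 := tree_dist_triangle hT (α (h ^ (-n : ℤ)) v) y x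
    rw [T.dist_comm (u := y) (v := x)] at h5
    rw [T.dist_comm (u := α (h ^ (n : ℤ)) v) (v := y)] at h3
    simp only [b, sub_sub_sub_cancel_right]
    rcases le_total (T.dist (α (h ^ (-n : ℤ)) v) x) (T.dist (α (h ^ (-n : ℤ)) v) y) with h6 | h6
    · rw [abs_of_nonpos (by omega)]; omega
    · rw [abs_of_nonneg (by omega)]; omega
  · set n := T.dist v x + T.dist v (α h x) + 1
    rw [hκ x hx (n + 1) (by omega), hκ (α h x) (by rw [dist_act hT α, hx]) n (by omega)]
    simp only [b]
    have : T.dist (α (h ^ (-n : ℤ)) v) (α h x) = T.dist (α (h ^ (-(n + 1 : ℕ) : ℤ)) v) x := by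
      rw [← dist_act hT α h (α (h ^ (-(n + 1 : ℕ) : ℤ)) v), ← act_mul, ← zpow_one_add]
      congr 4
    rw [this]
    push_cast
    ring

/-- The centralizer of an element without fixed vertices is cyclic if it acts freely: it acts on the
axis by translations. -/
lemma IsHeight.isCyclic_centralizer {χ : Γ →* Multiplicative ℤ} {η : V → ℤ} (hη : IsHeight α χ η)
    (hT : T.IsTree) {h : Γ} (hh : ∀ x, α h x ≠ x)
    (hfree : ∀ c x, Commute c h → α c x = x → c = 1) :
    ∃ z, Subgroup.centralizer {h} = Subgroup.zpowers z := by
  obtain ⟨v, L, hL, -, hd⟩ := hη.exists_axis hT hh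
  obtain ⟨κ, hκ, hκh⟩ := exists_axis_coordinate hT α hL hd
  have hv : T.dist v (α h v) = L := by
    have := hd 0 1
    rw [zpow_zero, act_one, zpow_one] at this
    simpa using this
  have hcomm : ∀ c ∈ Subgroup.centralizer {h}, ∀ x, α c (α h x) = α h (α c x) := by
    intro c hc x
    rw [← act_mul, ← act_mul, Subgroup.mem_centralizer_singleton_iff.1 hc]
  have hax : ∀ c ∈ Subgroup.centralizer {h}, ∀ x, T.dist x (α h x) = L →
      T.dist (α c x) (α h (α c x)) = L := by
    intro c hc x hx
    rw [← hcomm c hc, dist_act hT α, hx]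
  have hpow : ∀ x, T.dist x (α h x) = L → ∀ n : ℕ,
      T.dist (α (h ^ n) x) (α h (α (h ^ n) x)) = L ∧ κ (α (h ^ n) x) = κ x + n * L := by
    intro x hx n
    induction n with
    | zero => simp [hx]
    | succ n ih =>
      rw [pow_succ', act_mul, hκh _ ih.1, ih.2, dist_act hT α]
      refine ⟨ih.1, ?_⟩
      push_cast
      ring
  -- the displacement of `c` along the axis does not depend on the point
  have hshift : ∀ c ∈ Subgroup.centralizer {h}, ∀ x y, T.dist x (α h x) = L →
      T.dist y (α h y) = L → κ (α c x) - κ x = κ (α c y) - κ y := by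
    intro c hc x y hx hy
    obtain ⟨n, hn⟩ : ∃ n : ℕ, |κ x - κ y| + |κ (α c x) - κ (α c y)| ≤ n :=
      ⟨_, (Int.toNat_of_nonneg (by positivity)).ge⟩
    have hnL : (n : ℤ) ≤ n * L := le_mul_of_one_le_right (by positivity) (by exact_mod_cast hL)
    have hcn : α c (α (h ^ n) y) = α (h ^ n) (α c y) := by
      rw [← act_mul, ← act_mul, (show Commute c h from
        Subgroup.mem_centralizer_singleton_iff.1 hc).pow_right n |>.eq]
    have h1 := hκ (α (h ^ n) y) x (hpow y hy n).1 hx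
    have h2 := hκ (α c (α (h ^ n) y)) (α c x) (hax c hc _ (hpow y hy n).1) (hax c hc x hx)
    rw [dist_act hT α, h1, hcn, (hpow y hy n).2, (hpow _ (hax c hc y hy) n).2] at h2
    have b1 := le_abs_self (κ x - κ y)
    have b2 := le_abs_self (κ (α c x) - κ (α c y))
    have b3 := abs_nonneg (κ x - κ y)
    have b4 := abs_nonneg (κ (α c x) - κ (α c y))
    rw [abs_of_nonneg (by omega), abs_of_nonneg (by omega)] at h2
    omega
  let θ : Subgroup.centralizer {h} →* Multiplicative ℤ :=
    { toFun := fun c => Multiplicative.ofAdd (κ (α c v) - κ v)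
      map_one' := by
        change Multiplicative.ofAdd (κ (α 1 v) - κ v) = 1
        rw [act_one, sub_self]; rfl
      map_mul' := fun c d => by
        rw [← ofAdd_add, ← hshift c c.2 (α d v) v (hax d d.2 v hv) hv]
        change Multiplicative.ofAdd (κ (α (c * d) v) - κ v) = _
        rw [act_mul]
        congr 1
        ring }
  have hθ : Function.Injective θ := by
    rw [injective_iff_map_eq_one]
    intro c hc
    have h1 : κ (α c v) - κ v = 0 := hc
    have h2 := hκ (α c v) v (hax c c.2 v hv) hv
    rw [h1, abs_zero] at h2
    exact Subtype.ext (hfree c v (Subgroup.mem_centralizer_singleton_iff.1 c.2)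
      ((tree_dist_eq_zero hT).1 (by exact_mod_cast h2)))
  have : IsCyclic (Subgroup.centralizer {h}) := isCyclic_of_injective θ hθ
  obtain ⟨z, hz⟩ := (Subgroup.isCyclic_iff_exists_zpowers_eq_top _).1 this
  exact ⟨z, hz.symm⟩

end TreeActions

/-! ### Boundary points of quasi-lines -/

section QuasiLines

variable {X : Type*} [MetricSpace X]

/-- The point of the boundary represented by a sequence converging to infinity. -/
def boundaryPoint (u : SeqInfinity X) : Boundary X := Quot.mk _ u

lemma gromovProduct_comm (x y z : X) : gromovProduct x y z = gromovProduct y x z := by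
  simp only [gromovProduct, dist_comm x y]; ring

lemma gromovProduct_self (x z : X) : gromovProduct x x z = dist x z := by
  simp [gromovProduct]

lemma gromovProduct_le_base (x y z z' : X) :
    gromovProduct x y z ≤ gromovProduct x y z' + dist z z' := by
  have h1 := dist_triangle x z' z
  have h2 := dist_triangle y z' z
  rw [dist_comm z' z] at h1 h2
  simp only [gromovProduct]
  linarith

lemma gromovProduct_le_left (x x' y z : X) :
    gromovProduct x y z ≤ gromovProduct x' y z + dist x x' := by
  have h1 := dist_triangle x x' z
  have h2 := dist_triangle x' x y
  rw [dist_comm x' x] at h2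
  simp only [gromovProduct]
  linarith

lemma gromovProduct_le_right (x y y' z : X) :
    gromovProduct x y z ≤ gromovProduct x y' z + dist y y' := by
  simpa only [gromovProduct_comm x] using gromovProduct_le_left y y' x z

/-- Whether the Gromov products tend to infinity does not depend on the base point. -/
lemma tendsto_gromovProduct_of_base {ι : Type*} {l : Filter ι} {u v : ι → X} {o : X}
    (h : Tendsto (fun n => gromovProduct (u n) (v n) o) l atTop) (x : X) :
    Tendsto (fun n => gromovProduct (u n) (v n) x) l atTop := by
  refine tendsto_atTop_mono (fun n => ?_) (tendsto_atTop_add_const_right l (-dist o x) h)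
  have := gromovProduct_le_base (u n) (v n) o x
  linarith

lemma ConvergesToInfinity.tendsto_dist {u : ℕ → X} (h : ConvergesToInfinity u) (o : X) :
    Tendsto (fun n => dist (u n) o) atTop atTop := by
  simpa only [Function.comp_def, gromovProduct_self] using (h o).comp tendsto_atTop_diagonal

/-- In a hyperbolic space, being related is an equivalence relation on the sequences converging to
infinity. -/
lemma SeqInfinity.rel_equivalence {δ : ℝ} (hδ : ∀ x y z w : X,
    min (gromovProduct x y w) (gromovProduct y z w) ≤ gromovProduct x z w + δ) :
    Equivalence (SeqInfinity.Rel (X := X)) where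
  refl u x := (u.2 x).comp tendsto_atTop_diagonal
  symm {u v} h x := by simpa only [gromovProduct_comm] using h x
  trans {u v w} h1 h2 x := by
    rw [tendsto_atTop]
    intro b
    filter_upwards [tendsto_atTop.1 (h1 x) (b + δ), tendsto_atTop.1 (h2 x) (b + δ)] with n a1 a2
    have := hδ (u.1 n) (v.1 n) (w.1 n) x
    have := le_min a1 a2
    linarith

/-- A geodesic ray in steps of length `L` converges to infinity. -/
def raySequence (P : ℕ → X) {L : ℝ} (hL : 0 < L)
    (hP : ∀ i j : ℕ, dist (P i) (P j) = |(i : ℝ) - j| * L) : SeqInfinity X :=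
  ⟨P, tendsto_gromovProduct_of_base (o := P 0) (by
    have key : ∀ m : ℕ × ℕ, gromovProduct (P m.1) (P m.2) (P 0) = min (m.1 : ℝ) m.2 * L := by
      rintro ⟨i, j⟩
      simp only [gromovProduct, hP, Nat.cast_zero, sub_zero, Nat.abs_cast]
      rcases le_total (i : ℝ) j with h | h
      · rw [min_eq_left h, abs_of_nonpos (by linarith)]; ring
      · rw [min_eq_right h, abs_of_nonneg (by linarith)]; ring
    simp only [key]
    refine Tendsto.atTop_mul_const hL ?_
    rw [tendsto_atTop]
    intro b
    obtain ⟨N, hN⟩ := exists_nat_ge b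
    filter_upwards [eventually_ge_atTop (N, N)] with m hm
    exact hN.trans (le_min (Nat.cast_le.2 hm.1) (Nat.cast_le.2 hm.2)))⟩

section Line

variable (P : ℤ → X) {L : ℝ} (hL : 0 < L) (hP : ∀ i j : ℤ, dist (P i) (P j) = |(i : ℝ) - j| * L)

/-- The positive end of a line. -/
def lineTop : SeqInfinity X := raySequence (fun n => P n) hL fun i j => by simp [hP]

/-- The negative end of a line. -/
def lineBot : SeqInfinity X := raySequence (fun n => P (-n)) hL fun i j => by
  rw [hP, abs_sub_comm]
  push_cast
  ring_nf

include hP in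
lemma gromovProduct_line (i j : ℤ) :
    gromovProduct (P i) (P j) (P 0) = (|(i : ℝ)| + |(j : ℝ)| - |(i : ℝ) - j|) / 2 * L := by
  simp only [gromovProduct, hP, Int.cast_zero, sub_zero]
  ring

lemma not_rel_lineTop_lineBot : ¬ SeqInfinity.Rel (lineTop P hL hP) (lineBot P hL hP) := by
  intro h
  have h1 := h (P 0)
  have h2 : ∀ n : ℕ, gromovProduct ((lineTop P hL hP).1 n) ((lineBot P hL hP).1 n) (P 0) = 0 := by
    intro n
    change gromovProduct (P n) (P (-n)) (P 0) = 0
    rw [gromovProduct_line P hP]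
    push_cast
    rw [abs_neg, Nat.abs_cast, abs_of_nonneg (by linarith [n.cast_nonneg (α := ℝ)])]
    ring
  simp only [h2] at h1
  obtain ⟨n, hn⟩ := (tendsto_atTop.1 h1 1).exists
  linarith

lemma rel_lineTop {u : SeqInfinity X} {C : ℝ} {m : ℕ → ℤ} (hm : ∀ n, dist (u.1 n) (P (m n)) ≤ C)
    (hpos : ∀ᶠ n in atTop, 0 ≤ m n) : SeqInfinity.Rel u (lineTop P hL hP) := by
  refine fun x => tendsto_gromovProduct_of_base (o := P 0) ?_ x
  rw [tendsto_atTop]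
  intro b
  obtain ⟨N, hN⟩ := exists_nat_ge ((b + C) / L)
  filter_upwards [hpos, eventually_ge_atTop N,
    tendsto_atTop.1 (u.2.tendsto_dist (P 0)) (b + C + C)] with n h1 h2 h3
  have h1' : (0 : ℝ) ≤ m n := by exact_mod_cast h1
  have h4 : b + C ≤ m n * L := by
    have e1 := dist_triangle (u.1 n) (P (m n)) (P 0)
    rw [hP (m n) 0, Int.cast_zero, sub_zero, abs_of_nonneg h1'] at e1
    linarith [hm n]
  have h5 : b + C ≤ n * L := by
    rw [div_le_iff₀ hL] at hN
    exact hN.trans (mul_le_mul_of_nonneg_right (by exact_mod_cast h2) hL.le)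
  have h6 := gromovProduct_le_left (P (m n)) (u.1 n) (P n) (P 0)
  rw [gromovProduct_line P hP, dist_comm] at h6
  have h7 : b + C ≤ (|(m n : ℝ)| + |((n : ℤ) : ℝ)| - |(m n : ℝ) - (n : ℤ)|) / 2 * L := by
    rw [abs_of_nonneg h1', Int.cast_natCast, Nat.abs_cast]
    rcases le_total (m n : ℝ) n with h | h
    · rw [abs_of_nonpos (by linarith)]; linarith
    · rw [abs_of_nonneg (by linarith)]; linarith
  have h8 : b ≤ gromovProduct (u.1 n) (P n) (P 0) := by linarith [hm n]
  exact h8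

/-- A set at bounded distance from a line accumulates only at the two ends of the line. -/
lemma boundaryOf_subset_ends {Y : Set X} {C : ℝ} (hY : ∀ y ∈ Y, ∃ i : ℤ, dist y (P i) ≤ C) :
    boundaryOf Y ⊆ {boundaryPoint (lineTop P hL hP), boundaryPoint (lineBot P hL hP)} := by
  rintro _ ⟨u, hu, rfl⟩
  choose m hm using fun n => hY _ (hu n)
  obtain ⟨N, hN⟩ := ((tendsto_atTop.1 (u.2 (P 0)) (2 * C + 1))).exists_forall_of_atTop
  have hsign : ∀ i ≥ N.1 ⊔ N.2, ∀ j ≥ N.1 ⊔ N.2, 0 ≤ m i → 0 ≤ m j := by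
    intro i hi j hj h0
    by_contra! hneg
    have h1 := hN (i, j) ⟨le_trans le_sup_left hi, le_trans le_sup_right hj⟩
    have h2 := gromovProduct_le_left (u.1 i) (P (m i)) (u.1 j) (P 0)
    have h3 := gromovProduct_le_right (P (m i)) (u.1 j) (P (m j)) (P 0)
    have h0' : (0 : ℝ) ≤ m i := by exact_mod_cast h0
    have hneg' : (m j : ℝ) < 0 := by exact_mod_cast hneg
    rw [gromovProduct_line P hP, abs_of_nonneg h0', abs_of_neg hneg',
      abs_of_nonneg (by linarith)] at h3
    have h4 := hm i
    have h5 := hm j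
    simp only at h1
    ring_nf at h3
    linarith
  rcases le_or_gt 0 (m (N.1 ⊔ N.2)) with h | h
  · refine Or.inl (Quot.sound (rel_lineTop P hL hP hm ?_))
    filter_upwards [eventually_ge_atTop (N.1 ⊔ N.2)] with j hj
    exact hsign _ le_rfl j hj h
  · refine Or.inr (Quot.sound ?_)
    have hP' : ∀ i j : ℤ, dist (P (-i)) (P (-j)) = |(i : ℝ) - j| * L := fun i j => by
      rw [hP, abs_sub_comm]; push_cast; ring_nf
    refine rel_lineTop (fun i => P (-i)) hL hP' (m := fun n => -m n)
      (fun n => by simpa using hm n) ?_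
    filter_upwards [eventually_ge_atTop (N.1 ⊔ N.2)] with j hj
    by_contra! hcon
    have := hsign j hj _ le_rfl (by omega)
    omega

end Line

lemma boundaryOf_eq_empty {Y : Set X} (hY : Bornology.IsBounded Y) : boundaryOf Y = ∅ := by
  rw [Set.eq_empty_iff_forall_notMem]
  rintro _ ⟨u, hu, rfl⟩
  obtain ⟨C, hC⟩ := hY.subset_closedBall (u.1 0)
  obtain ⟨n, hn⟩ := (tendsto_atTop.1 (u.2.tendsto_dist (u.1 0)) (C + 1)).exists
  have := hC (hu n)
  rw [Metric.mem_closedBall] at this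
  linarith

end QuasiLines

/-! ### Limit sets -/

section LimitSets

variable {Γ : Type*} [Group Γ] {X : Type*} [MetricSpace X] (ρ : Γ →* (X ≃ᵢ X))

lemma rho_mul (g h : Γ) (x : X) : ρ (g * h) x = ρ g (ρ h x) := by
  rw [map_mul]; rfl

lemma dist_rho (g : Γ) (x y : X) : dist (ρ g x) (ρ g y) = dist x y := (ρ g).dist_eq x y

lemma isBounded_orbitOf {H : Subgroup Γ} {o : X} {C : ℝ} (hC : ∀ h ∈ H, dist o (ρ h o) ≤ C)
    (x : X) : Bornology.IsBounded (orbitOf ρ H x) := by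
  refine (Metric.isBounded_closedBall (x := o) (r := dist x o + C)).subset ?_
  rintro _ ⟨h, hh, rfl⟩
  have h1 := dist_triangle (ρ h x) (ρ h o) o
  rw [dist_rho, dist_comm (ρ h o)] at h1
  exact h1.trans (by linarith [hC h hh])

lemma limitSet_eq_empty {H : Subgroup Γ} {o : X} {C : ℝ} (hC : ∀ h ∈ H, dist o (ρ h o) ≤ C) :
    limitSet ρ H = ∅ := by
  simp only [limitSet, boundaryOf_eq_empty (isBounded_orbitOf ρ hC _), Set.iUnion_empty]

lemma isElementary_of_fixed {H : Subgroup Γ} {o : X} (h : ∀ h ∈ H, ρ h o = o) :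
    IsElementary ρ H := by
  rw [IsElementary, limitSet_eq_empty ρ (o := o) (C := 0) fun g hg => by simp [h g hg]]
  simp

lemma limitSet_subset_ends {H : Subgroup Γ} (P : ℤ → X) {L : ℝ} (hL : 0 < L)
    (hP : ∀ i j : ℤ, dist (P i) (P j) = |(i : ℝ) - j| * L) {o : X} {C : ℝ}
    (hH : ∀ h ∈ H, ∃ i : ℤ, dist (ρ h o) (P i) ≤ C) :
    limitSet ρ H ⊆ {boundaryPoint (lineTop P hL hP), boundaryPoint (lineBot P hL hP)} := by
  refine Set.iUnion_subset fun x => boundaryOf_subset_ends P hL hP (C := dist x o + C) ?_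
  rintro _ ⟨h, hh, rfl⟩
  obtain ⟨i, hi⟩ := hH h hh
  have := dist_triangle (ρ h x) (ρ h o) (P i)
  rw [dist_rho] at this
  exact ⟨i, by linarith⟩

lemma smul_limitSet_subset {H : Subgroup Γ} {h : Γ} (hh : h ∈ H) :
    ρ h • limitSet ρ H ⊆ limitSet ρ H := by
  rintro _ ⟨ξ, hξ, rfl⟩
  obtain ⟨x, u, hu, rfl⟩ := Set.mem_iUnion.1 hξ
  refine Set.mem_iUnion.2 ⟨x, SeqInfinity.map (ρ h) u, fun n => ?_, rfl⟩
  obtain ⟨k, hk, hkx⟩ := hu n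
  refine ⟨h * k, H.mul_mem hh hk, ?_⟩
  change ρ (h * k) x = ρ h (u.1 n)
  rw [← hkx, rho_mul]

lemma mem_maximalLoxodromic (g : Γ) : g ∈ maximalLoxodromic ρ g := by
  change ρ g • limitSet ρ (Subgroup.zpowers g) = limitSet ρ (Subgroup.zpowers g)
  refine (smul_limitSet_subset ρ (Subgroup.mem_zpowers g)).antisymm ?_
  rw [Set.subset_smul_set_iff, ← map_inv]
  exact smul_limitSet_subset ρ (inv_mem (Subgroup.mem_zpowers g))

lemma translationLength_le (g : Γ) (x : X) : translationLength ρ g ≤ dist x (ρ g x) :=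
  ciInf_le ⟨0, by rintro _ ⟨y, rfl⟩; exact dist_nonneg⟩ x

lemma axis_eq_fixed {g : Γ} (hg : translationLength ρ g ≤ 0) {x : X} (hx : x ∈ axis ρ g) :
    ρ g x = x := by
  have h : dist x (ρ g x) = translationLength ρ g := hx
  exact (dist_le_zero.1 (h ▸ hg)).symm

lemma Omega_eq_zero : Omega ρ = 0 := by
  rw [Omega, ← nonpos_iff_eq_zero]
  refine iSup₂_le fun a ha => ?_
  -- a common point of the axes would be fixed by the group, so the intersection is empty
  rw [nonpos_iff_eq_zero, Metric.ediam_eq_zero_iff]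
  intro x hx
  refine absurd (isElementary_of_fixed ρ (o := x) fun h hh => ?_) ha.1
  induction hh using Subgroup.closure_induction with
  | mem _ hg =>
    obtain ⟨j, rfl⟩ := hg
    exact axis_eq_fixed ρ (ha.2 j) (Set.mem_iInter.1 hx j)
  | one => rw [map_one]; rfl
  | mul g k _ _ hg hk => rw [rho_mul, hk, hg]
  | inv g _ hg =>
    conv_lhs => rw [← hg, ← rho_mul, inv_mul_cancel, map_one]
    rfl

lemma two_lt_encard {ι : Type*} {s : Set ι} {a b c : ι} (ha : a ∈ s) (hb : b ∈ s) (hc : c ∈ s)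
    (hab : a ≠ b) (hac : a ≠ c) (hbc : b ≠ c) : 2 < s.encard := by
  have hsub : {a, b, c} ⊆ s := by
    rintro _ (rfl | rfl | rfl)
    exacts [ha, hb, hc]
  have h3 := Set.encard_le_encard hsub
  rw [Set.encard_insert_of_notMem (by simp [hab, hac]), Set.encard_pair hbc] at h3
  exact lt_of_lt_of_le (by decide) h3

lemma not_isElementary {H : Subgroup Γ} {δ : ℝ} (hδ : ∀ x y z w : X,
    min (gromovProduct x y w) (gromovProduct y z w) ≤ gromovProduct x z w + δ) {o : X}
    {u v w : SeqInfinity X} (hu : ∀ n, u.1 n ∈ orbitOf ρ H o) (hv : ∀ n, v.1 n ∈ orbitOf ρ H o)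
    (hw : ∀ n, w.1 n ∈ orbitOf ρ H o) (huv : ¬ SeqInfinity.Rel u v) (huw : ¬ SeqInfinity.Rel u w)
    (hvw : ¬ SeqInfinity.Rel v w) : ¬ IsElementary ρ H := by
  have hE := SeqInfinity.rel_equivalence hδ
  have hmem : ∀ s : SeqInfinity X, (∀ n, s.1 n ∈ orbitOf ρ H o) →
      boundaryPoint s ∈ limitSet ρ H := fun s hs => Set.mem_iUnion.2 ⟨o, s, hs, rfl⟩
  have hne : ∀ s t : SeqInfinity X, ¬ SeqInfinity.Rel s t →
      boundaryPoint s ≠ boundaryPoint t := fun s t h he =>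
    h (hE.eqvGen_iff.1 (Quot.eqvGen_exact he))
  exact not_le.2 (two_lt_encard (hmem u hu) (hmem v hv) (hmem w hw) (hne u v huv) (hne u w huw)
    (hne v w hvw))

end LimitSets

/-! ### Actions on the realization of a tree -/

section TreeRealization

variable {V : Type*} {T : SimpleGraph V} (hT : T.IsTree)

lemma encard_pair_le_two {ι : Type*} (a b : ι) : ({a, b} : Set ι).encard ≤ 2 := by
  refine (Set.encard_insert_le _ _).trans ?_
  rw [Set.encard_singleton]
  rfl

lemma dist_vertex_vertex (u v : V) :
    dist (Realization.vertex hT u) (Realization.vertex hT v) = T.dist u v :=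
  Realization.dist_vertex hT _ v

lemma exists_vertex_dist_le (x : Realization hT) : ∃ u, dist x (Realization.vertex hT u) ≤ 1 := by
  obtain ⟨u, v, t, huv, h0, h1, hx⟩ := x.exists_edge
  refine ⟨u, ?_⟩
  rw [Realization.dist_vertex, hx]
  have : (T.dist v u : ℝ) ≤ 1 := by
    rcases huv with rfl | huv
    · simp
    · exact_mod_cast (SimpleGraph.dist_eq_one_iff_adj.2 huv.symm).le
  simp only [edgePoint, SimpleGraph.dist_self, Nat.cast_zero, mul_zero, zero_add]
  exact mul_le_one₀ h1 (Nat.cast_nonneg _) this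

lemma gromovProduct_vertex (x y z w : V) :
    min (gromovProduct (Realization.vertex hT x) (Realization.vertex hT y) (Realization.vertex hT w))
      (gromovProduct (Realization.vertex hT y) (Realization.vertex hT z) (Realization.vertex hT w))
      ≤ gromovProduct (Realization.vertex hT x) (Realization.vertex hT z)
        (Realization.vertex hT w) := by
  have h := tree_four_point hT x y z w
  rw [T.dist_comm (u := x) (v := y)] at h
  simp only [gromovProduct, dist_vertex_vertex, T.dist_comm (u := x) (v := y)]
  rcases le_max_iff.1 h with h | h
  · refine (min_le_left _ _).trans ?_
    have h' : (T.dist x z + T.dist y w : ℝ) ≤ T.dist y x + T.dist z w := by exact_mod_cast h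
    linarith
  · refine (min_le_right _ _).trans ?_
    have h' : (T.dist x z + T.dist y w : ℝ) ≤ T.dist x w + T.dist y z := by exact_mod_cast h
    linarith

/-- The realization of a tree is hyperbolic, since it is at distance one from its vertices. (The
constant is not optimal.) -/
lemma realization_hyperbolic (x y z w : Realization hT) :
    min (gromovProduct x y w) (gromovProduct y z w) ≤ gromovProduct x z w + 6 := by
  obtain ⟨x', hx⟩ := exists_vertex_dist_le hT x
  obtain ⟨y', hy⟩ := exists_vertex_dist_le hT y
  obtain ⟨z', hz⟩ := exists_vertex_dist_le hT z
  obtain ⟨w', hw⟩ := exists_vertex_dist_le hT w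
  have key : ∀ (a b c a' b' c' : Realization hT), dist a a' ≤ 1 → dist b b' ≤ 1 → dist c c' ≤ 1 →
      gromovProduct a b c ≤ gromovProduct a' b' c' + 3 := by
    intro a b c a' b' c' h1 h2 h3
    have e1 := gromovProduct_le_left a a' b c
    have e2 := gromovProduct_le_right a' b b' c
    have e3 := gromovProduct_le_base a' b' c c'
    linarith
  have h := gromovProduct_vertex hT x' y' z' w'
  have h1 := key _ _ _ _ _ _ hx hy hw
  have h2 := key _ _ _ _ _ _ hy hz hw
  rw [dist_comm] at hx hz hw
  have h3 := key _ _ _ _ _ _ hx hz hw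
  rcases min_le_iff.1 h with h | h
  · exact (min_le_left _ _).trans (by linarith)
  · exact (min_le_right _ _).trans (by linarith)

variable {Γ : Type*} [Group Γ] (α : Γ →* (T ≃g T))

lemma treeAction_vertex (g : Γ) (u : V) :
    treeAction hT α g (Realization.vertex hT u) = Realization.vertex hT (α g u) :=
  realizationHom_vertex hT (α g) u

variable {α} {χ : Γ →* Multiplicative ℤ} {η : V → ℤ} (hη : IsHeight α χ η)
include hη

lemma IsHeight.exists_fixed_of_isEllipticSubgroup {H : Subgroup Γ}
    (hH : IsEllipticSubgroup (treeAction hT α) H) : ∃ x, ∀ h ∈ H, α h x = x := by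
  obtain ⟨v⟩ := hT.connected.nonempty
  obtain ⟨C, hC⟩ := (hH (Realization.vertex hT v)).subset_closedBall (Realization.vertex hT v)
  obtain ⟨N, hN⟩ := exists_nat_ge C
  refine hη.exists_fixed_of_bounded hT H (v := v) (C := N) fun h hh => ?_
  have h1 := hC ⟨h, hh, rfl⟩
  rw [Metric.mem_closedBall, dist_comm] at h1
  change dist _ (treeAction hT α h (Realization.vertex hT v)) ≤ C at h1
  rw [treeAction_vertex, dist_vertex_vertex] at h1
  exact_mod_cast h1.trans hN

/-- The limit set of a group that is contained in the union of two cosets of a cyclic group generated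
by an element `h` without fixed vertices consists of at most two points, the ends of the axis. -/
lemma IsHeight.isElementary_of_zpow {h : Γ} (hh : ∀ x, α h x ≠ x) {H : Subgroup Γ} {g : Γ}
    (hH : ∀ k ∈ H, ∃ n : ℤ, k = h ^ n ∨ k = h ^ n * g) : IsElementary (treeAction hT α) H := by
  obtain ⟨v, L, hL, -, hd⟩ := hη.exists_axis hT hh
  have hP : ∀ i j : ℤ, dist (Realization.vertex hT (α (h ^ i) v))
      (Realization.vertex hT (α (h ^ j) v)) = |(i : ℝ) - j| * (L : ℝ) := fun i j => by
    rw [dist_vertex_vertex]; exact_mod_cast hd i j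
  refine (Set.encard_le_encard (limitSet_subset_ends _ _ (Nat.cast_pos.2 hL) hP
    (o := Realization.vertex hT v) (C := T.dist (α g v) v) fun k hk => ?_)).trans
    (encard_pair_le_two _ _)
  obtain ⟨n, rfl | rfl⟩ := hH k hk
  · exact ⟨n, by rw [treeAction_vertex, dist_self]; positivity⟩
  · exact ⟨n, by rw [treeAction_vertex, dist_vertex_vertex, act_mul, dist_act hT α]⟩

/-- The loxodromic elements are those without fixed vertices. -/
lemma IsHeight.isLoxodromic_iff {h : Γ} :
    IsLoxodromic (treeAction hT α) h ↔ ∀ x, α h x ≠ x := by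
  constructor
  · intro hl x hx
    have : limitSet (treeAction hT α) (Subgroup.zpowers h) = ∅ := by
      refine limitSet_eq_empty _ (o := Realization.vertex hT x) (C := 0) ?_
      rintro _ ⟨n, rfl⟩
      change dist _ (treeAction hT α (h ^ n) _) ≤ 0
      rw [treeAction_vertex, act_zpow_of_fixed α hx n, dist_self]
    rw [IsLoxodromic, this] at hl
    simp at hl
  · intro hh
    obtain ⟨v, L, hL, -, hd⟩ := hη.exists_axis hT hh
    have hP : ∀ i j : ℤ, dist (Realization.vertex hT (α (h ^ i) v))
        (Realization.vertex hT (α (h ^ j) v)) = |(i : ℝ) - j| * (L : ℝ) := fun i j => by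
      rw [dist_vertex_vertex]; exact_mod_cast hd i j
    have hL' : (0 : ℝ) < L := Nat.cast_pos.2 hL
    have hsub := limitSet_subset_ends (treeAction hT α) (H := Subgroup.zpowers h) _ hL' hP
      (o := Realization.vertex hT v) (C := 0) (by
        rintro _ ⟨n, rfl⟩
        exact ⟨n, (dist_eq_zero.2 (treeAction_vertex hT α _ v)).le⟩)
    have hsup : {boundaryPoint (lineTop _ hL' hP), boundaryPoint (lineBot _ hL' hP)} ⊆
        limitSet (treeAction hT α) (Subgroup.zpowers h) := by
      rintro _ (rfl | rfl) <;>
      refine Set.mem_iUnion.2 ⟨Realization.vertex hT v, _, fun n => ?_, rfl⟩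
      · exact ⟨h ^ (n : ℤ), ⟨n, rfl⟩, treeAction_vertex hT α _ v⟩
      · exact ⟨h ^ (-n : ℤ), ⟨-n, rfl⟩, treeAction_vertex hT α _ v⟩
    rw [IsLoxodromic, hsub.antisymm hsup]
    refine Set.encard_pair fun he => not_rel_lineTop_lineBot _ hL' hP ?_
    exact (SeqInfinity.rel_equivalence (realization_hyperbolic hT)).eqvGen_iff.1
      (Quot.eqvGen_exact he)

/-- The translation length is at least the change in height. -/
lemma IsHeight.le_translationLength (g : Γ) :
    |((χ g).toAdd : ℝ)| ≤ translationLength (treeAction hT α) g := by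
  obtain ⟨v⟩ := hT.connected.nonempty
  have : Nonempty (Realization hT) := ⟨Realization.vertex hT v⟩
  refine le_ciInf fun x => ?_
  set ρ := treeAction hT α
  set o := Realization.vertex hT v
  have h1 : ∀ n : ℕ, dist x (ρ (g ^ n) x) ≤ n * dist x (ρ g x) := by
    intro n
    induction n with
    | zero => simp
    | succ n ih =>
      have e1 := dist_triangle x (ρ (g ^ n) x) (ρ (g ^ (n + 1)) x)
      have e2 : dist (ρ (g ^ n) x) (ρ (g ^ (n + 1)) x) = dist x (ρ g x) := by
        rw [pow_succ, rho_mul, dist_rho]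
      push_cast
      linarith
  have h2 : ∀ n : ℕ, n * |((χ g).toAdd : ℝ)| ≤ dist o (ρ (g ^ n) o) := by
    intro n
    rw [treeAction_vertex, dist_vertex_vertex]
    have := hη.abs_le_dist hT (g ^ n) v
    rw [map_pow, toAdd_pow, nsmul_eq_mul, abs_mul, Nat.abs_cast] at this
    exact_mod_cast this
  -- the displacement of `x` by `g ^ n` is at most `n` times that by `g`
  by_contra! hlt
  obtain ⟨n, hn⟩ := exists_nat_gt
    (2 * dist o x / (|((χ g).toAdd : ℝ)| - dist x (ρ g x)))
  rw [div_lt_iff₀ (by linarith)] at hn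
  have h3 := dist_triangle o x (ρ (g ^ n) o)
  have h4 := dist_triangle x (ρ (g ^ n) x) (ρ (g ^ n) o)
  rw [dist_rho, dist_comm x o] at h4
  linarith [h1 n, h2 n]

end TreeRealization

/-! ### The affine group of the line -/

section Affine

variable {p : ℕ} [Fact p.Prime]

lemma AGL1_apply (e : AGL1 p) (x : ZMod p) : e x = (e 1 - e 0) * x + e 0 := by
  have h : ∀ y : ZMod p, e y = y * e.linear 1 + e 0 := fun y => by
    have h1 := e.map_vadd 0 y
    have h2 := e.linear.map_smul y 1
    simp only [smul_eq_mul, mul_one, vadd_eq_add, add_zero] at h1 h2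
    rw [h1, h2]
  rw [h x, h 1]
  ring

/-- An affine map of the line is given by its slope and its value at the origin. -/
def AGL1Equiv : AGL1 p ≃ (ZMod p)ˣ × ZMod p where
  toFun e := (Units.mk0 (e 1 - e 0) (sub_ne_zero.2 fun h => one_ne_zero (e.injective h)), e 0)
  invFun x :=
    { toFun := fun y => x.1 * y + x.2
      invFun := fun y => x.1⁻¹ * (y - x.2)
      left_inv := fun y => by beta_reduce; rw [add_sub_cancel_right, Units.inv_mul_cancel_left]
      right_inv := fun y => by beta_reduce; rw [Units.mul_inv_cancel_left, sub_add_cancel]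
      linear := LinearEquiv.smulOfUnit x.1
      map_vadd' := fun y v => by
        simp only [vadd_eq_add, LinearEquiv.smulOfUnit]
        change (x.1 : ZMod p) * (v + y) + x.2 = x.1 * v + (x.1 * y + x.2)
        ring }
  left_inv e := AffineEquiv.ext fun y => (AGL1_apply e y).symm
  right_inv x := by
    refine Prod.ext (Units.ext ?_) ?_
    · change (x.1 : ZMod p) * 1 + x.2 - (x.1 * 0 + x.2) = x.1
      ring
    · change (x.1 : ZMod p) * 0 + x.2 = x.2
      ring

lemma card_AGL1 : Nat.card (AGL1 p) = (p - 1) * p := by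
  rw [Nat.card_congr AGL1Equiv, Nat.card_prod, Nat.card_eq_fintype_card, ZMod.card_units,
    Nat.card_zmod]

lemma AGL1_pow_apply (x : AGL1 p) (k : ℕ) :
    (x ^ k) 1 - (x ^ k) 0 = (x 1 - x 0) ^ k := by
  induction k with
  | zero => simp
  | succ k ih =>
    rw [pow_succ' x, AffineEquiv.mul_def, AffineEquiv.trans_apply, AffineEquiv.trans_apply,
      AGL1_apply x ((x ^ k) 1), AGL1_apply x ((x ^ k) 0), pow_succ', ← ih]
    ring

/-- The elements of order `p` of the affine group, being translations of the line, generate normal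
subgroups. -/
lemma AGL1_conj_mem_zpowers {x : AGL1 p} (hx : x ^ p = 1) (g : AGL1 p) :
    g * x * g⁻¹ ∈ Subgroup.zpowers x := by
  have hslope : x 1 - x 0 = 1 := by
    have := AGL1_pow_apply x p
    rw [hx, ZMod.pow_card] at this
    rw [← this]
    simp
  have hadd : ∀ (k : ℕ) (y : ZMod p), (x ^ k) y = y + k * x 0 := by
    intro k
    induction k with
    | zero => simp
    | succ k ih =>
      intro y
      rw [pow_succ', AffineEquiv.mul_def, AffineEquiv.trans_apply, ih, AGL1_apply x, hslope]
      push_cast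
      ring
  refine ⟨((g 1 - g 0).val : ℕ), ?_⟩
  change x ^ (((g 1 - g 0).val : ℕ) : ℤ) = _
  rw [zpow_natCast, eq_mul_inv_iff_mul_eq]
  ext y
  rw [AffineEquiv.mul_def, AffineEquiv.trans_apply, AffineEquiv.mul_def, AffineEquiv.trans_apply,
    hadd, ZMod.natCast_zmod_val, AGL1_apply g y, AGL1_apply g (x y), AGL1_apply x y, hslope]
  ring

end Affine

/-! ### Pairs of involutions -/

section Involutions

variable {G : Type*} [Group G]

lemma isInvolution_iff {g : G} : IsInvolution g ↔ g * g = 1 ∧ g ≠ 1 := by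
  rw [IsInvolution, orderOf_eq_prime_iff, sq]

lemma IsInvolution.mul_self {g : G} (h : IsInvolution g) : g * g = 1 := (isInvolution_iff.1 h).1

lemma IsInvolution.ne_one {g : G} (h : IsInvolution g) : g ≠ 1 := (isInvolution_iff.1 h).2

lemma IsInvolution.inv_eq {g : G} (h : IsInvolution g) : g⁻¹ = g :=
  inv_eq_of_mul_eq_one_left h.mul_self

lemma IsInvolution.isOfFinOrder {g : G} (h : IsInvolution g) : IsOfFinOrder g :=
  orderOf_pos_iff.1 (by rw [show orderOf g = 2 from h]; norm_num)

lemma isInvolution_map {G' : Type*} [Group G'] {f : G →* G'} (hf : Function.Injective f) {g : G} :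
    IsInvolution (f g) ↔ IsInvolution g := by
  rw [IsInvolution, IsInvolution, orderOf_injective f hf]

lemma isInvolution_conj {g : G} (γ : G) : IsInvolution (γ * g * γ⁻¹) ↔ IsInvolution g :=
  isInvolution_map (f := (MulAut.conj γ).toMonoidHom) (MulAut.conj γ).injective

lemma isInvolutionPair_map {G' : Type*} [Group G'] {f : G →* G'} (hf : Function.Injective f)
    {r s : G} : IsInvolutionPair (f r) (f s) ↔ IsInvolutionPair r s := by
  rw [IsInvolutionPair, IsInvolutionPair, isInvolution_map hf, isInvolution_map hf, hf.ne_iff]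

lemma IsInvolutionPair.mul_ne_one {r s : G} (h : IsInvolutionPair r s) : r * s ≠ 1 := fun h1 =>
  h.2.2 ((eq_inv_of_mul_eq_one_left h1).trans h.2.1.inv_eq)

lemma IsInvolution.mul_mul_left {r s : G} (hr : IsInvolution r) (hs : IsInvolution s) :
    r * (r * s) * r = (r * s)⁻¹ := by
  rw [mul_inv_rev, hr.inv_eq, hs.inv_eq, ← mul_assoc, hr.mul_self, one_mul]

/-- The homomorphism `k ↦ z ^ k` on `ℤ/n`, for an element `z` with `z ^ n = 1`. -/
def zmodPowHom (z : G) (n : ℕ) (hn : z ^ n = 1) : ZMod n →+ Additive G :=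
  ZMod.lift n ⟨zmultiplesHom (Additive G) (Additive.ofMul z), by
    rw [zmultiplesHom_apply, natCast_zsmul, ← ofMul_pow, hn, ofMul_one]⟩

lemma zmodPowHom_intCast (z : G) (n : ℕ) (hn : z ^ n = 1) (k : ℤ) :
    (zmodPowHom z n hn k).toMul = z ^ k := by
  rw [zmodPowHom, ZMod.lift_coe]
  rfl

/-- The homomorphism from a dihedral group that maps two generating reflections to the involutions
`r` and `s`. -/
def dihedralHom {r s : G} (hr : IsInvolution r) (hs : IsInvolution s) (n : ℕ)
    (hn : (r * s) ^ n = 1) : DihedralGroup n →* G :=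
  let c := zmodPowHom (r * s) n hn
  have hc : ∀ i, r * (c i).toMul * r = (c (-i)).toMul := fun i => by
    obtain ⟨k, rfl⟩ := ZMod.intCast_surjective i
    rw [← Int.cast_neg, zmodPowHom_intCast, zmodPowHom_intCast]
    have := conj_zpow (a := r) (b := r * s) (i := k)
    rw [hr.inv_eq, hr.mul_mul_left hs, inv_zpow'] at this
    exact this.symm
  have hc' : ∀ i, (c i).toMul * r = r * (c (-i)).toMul := fun i => by
    rw [← hc, ← mul_assoc, ← mul_assoc, hr.mul_self, one_mul]
  have hadd : ∀ i j, (c (i + j)).toMul = (c i).toMul * (c j).toMul := fun i j => by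
    rw [map_add, toMul_add]
  { toFun := fun x => match x with
      | .r i => (c i).toMul
      | .sr i => r * (c i).toMul
    map_one' := by
      change (c 0).toMul = 1
      rw [map_zero, toMul_zero]
    map_mul' := by
      rintro (i | i) (j | j)
      · exact hadd i j
      · change r * (c (j - i)).toMul = (c i).toMul * (r * (c j).toMul)
        rw [← mul_assoc, hc', mul_assoc, ← hadd, neg_add_eq_sub]
      · change r * (c (i + j)).toMul = r * (c i).toMul * (c j).toMul
        rw [hadd, mul_assoc]
      · change (c (j - i)).toMul = r * (c i).toMul * (r * (c j).toMul)
        rw [← mul_assoc, hc, ← hadd, neg_add_eq_sub] }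

section

variable {r s : G} (hr : IsInvolution r) (hs : IsInvolution s) (n : ℕ) (hn : (r * s) ^ n = 1)

lemma dihedralHom_r (k : ℤ) : dihedralHom hr hs n hn (.r k) = (r * s) ^ k :=
  zmodPowHom_intCast (r * s) n hn k

lemma dihedralHom_sr (k : ℤ) : dihedralHom hr hs n hn (.sr k) = r * (r * s) ^ k :=
  congrArg (r * ·) (zmodPowHom_intCast (r * s) n hn k)

lemma dihedralHom_sr_zero : dihedralHom hr hs n hn (.sr 0) = r := by
  simpa using dihedralHom_sr hr hs n hn 0

lemma dihedralHom_sr_one : dihedralHom hr hs n hn (.sr 1) = s := by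
  have := dihedralHom_sr hr hs n hn 1
  rwa [zpow_one, ← mul_assoc, hr.mul_self, one_mul, Int.cast_one] at this

lemma dihedralHom_range : (dihedralHom hr hs n hn).range = dihedral r s := by
  apply le_antisymm
  · have hz : r * s ∈ dihedral r s :=
      mul_mem (left_mem_dihedral r s) (right_mem_dihedral r s)
    rintro _ ⟨i | i, rfl⟩ <;> obtain ⟨k, rfl⟩ := ZMod.intCast_surjective i
    · rw [dihedralHom_r]
      exact zpow_mem hz k
    · rw [dihedralHom_sr]
      exact mul_mem (left_mem_dihedral r s) (zpow_mem hz k)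
  · rw [dihedral, Subgroup.closure_le]
    rintro _ (rfl | rfl)
    · exact ⟨_, dihedralHom_sr_zero hr hs n hn⟩
    · exact ⟨_, dihedralHom_sr_one hr hs n hn⟩

end

lemma mem_dihedral_iff {r s : G} (hr : IsInvolution r) (hs : IsInvolution s) {x : G} :
    x ∈ dihedral r s ↔ ∃ k : ℤ, x = (r * s) ^ k ∨ x = r * (r * s) ^ k := by
  rw [← dihedralHom_range hr hs 0 (pow_zero _)]
  constructor
  · rintro ⟨i | i, rfl⟩
    · exact ⟨i, Or.inl (dihedralHom_r hr hs 0 _ i)⟩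
    · exact ⟨i, Or.inr (dihedralHom_sr hr hs 0 _ i)⟩
  · rintro ⟨k, rfl | rfl⟩
    · exact ⟨_, dihedralHom_r hr hs 0 _ k⟩
    · exact ⟨_, dihedralHom_sr hr hs 0 _ k⟩

lemma finite_dihedral {r s : G} (hr : IsInvolution r) (hs : IsInvolution s)
    (h : IsOfFinOrder (r * s)) : Finite (dihedral r s) := by
  have : NeZero (orderOf (r * s)) := ⟨h.orderOf_pos.ne'⟩
  rw [← dihedralHom_range hr hs _ (pow_orderOf_eq_one _)]
  exact Finite.of_surjective _ (MonoidHom.rangeRestrict_surjective _)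

/-- The elements of a dihedral group outside of the rotation subgroup are involutions. -/
lemma IsInvolutionPair.isInvolution_mul_zpow {r s : G} (h : IsInvolutionPair r s)
    (h2 : (r * s) ^ 2 ≠ 1) (k : ℤ) : IsInvolution (r * (r * s) ^ k) := by
  rw [isInvolution_iff]
  constructor
  · have := conj_zpow (a := r) (b := r * s) (i := k)
    rw [h.1.inv_eq, h.1.mul_mul_left h.2.1, inv_zpow'] at this
    rw [← mul_assoc, ← this, ← zpow_add, neg_add_cancel, zpow_zero]
  · intro h1
    apply h2
    have hcomm : Commute ((r * s) ^ k)⁻¹ (r * s) :=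
      ((Commute.refl (r * s)).zpow_left k).inv_left
    rw [← eq_inv_of_mul_eq_one_left h1] at hcomm
    have h3 := h.1.mul_mul_left h.2.1
    rw [hcomm.eq, mul_assoc, h.1.mul_self, mul_one] at h3
    rw [sq]
    nth_rewrite 2 [h3]
    exact mul_inv_cancel _

/-- The nontrivial elements of a dihedral group are involutions and translations. -/
lemma IsInvolutionPair.cases_of_mem {r s : G} (h : IsInvolutionPair r s)
    (h2 : (r * s) ^ 2 ≠ 1) {x : G} (hx : x ∈ dihedral r s) (hx1 : x ≠ 1) :
    IsInvolution x ∨ (IsTranslation x ∧ x ∈ Subgroup.zpowers (r * s)) := by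
  obtain ⟨k, rfl | rfl⟩ := (mem_dihedral_iff h.1 h.2.1).1 hx
  · refine Or.inr ⟨⟨r, r * (r * s) ^ k, ⟨h.1, h.isInvolution_mul_zpow h2 k, ?_⟩, ?_⟩, k, rfl⟩
    · intro he
      exact hx1 (mul_left_cancel (he.symm.trans (mul_one r).symm))
    · rw [← mul_assoc, h.1.mul_self, one_mul]
  · exact Or.inl (h.isInvolution_mul_zpow h2 k)

section OddOrder

variable {r s : G} (h : IsInvolutionPair r s) {p : ℕ} (hp : p.Prime) (hp2 : p ≠ 2)
  (ho : orderOf (r * s) = p)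
include hp hp2 ho

lemma sq_ne_one_of_orderOf : (r * s) ^ 2 ≠ 1 := fun h1 => by
  have := orderOf_dvd_of_pow_eq_one h1
  rw [ho, Nat.prime_dvd_prime_iff_eq hp Nat.prime_two] at this
  exact hp2 this

include h

lemma dihedralHom_injective :
    Function.Injective (dihedralHom h.1 h.2.1 p (ho ▸ pow_orderOf_eq_one _)) := by
  rw [injective_iff_map_eq_one]
  rintro (i | i) hi <;> obtain ⟨k, rfl⟩ := ZMod.intCast_surjective i
  · rw [dihedralHom_r, ← orderOf_dvd_iff_zpow_eq_one, ho] at hi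
    rw [(ZMod.intCast_zmod_eq_zero_iff_dvd k p).2 hi]
    rfl
  · rw [dihedralHom_sr] at hi
    exact absurd hi (h.isInvolution_mul_zpow (sq_ne_one_of_orderOf hp hp2 ho) k).ne_one

/-- The group generated by two involutions whose product has order `p` is dihedral. -/
noncomputable def dihedralEquiv : DihedralGroup p ≃* dihedral r s :=
  (MonoidHom.ofInjective (dihedralHom_injective h hp hp2 ho)).trans
    (MulEquiv.subgroupCongr (dihedralHom_range h.1 h.2.1 p (ho ▸ pow_orderOf_eq_one _)))

lemma dihedralEquiv_sr_zero :
    dihedralEquiv h hp hp2 ho (.sr 0) = ⟨r, left_mem_dihedral r s⟩ :=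
  Subtype.ext (dihedralHom_sr_zero h.1 h.2.1 p (ho ▸ pow_orderOf_eq_one _))

lemma dihedralEquiv_sr_one :
    dihedralEquiv h hp hp2 ho (.sr 1) = ⟨s, right_mem_dihedral r s⟩ :=
  Subtype.ext (dihedralHom_sr_one h.1 h.2.1 p (ho ▸ pow_orderOf_eq_one _))

lemma card_dihedral : Nat.card (dihedral r s) = 2 * p := by
  rw [← Nat.card_congr (dihedralEquiv h hp hp2 ho).toEquiv, DihedralGroup.nat_card]

/-- An element of a dihedral group that is not of order at most two generates the rotation
subgroup. -/
lemma zpowers_eq_of_mem_dihedral {x : G} (hx : x ∈ dihedral r s) (hx2 : x ^ 2 ≠ 1) :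
    Subgroup.zpowers x = Subgroup.zpowers (r * s) := by
  have hx1 : x ≠ 1 := by rintro rfl; simp at hx2
  rcases h.cases_of_mem (sq_ne_one_of_orderOf hp hp2 ho) hx hx1 with hi | ⟨-, hi⟩
  · exact absurd (by rw [sq, hi.mul_self]) hx2
  · have hfin : Finite (Subgroup.zpowers (r * s)) := by
      rw [← SetLike.coe_sort_coe, Set.finite_coe_iff, finite_zpowers]
      exact orderOf_pos_iff.1 (ho ▸ hp.pos)
    apply Subgroup.eq_of_le_of_card_ge (Subgroup.zpowers_le.2 hi)
    rw [Nat.card_zpowers, Nat.card_zpowers, ho]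
    have hdvd := orderOf_dvd_of_mem_zpowers hi
    rw [ho, Nat.dvd_prime hp, orderOf_eq_one_iff] at hdvd
    exact (hdvd.resolve_left hx1).ge

end OddOrder

lemma exists_mapsPair {r s r' s' : G} (h : IsInvolutionPair r s) (h' : IsInvolutionPair r' s')
    {p : ℕ} (hp : p.Prime) (hp2 : p ≠ 2) (ho : orderOf (r * s) = p) (ho' : orderOf (r' * s') = p) :
    ∃ φ : dihedral r' s' ≃* dihedral r s, MapsPair φ := by
  refine ⟨(dihedralEquiv h' hp hp2 ho').symm.trans (dihedralEquiv h hp hp2 ho), ?_, ?_⟩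
  · rw [← dihedralEquiv_sr_zero h' hp hp2 ho', MulEquiv.trans_apply, MulEquiv.symm_apply_apply,
      dihedralEquiv_sr_zero]
  · rw [← dihedralEquiv_sr_one h' hp hp2 ho', MulEquiv.trans_apply, MulEquiv.symm_apply_apply,
      dihedralEquiv_sr_one]

end Involutions

/-! ### Inheritance of weak sharp 2-transitivity -/

section Images

variable {G : Type*} [Group G] {Γ : Type*} [Group Γ] {f : G →* Γ} (hf : Function.Injective f)

variable (f) in
lemma dihedral_map (r s : G) : dihedral (f r) (f s) = (dihedral r s).map f := by
  rw [dihedral, dihedral, MonoidHom.map_closure, Set.image_pair]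

include hf

lemma IsPAffine.map {p : ℕ} {r s : G} (h : IsPAffine p r s) : IsPAffine p (f r) (f s) := by
  obtain ⟨h1, H, hH, ⟨e⟩⟩ := h
  refine ⟨(isInvolutionPair_map hf).2 h1, H.map f, ?_,
    ⟨(H.equivMapOfInjective f hf).symm.trans e⟩⟩
  rw [dihedral_map]
  exact Subgroup.map_mono hH

/-- A subgroup of the range of an embedding is isomorphic to its preimage. -/
noncomputable def comapEquiv {H : Subgroup Γ} (hH : H ≤ f.range) : H.comap f ≃* H :=
  ((H.comap f).equivMapOfInjective f hf).trans
    (MulEquiv.subgroupCongr (Subgroup.map_comap_eq_self hH))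

lemma isPAffine_of_map {p : ℕ} {r s : G} (h : IsInvolutionPair (f r) (f s)) {H : Subgroup Γ}
    (hH : dihedral (f r) (f s) ≤ H) (e : H ≃* AGL1 p) (hr : H ≤ f.range) : IsPAffine p r s := by
  refine ⟨(isInvolutionPair_map hf).1 h, H.comap f, ?_, ⟨(comapEquiv hf hr).trans e⟩⟩
  rwa [← Subgroup.map_le_iff_le_comap, ← dihedral_map]

lemma isTranslation_map {z : G} (h : IsTranslation z) : IsTranslation (f z) := by
  obtain ⟨r, s, hrs, rfl⟩ := h
  exact ⟨f r, f s, (isInvolutionPair_map hf).2 hrs, map_mul f r s⟩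

end Images

section Normalizer

variable {Γ : Type*} [Group Γ]

lemma mem_normalizer_zpowers_of_conj_eq {g z : Γ} (h : g * z * g⁻¹ = z ∨ g * z * g⁻¹ = z⁻¹) :
    g ∈ Subgroup.normalizer (Subgroup.zpowers z : Set Γ) := by
  rw [Subgroup.mem_normalizer_iff_map_conj_eq, MonoidHom.map_zpowers]
  change Subgroup.zpowers (g * z * g⁻¹) = _
  rcases h with h | h <;> rw [h]
  exact Subgroup.zpowers_inv

lemma mem_normalizer_zpowers_of_commute {g z : Γ} (h : Commute g z) :
    g ∈ Subgroup.normalizer (Subgroup.zpowers z : Set Γ) :=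
  mem_normalizer_zpowers_of_conj_eq (Or.inl (by rw [h.eq, mul_inv_cancel_right]))

lemma IsInvolutionPair.left_mem_normalizer {r s : Γ} (h : IsInvolutionPair r s) :
    r ∈ Subgroup.normalizer (Subgroup.zpowers (r * s) : Set Γ) :=
  mem_normalizer_zpowers_of_conj_eq (Or.inr (by rw [h.1.inv_eq, h.1.mul_mul_left h.2.1]))

lemma IsInvolutionPair.right_mem_normalizer {r s : Γ} (h : IsInvolutionPair r s) :
    s ∈ Subgroup.normalizer (Subgroup.zpowers (r * s) : Set Γ) :=
  mem_normalizer_zpowers_of_conj_eq (Or.inr (by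
    rw [h.2.1.inv_eq, mul_assoc, mul_assoc, h.2.1.mul_self, mul_one, mul_inv_rev, h.1.inv_eq,
      h.2.1.inv_eq]))

lemma IsInvolutionPair.dihedral_le_normalizer {r s : Γ} (h : IsInvolutionPair r s) :
    dihedral r s ≤ Subgroup.normalizer (Subgroup.zpowers (r * s) : Set Γ) := by
  rw [dihedral, Subgroup.closure_le]
  rintro _ (rfl | rfl)
  exacts [h.left_mem_normalizer, h.right_mem_normalizer]

end Normalizer

section Splitting

variable {G : Type*} [Group G] {Γ : Type*} [Group Γ] {V : Type*} {T : SimpleGraph V}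

/-- An action of `Γ` on a tree with a height function and one orbit of vertices, such that `G` is
the stabilizer of the vertex `o`, the stabilizers of the edges are finite, of bounded order, and
consist of involutions and translations, and the elements that are not of order at most two fix no
two vertices at distance three. -/
structure IsDihedralSplitting (α : Γ →* (T ≃g T)) (χ : Γ →* Multiplicative ℤ) (η : V → ℤ)
    (ι : G →* Γ) (o : V) : Prop where
  isTree : T.IsTree
  height : IsHeight α χ η
  injective : Function.Injective ι
  stabilizer : vertexStabilizer α o = ι.range
  transitive : ∀ v, ∃ γ, α γ o = v
  finite_edge : ∃ K : ℕ, ∀ x y, T.Adj x y → {g | α g x = x ∧ α g y = y}.encard ≤ K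
  edge : ∀ x y, T.Adj x y → ∀ g, α g x = x → α g y = y → g ≠ 1 → IsInvolution g ∨ IsTranslation g
  diam : ∀ z x y, z ^ 2 ≠ 1 → α z x = x → α z y = y → T.dist x y ≤ 2

/-- The embedding of the vertex group followed by the conjugation by `γ`. -/
def conjEmbedding (ι : G →* Γ) (γ : Γ) : G →* Γ := (MulAut.conj γ).toMonoidHom.comp ι

lemma conjEmbedding_apply (ι : G →* Γ) (γ : Γ) (g : G) : conjEmbedding ι γ g = γ * ι g * γ⁻¹ := rfl

variable {α : Γ →* (T ≃g T)} {χ : Γ →* Multiplicative ℤ} {η : V → ℤ} {ι : G →* Γ} {o : V}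
  (h : IsDihedralSplitting α χ η ι o)
include h

namespace IsDihedralSplitting

lemma conjEmbedding_injective (γ : Γ) : Function.Injective (conjEmbedding ι γ) :=
  (MulAut.conj γ).injective.comp h.injective

lemma exists_conj_of_fixed (x : V) : ∃ γ, ∀ g, α g x = x → g ∈ (conjEmbedding ι γ).range := by
  obtain ⟨γ, rfl⟩ := h.transitive x
  refine ⟨γ, fun g hg => ?_⟩
  have : γ⁻¹ * g * γ ∈ vertexStabilizer α o := by
    rw [mem_vertexStabilizer, act_mul, act_mul, hg, act_inv_act]
  rw [h.stabilizer] at this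
  obtain ⟨g₀, hg₀⟩ := this
  exact ⟨g₀, by rw [conjEmbedding_apply, hg₀]; group⟩

lemma edge_of_fixed {g : Γ} {x y : V} (hxy : x ≠ y) (hx : α g x = x) (hy : α g y = y)
    (hg : g ≠ 1) : IsInvolution g ∨ IsTranslation g := by
  obtain ⟨m, hm, hfix⟩ := exists_adj_fixed h.isTree α hxy
  exact h.edge x m hm g hx (hfix g hx hy) hg

variable {p q₁ q₂ : ℕ} (hG : WST G p q₁ q₂)
include hG

lemma isOfFinOrder_of_fixed {g : Γ} {x : V} (hx : α g x = x) : IsOfFinOrder g := by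
  obtain ⟨γ, hγ⟩ := h.exists_conj_of_fixed x
  obtain ⟨g₀, rfl⟩ := hγ g hx
  exact MonoidHom.isOfFinOrder _ (hG.torsion g₀)

lemma isOfFinOrder_iff {g : Γ} : IsOfFinOrder g ↔ ∃ x, α g x = x :=
  ⟨h.height.exists_fixed_of_isOfFinOrder h.isTree, fun ⟨_, hx⟩ => h.isOfFinOrder_of_fixed hG hx⟩

lemma order_translation {r s : Γ} (hrs : IsInvolutionPair r s) :
    orderOf (r * s) = p ∨ ¬ IsOfFinOrder (r * s) := by
  by_cases hfin : IsOfFinOrder (r * s)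
  · left
    have := finite_dihedral hrs.1 hrs.2.1 hfin
    obtain ⟨x, hx⟩ := h.height.exists_fixed_of_finite h.isTree (dihedral r s)
    obtain ⟨γ, hγ⟩ := h.exists_conj_of_fixed x
    obtain ⟨r, rfl⟩ := hγ r (hx r (left_mem_dihedral r s))
    obtain ⟨s, rfl⟩ := hγ s (hx s (right_mem_dihedral _ s))
    have hf := h.conjEmbedding_injective γ
    rw [← map_mul, orderOf_injective _ hf]
    exact (hG.weakly.order_translation r s ((isInvolutionPair_map hf).1 hrs)).resolve_right
      (not_not_intro (hG.torsion _))
  · exact Or.inr hfin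

omit h in
lemma _root_.SharpTwo.WST.ne_two : p ≠ 2 := by
  rintro rfl
  have := hG.weakly.mod_four
  omega

lemma sq_ne_one {z : Γ} (hz : IsTranslation z) : z ^ 2 ≠ 1 := by
  obtain ⟨r, s, hrs, rfl⟩ := hz
  rcases h.order_translation hG hrs with ho | ho
  · exact sq_ne_one_of_orderOf hG.weakly.prime hG.ne_two ho
  · exact fun h1 => ho (isOfFinOrder_iff_pow_eq_one.2 ⟨2, by norm_num, h1⟩)

/-- Distinct involutions do not commute. -/
lemma eq_of_commute {a b : Γ} (ha : IsInvolution a) (hb : IsInvolution b) (hab : Commute a b) :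
    a = b := by
  by_contra hne
  refine h.sq_ne_one hG ⟨a, b, ⟨ha, hb, hne⟩, rfl⟩ ?_
  rw [hab.mul_pow, sq, sq, ha.mul_self, hb.mul_self, one_mul]

/-- The normalizer of the group generated by a translation of finite order fixes a vertex, because
it acts on the fixed point set, which is of bounded diameter. -/
lemma exists_fixed_normalizer {z : Γ} (hz : IsTranslation z) (hfin : IsOfFinOrder z) :
    ∃ x, ∀ n ∈ Subgroup.normalizer (Subgroup.zpowers z : Set Γ), α n x = x := by
  obtain ⟨v, hv⟩ := (h.isOfFinOrder_iff hG).1 hfin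
  refine h.height.exists_fixed_of_bounded h.isTree _ (v := v) (C := 2) fun n hn => ?_
  refine h.diam z v (α n v) (h.sq_ne_one hG hz) hv ?_
  obtain ⟨k, hk⟩ := (Subgroup.mem_normalizer_iff''.1 hn z).1 (Subgroup.mem_zpowers z)
  have hk' : z * n = n * z ^ k := by
    rw [show z ^ k = n⁻¹ * z * n from hk]; group
  rw [← act_mul, hk', act_mul, act_zpow_of_fixed α hv]

lemma exists_fixed_commute {z : Γ} (hz : IsTranslation z) (hfin : IsOfFinOrder z) {c : Γ}
    (hc : Commute c z) : IsOfFinOrder c := by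
  obtain ⟨x, hx⟩ := h.exists_fixed_normalizer hG hz hfin
  exact h.isOfFinOrder_of_fixed hG (hx c (mem_normalizer_zpowers_of_commute hc))

lemma minimal_or_affine {r s : Γ} (hrs : IsInvolutionPair r s) (ho : orderOf (r * s) = p) :
    IsPMinimal p r s ∨ IsPAffine p r s := by
  obtain ⟨x, hx⟩ := h.exists_fixed_normalizer hG ⟨r, s, hrs, rfl⟩
    (orderOf_pos_iff.1 (ho ▸ hG.weakly.prime.pos))
  obtain ⟨γ, hγ⟩ := h.exists_conj_of_fixed x
  have hf := h.conjEmbedding_injective γ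
  obtain ⟨r, rfl⟩ := hγ r (hx r hrs.left_mem_normalizer)
  obtain ⟨s, rfl⟩ := hγ s (hx s hrs.right_mem_normalizer)
  have hrs₀ := (isInvolutionPair_map hf).1 hrs
  have ho₀ := ho
  rw [← map_mul, orderOf_injective _ hf] at ho₀
  refine (hG.weakly.minimal_or_affine r s hrs₀ ho₀).imp (fun hm => ⟨hrs, ho, ?_⟩) (.map hf)
  refine le_antisymm (fun n hn => ?_) hrs.dihedral_le_normalizer
  obtain ⟨n, rfl⟩ := hγ n (hx n hn)
  rw [dihedral_map, ← hm.2.2]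
  refine Subgroup.mem_map_of_mem _ ?_
  rw [Subgroup.mem_normalizer_iff] at hn ⊢
  intro g
  have hmem : ∀ k, conjEmbedding ι γ k ∈ Subgroup.zpowers (conjEmbedding ι γ r * conjEmbedding ι γ s)
      ↔ k ∈ Subgroup.zpowers (r * s) := fun k => by
    rw [← map_mul, ← MonoidHom.map_zpowers, Subgroup.mem_map_iff_mem hf]
  have := hn (conjEmbedding ι γ g)
  rwa [hmem, show conjEmbedding ι γ n * conjEmbedding ι γ g * (conjEmbedding ι γ n)⁻¹ =
    conjEmbedding ι γ (n * g * n⁻¹) by simp only [map_mul, map_inv], hmem] at this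

lemma transitive_affine {r s r' s' : Γ} (hrs : IsPAffine p r s) (hrs' : IsPAffine p r' s') :
    ∃ g, g⁻¹ * r * g = r' ∧ g⁻¹ * s * g = s' := by
  have : Fact p.Prime := ⟨hG.weakly.prime⟩
  have hfin : Finite (AGL1 p) := Finite.of_equiv _ AGL1Equiv.symm
  have key : ∀ r s : Γ, IsPAffine p r s → ∃ γ r₀ s₀, IsPAffine p r₀ s₀ ∧
      conjEmbedding ι γ r₀ = r ∧ conjEmbedding ι γ s₀ = s := by
    rintro r s ⟨hrs, H, hH, ⟨e⟩⟩
    have : Finite H := Finite.of_equiv _ e.symm.toEquiv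
    obtain ⟨x, hx⟩ := h.height.exists_fixed_of_finite h.isTree H
    obtain ⟨γ, hγ⟩ := h.exists_conj_of_fixed x
    obtain ⟨r, rfl⟩ := hγ r (hx r (hH (left_mem_dihedral r s)))
    obtain ⟨s, rfl⟩ := hγ s (hx s (hH (right_mem_dihedral _ s)))
    exact ⟨γ, r, s, isPAffine_of_map (h.conjEmbedding_injective γ) hrs hH e
      fun g hg => hγ g (hx g hg), rfl, rfl⟩
  obtain ⟨γ, r, s, h₀, rfl, rfl⟩ := key r s hrs
  obtain ⟨γ', r', s', h₀', rfl, rfl⟩ := key r' s' hrs'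
  obtain ⟨g, rfl, rfl⟩ := hG.weakly.transitive_affine r s r' s' h₀ h₀'
  refine ⟨γ * ι g * γ'⁻¹, ?_, ?_⟩ <;> simp only [conjEmbedding_apply, map_mul, map_inv] <;> group

omit hG in
/-- An element that commutes with an element `c` without fixed vertices and fixes some vertex fixes
the axis of `c` pointwise. -/
lemma fixes_axis {g c : Γ} (hgc : Commute g c) {x : V} (hx : α g x = x) {v : V} {L : ℕ}
    (hL : 0 < L) (hd : ∀ i j : ℤ, (T.dist (α (c ^ i) v) (α (c ^ j) v) : ℤ) = |i - j| * L) :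
    α g v = v := by
  set n : ℕ := T.dist v x + 1
  have hfix : ∀ k : ℤ, α g (α (c ^ k) x) = α (c ^ k) x := fun k => by
    rw [← act_mul, (hgc.zpow_right k).eq, act_mul, hx]
  have h1 := hd (-n) 0
  have h2 := hd 0 n
  have h3 := hd (-n) n
  rw [zpow_zero, act_one] at h1 h2
  rw [sub_zero, abs_neg, Nat.abs_cast] at h1
  rw [zero_sub, abs_neg, Nat.abs_cast] at h2
  rw [show (-n - n : ℤ) = -(n + n) by ring, abs_neg, abs_of_nonneg (by positivity)] at h3
  have h4 : (n : ℤ) ≤ n * L := le_mul_of_one_le_right (by positivity) (by exact_mod_cast hL)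
  refine act_eq_of_between h.isTree α g (hfix (-n)) (hfix n) (between_of_dist_lt h.isTree
    (a := α (c ^ (-n : ℤ)) v) (d := α (c ^ (n : ℤ)) v) ?_ ?_ ?_)
  · zify
    rw [h1, h2, h3]
    ring
  · rw [dist_act h.isTree α]
    omega
  · rw [dist_act h.isTree α, T.dist_comm]
    omega

/-- The centralizer of a translation `r * s` of infinite order acts freely on the tree: an element
`c` of it that fixes a vertex would be an involution that fixes the axis, and so would its conjugate
by `r`; they would have to coincide, so that `c` commutes with the dihedral group. -/
lemma free_of_commute {r s : Γ} (hrs : IsInvolutionPair r s) (hinf : ¬ IsOfFinOrder (r * s))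
    {c : Γ} {x : V} (hc : Commute c (r * s)) (hx : α c x = x) : c = 1 := by
  by_contra hc1
  have hfree : ∀ y, α (r * s) y ≠ y := fun y hy => hinf (h.isOfFinOrder_of_fixed hG hy)
  have hnt : ∀ d, Commute d (r * s) → IsOfFinOrder d → ¬ IsTranslation d := fun d hd hfin ht =>
    hinf (h.exists_fixed_commute hG ht hfin hd.symm)
  have hinv : IsInvolution c := by
    refine (h.edge_of_fixed (hfree x).symm hx ?_ hc1).resolve_right
      (hnt c hc (h.isOfFinOrder_of_fixed hG hx))
    rw [← act_mul, hc.eq, act_mul, hx]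
  obtain ⟨v, L, hL, -, hd⟩ := h.height.exists_axis h.isTree hfree
  have hrpow : ∀ i : ℤ, (r * s) ^ i * r = r * (r * s) ^ (-i) := fun i => by
    have := conj_zpow (a := r) (b := r * s) (i := -i)
    rw [hrs.1.inv_eq, hrs.1.mul_mul_left hrs.2.1, inv_zpow', neg_neg] at this
    rw [this, mul_assoc, hrs.1.mul_self, mul_one]
  have hcv := h.fixes_axis hc hx hL hd
  have hcrv := h.fixes_axis hc hx (v := α r v) hL fun i j => by
    rw [← act_mul, ← act_mul, hrpow, hrpow, act_mul, act_mul, dist_act h.isTree α, hd, abs_sub_comm]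
    ring_nf
  set c' := r * c * r⁻¹
  have hc'v : α c' v = v := by
    rw [act_mul, act_mul, hrs.1.inv_eq, hcrv, ← act_mul, hrs.1.mul_self, act_one]
  have hc' : Commute c' (r * s) := by
    have h1 : r * (r * s)⁻¹ * r⁻¹ = r * s := by
      rw [hrs.1.inv_eq, ← hrs.1.mul_mul_left hrs.2.1]
      simp only [← mul_assoc]
      simp [hrs.1.mul_self, mul_assoc]
    have h2 := (hc.inv_right).map (MulAut.conj r)
    rw [MulAut.conj_apply, MulAut.conj_apply, h1] at h2
    exact h2
  have hcc' : c = c' := by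
    by_contra hne
    refine hnt (c * c') (hc.mul_left hc') (h.isOfFinOrder_of_fixed hG (x := v) ?_)
      ⟨c, c', ⟨hinv, (isInvolution_conj r).2 hinv, hne⟩, rfl⟩
    rw [act_mul, hc'v, hcv]
  have hcr : c = r := h.eq_of_commute hG hinv hrs.1 (by
    rw [Commute, SemiconjBy]
    nth_rewrite 1 [hcc']
    simp [c'])
  subst hcr
  have h3 := hrs.1.mul_mul_left hrs.2.1
  rw [hc.eq, mul_assoc, hrs.1.mul_self, mul_one] at h3
  refine hinf (isOfFinOrder_iff_pow_eq_one.2 ⟨2, by norm_num, ?_⟩)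
  rw [sq]
  nth_rewrite 2 [h3]
  exact mul_inv_cancel _

lemma centralizer_translation {r s : Γ} (hrs : IsInvolutionPair r s) :
    ∃ z, IsTranslation z ∧ Subgroup.centralizer {r * s} = Subgroup.zpowers z := by
  by_cases hfin : IsOfFinOrder (r * s)
  · obtain ⟨x, hx⟩ := h.exists_fixed_normalizer hG ⟨r, s, hrs, rfl⟩ hfin
    obtain ⟨γ, hγ⟩ := h.exists_conj_of_fixed x
    have hf := h.conjEmbedding_injective γ
    obtain ⟨r, rfl⟩ := hγ r (hx r hrs.left_mem_normalizer)
    obtain ⟨s, rfl⟩ := hγ s (hx s hrs.right_mem_normalizer)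
    obtain ⟨z, hz, hC⟩ := hG.weakly.centralizer_translation r s ((isInvolutionPair_map hf).1 hrs)
    refine ⟨_, isTranslation_map hf hz, ?_⟩
    rw [← MonoidHom.map_zpowers, ← hC]
    ext c
    rw [Subgroup.mem_centralizer_singleton_iff]
    constructor
    · intro hc
      obtain ⟨c, rfl⟩ := hγ c (hx c (mem_normalizer_zpowers_of_commute hc))
      refine Subgroup.mem_map_of_mem _ (Subgroup.mem_centralizer_singleton_iff.2 (hf ?_))
      simpa only [map_mul] using hc
    · rintro ⟨c, hc, rfl⟩
      rw [← map_mul, ← map_mul, ← map_mul, Subgroup.mem_centralizer_singleton_iff.1 hc]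
  · obtain ⟨z, hz⟩ := h.height.isCyclic_centralizer α h.isTree
      (fun x hx => hfin (h.isOfFinOrder_of_fixed hG hx))
      fun c x hc hx => h.free_of_commute hG hrs hfin hc hx
    refine ⟨z, ?_, hz⟩
    obtain ⟨m, hm⟩ : r * s ∈ Subgroup.zpowers z := by
      rw [← hz, Subgroup.mem_centralizer_singleton_iff]
    change z ^ m = r * s at hm
    have hzinf : ¬ IsOfFinOrder z := fun hz' => hfin (hm ▸ hz'.zpow)
    -- `r` inverts `r * s`, so it normalizes the centralizer and inverts its generator
    obtain ⟨k, hk⟩ : r * z * r⁻¹ ∈ Subgroup.zpowers z := by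
      have hzc : Commute z (r * s) := hm ▸ (Commute.refl z).zpow_right m
      have := (hzc.inv_right).map (MulAut.conj r)
      rw [← hz, Subgroup.mem_centralizer_singleton_iff]
      rw [MulAut.conj_apply, MulAut.conj_apply] at this
      have h1 : r * (r * s)⁻¹ * r⁻¹ = r * s := by
        rw [hrs.1.inv_eq, ← hrs.1.mul_mul_left hrs.2.1]
        simp only [← mul_assoc]
        simp [hrs.1.mul_self, mul_assoc]
      rw [h1] at this
      exact this
    change z ^ k = _ at hk
    have hinj : Function.Injective fun n : ℤ => z ^ n :=
      injective_zpow_iff_not_isOfFinOrder.2 hzinf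
    have hk1 : k = -1 := by
      have h1 : z ^ (k * m) = z ^ (-m) := by
        rw [zpow_mul, hk, conj_zpow, zpow_neg, hm, hrs.1.inv_eq, hrs.1.mul_mul_left hrs.2.1]
      have h2 : k * m = -m := hinj h1
      have hm0 : m ≠ 0 := by
        rintro rfl
        exact hrs.mul_ne_one (by rw [← hm, zpow_zero])
      exact mul_right_cancel₀ hm0 (by rw [h2]; ring)
    rw [hk1, zpow_neg_one, hrs.1.inv_eq] at hk
    refine ⟨r, r * z, ⟨hrs.1, isInvolution_iff.2 ⟨?_, ?_⟩, ?_⟩, ?_⟩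
    · rw [← mul_assoc, ← hk, inv_mul_cancel]
    · intro h1
      refine hzinf ?_
      rw [eq_inv_of_mul_eq_one_right h1]
      exact hrs.1.isOfFinOrder.inv
    · intro h1
      refine hzinf ?_
      rw [mul_left_cancel (h1.symm.trans (mul_one r).symm)]
      exact IsOfFinOrder.one
    · rw [← mul_assoc, hrs.1.mul_self, one_mul]

lemma isWeaklySharplyTwoTransitive : IsWeaklySharplyTwoTransitive Γ p where
  prime := hG.weakly.prime
  mod_four := hG.weakly.mod_four
  order_translation _ _ := h.order_translation hG
  minimal_or_affine _ _ := h.minimal_or_affine hG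
  exists_affine := by
    obtain ⟨r, s, hrs⟩ := hG.weakly.exists_affine
    exact ⟨_, _, hrs.map h.injective⟩
  transitive_affine _ _ _ _ := h.transitive_affine hG
  centralizer_translation _ _ := h.centralizer_translation hG

/-- Involutions do not commute with translations. -/
lemma not_commute_involution_translation {i z : Γ} (hi : IsInvolution i) (hz : IsTranslation z) :
    ¬ Commute i z := by
  intro hc
  obtain ⟨r, s, hrs, rfl⟩ := hz
  obtain ⟨z, ⟨a, b, hab, rfl⟩, hC⟩ := h.centralizer_translation hG hrs
  have hmem : i ∈ Subgroup.zpowers (a * b) := by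
    rw [← hC, Subgroup.mem_centralizer_singleton_iff]
    exact hc
  rcases h.order_translation hG hab with ho | ho
  · have := orderOf_dvd_of_mem_zpowers hmem
    rw [ho, show orderOf i = 2 from hi, Nat.prime_dvd_prime_iff_eq Nat.prime_two hG.weakly.prime]
      at this
    exact hG.ne_two this.symm
  · obtain ⟨k, rfl⟩ := hmem
    have h1 := hi.mul_self
    simp only [← zpow_add] at h1
    have h2 : k + k = 0 := injective_zpow_iff_not_isOfFinOrder.2 ho (h1.trans (zpow_zero _).symm)
    obtain rfl : k = 0 := by omega
    exact hi.ne_one (zpow_zero _)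

lemma isAlmostBoundedExponent : IsAlmostBoundedExponent Γ p q₁ q₂ where
  odd_left := hG.bounded.odd_left
  odd_right := hG.bounded.odd_right
  finite_subgroups E hE := by
    obtain ⟨x, hx⟩ := h.height.exists_fixed_of_finite h.isTree E
    obtain ⟨γ, hγ⟩ := h.exists_conj_of_fixed x
    have hf := h.conjEmbedding_injective γ
    have hE' : E ≤ (conjEmbedding ι γ).range := fun g hg => hγ g (hx g hg)
    have e := comapEquiv hf hE'
    have : Finite (E.comap (conjEmbedding ι γ)) := Finite.of_equiv _ e.symm.toEquiv
    have hup : ∀ C : Subgroup G, E.comap (conjEmbedding ι γ) ≤ C →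
        E ≤ C.map (conjEmbedding ι γ) := fun C hC => by
      rw [← Subgroup.map_comap_eq_self hE']
      exact Subgroup.map_mono hC
    rcases hG.bounded.finite_subgroups _ this with ⟨f, hf'⟩ | ⟨⟨C, hC, ⟨c⟩⟩, hcent⟩ | ⟨C, hC, ⟨c⟩⟩
    · exact Or.inl ⟨f.comp e.symm.toMonoidHom, hf'.comp e.symm.injective⟩
    · refine Or.inr (Or.inl ⟨⟨_, hup C hC, ⟨(C.equivMapOfInjective _ hf).symm.trans c⟩⟩, ?_⟩)
      intro g hg hg1 i hi hcomm
      by_cases hix : α i x = x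
      · obtain ⟨i, rfl⟩ := hγ i hix
        obtain ⟨g, rfl⟩ := hE' hg
        refine hcent g hg (fun h1 => hg1 (by rw [h1, map_one])) i ((isInvolution_map hf).1 hi) ?_
        exact hf (by simpa only [map_mul] using hcomm.eq)
      -- otherwise `g` fixes an edge
      · rcases h.edge_of_fixed (Ne.symm hix) (hx g hg)
          (by rw [← act_mul, hcomm.eq, act_mul, hx g hg]) hg1 with h1 | h1
        · obtain ⟨g, rfl⟩ := hE' hg
          have h2 := orderOf_dvd_natCard (c ⟨g, hC hg⟩)
          rw [MulEquiv.orderOf_eq, Subgroup.orderOf_mk,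
            show orderOf g = 2 from (isInvolution_map hf).1 h1, Nat.card_congr Multiplicative.toAdd,
            Nat.card_zmod] at h2
          exact (Nat.not_even_iff_odd.2 hG.bounded.odd_left) (even_iff_two_dvd.2 h2)
        · exact h.not_commute_involution_translation hG hi h1 hcomm.symm
    · exact Or.inr (Or.inr ⟨_, hup C hC, ⟨(C.equivMapOfInjective _ hf).symm.trans c⟩⟩)

end IsDihedralSplitting

end Splitting

/-! ### Dynamics of the action -/

section Dynamics

variable {G : Type*} [Group G] {Γ : Type*} [Group Γ] {V : Type*} {T : SimpleGraph V}

lemma card_ne_four_of_bounded {p q₁ q₂ : ℕ} (hp : p.Prime) (hp4 : p % 4 = 3)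
    (hΓ : IsAlmostBoundedExponent Γ p q₁ q₂) (H : Subgroup Γ) : Nat.card H ≠ 4 := by
  intro h4
  have : Fact p.Prime := ⟨hp⟩
  have : Finite H := Nat.finite_of_card_ne_zero (by omega)
  rcases hΓ.finite_subgroups H this with ⟨f, hf⟩ | ⟨⟨C, hC, ⟨c⟩⟩, -⟩ | ⟨C, hC, ⟨c⟩⟩
  · have h1 := Subgroup.card_dvd_of_injective f hf
    rw [h4, card_AGL1] at h1
    obtain ⟨k, hk⟩ : ∃ k, p = 4 * k + 3 := ⟨p / 4, by omega⟩
    rw [hk, Nat.dvd_iff_mod_eq_zero, show (4 * k + 3 - 1) * (4 * k + 3) =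
      2 + 4 * (4 * k ^ 2 + 5 * k + 1) by rw [Nat.add_sub_assoc (by norm_num)]; ring] at h1
    omega
  · have h1 := Subgroup.card_dvd_of_le hC
    rw [h4, Nat.card_congr c.toEquiv, Nat.card_congr Multiplicative.toAdd, Nat.card_zmod] at h1
    obtain ⟨k, hk⟩ := hΓ.odd_left
    omega
  · have h1 := Subgroup.card_dvd_of_le hC
    rw [h4, Nat.card_congr c.toEquiv, Nat.card_congr Multiplicative.toAdd, Nat.card_zmod] at h1
    obtain ⟨k, hk⟩ := hΓ.odd_right
    omega

lemma mem_closure_pair_of_commute {g h : Γ} (hg : g * g = 1) (hgh : Commute g h) {k : Γ}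
    (hk : k ∈ Subgroup.closure {g, h}) : ∃ n : ℤ, k = h ^ n ∨ k = h ^ n * g := by
  induction hk using Subgroup.closure_induction with
  | mem x hx =>
    rcases hx with rfl | rfl
    · exact ⟨0, Or.inr (by simp)⟩
    · exact ⟨1, Or.inl (by simp)⟩
  | one => exact ⟨0, Or.inl (by simp)⟩
  | mul x y _ _ hx hy =>
    obtain ⟨n, rfl | rfl⟩ := hx <;> obtain ⟨m, rfl | rfl⟩ := hy <;> refine ⟨n + m, ?_⟩
    · exact Or.inl (zpow_add h n m).symm
    · exact Or.inr (by rw [zpow_add, mul_assoc])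
    · exact Or.inr (by rw [mul_assoc, (hgh.zpow_right m).eq, zpow_add, mul_assoc])
    · exact Or.inl (by
        rw [mul_assoc, ← mul_assoc g, (hgh.zpow_right m).eq, mul_assoc, hg, mul_one, zpow_add])
  | inv x _ hx =>
    obtain ⟨n, rfl | rfl⟩ := hx <;> refine ⟨-n, ?_⟩
    · exact Or.inl (zpow_neg h n).symm
    · exact Or.inr (by
        rw [mul_inv_rev, inv_eq_of_mul_eq_one_left hg, ← zpow_neg, (hgh.zpow_right _).eq])

variable (α : Γ →* (T ≃g T))

/-- Actions on trees whose edges have finite stabilizers of bounded order are acylindrical: an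
element that moves two distant vertices little maps an edge in the middle of the geodesic between
them to one of boundedly many edges of that geodesic. -/
lemma isAcylindrical_of_finite_edge (hT : T.IsTree) {K : ℕ}
    (hK : ∀ x y, T.Adj x y → {g | α g x = x ∧ α g y = y}.encard ≤ K) :
    IsAcylindrical (treeAction hT α) := by
  intro ε hε
  set E := ⌈ε⌉₊ + 2
  refine ⟨(2 * E + 2) * (2 * E + 3) * K + 1, 2 * E + 5, by positivity, by positivity,
    fun x y hxy => ?_⟩
  obtain ⟨u, hu⟩ := exists_vertex_dist_le hT x
  obtain ⟨w, hw⟩ := exists_vertex_dist_le hT y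
  have hmove : ∀ (g : Γ) (a : Realization hT) (b : V), dist a (Realization.vertex hT b) ≤ 1 →
      dist a (treeAction hT α g a) ≤ ε → T.dist b (α g b) ≤ E := by
    intro g a b hab hg
    have h1 := dist_triangle4 (Realization.vertex hT b) a (treeAction hT α g a)
      (treeAction hT α g (Realization.vertex hT b))
    rw [dist_rho, treeAction_vertex, dist_vertex_vertex, dist_comm _ a] at h1
    have h2 := Nat.le_ceil ε
    have h3 : (T.dist b (α g b) : ℝ) ≤ E := by
      simp only [E]
      push_cast
      linarith
    exact_mod_cast h3
  have hD : 2 * E + 3 ≤ T.dist u w := by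
    have h1 := dist_triangle4 x (Realization.vertex hT u) (Realization.vertex hT w) y
    rw [dist_vertex_vertex, dist_comm (Realization.vertex hT w) y] at h1
    have h2 : ((2 * E + 3 : ℕ) : ℝ) ≤ T.dist u w := by
      push_cast
      linarith
    exact_mod_cast h2
  obtain ⟨m, hm1, hm2⟩ := exists_dist_eq_of_le hT (show E + 1 ≤ T.dist u w by omega)
  obtain ⟨n, hn1, hn2⟩ := exists_dist_eq_of_le hT (show 1 ≤ T.dist m w by omega)
  have hn3 : T.dist u n = E + 2 := by
    have h1 := tree_dist_triangle hT u m n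
    have h2 := tree_dist_triangle hT u n w
    omega
  have hbetween : ∀ (g : Γ) (a : V), T.dist u (α g u) ≤ E → T.dist w (α g w) ≤ E →
      T.dist u a + T.dist a w = T.dist u w → E < T.dist u a → E < T.dist a w →
      T.dist u (α g a) + T.dist (α g a) w = T.dist u w := fun g a h1 h2 h3 h4 h5 =>
    between_of_dist_lt hT (a := α g u) (d := α g w) (by simpa only [dist_act hT α] using h3)
      (by rw [T.dist_comm, dist_act hT α]; omega) (by rw [dist_act hT α]; omega)
  have hle : ∀ (g : Γ) (a : V), T.dist u (α g u) ≤ E → T.dist u (α g a) ≤ E + T.dist u a := by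
    intro g a h1
    have h2 := tree_dist_triangle hT u (α g u) (α g a)
    rw [dist_act hT α] at h2
    omega
  -- the elements with prescribed images of `m` and `n` form a coset of an edge stabilizer
  let S : Fin (2 * E + 2) × Fin (2 * E + 3) → Set Γ := fun i =>
    {g | T.dist u (α g u) ≤ E ∧ T.dist w (α g w) ≤ E ∧ T.dist u (α g m) = i.1 ∧
      T.dist u (α g n) = i.2}
  have hS : ∀ i, (S i).encard ≤ K := by
    intro i
    rcases (S i).eq_empty_or_nonempty with h0 | ⟨g, hg⟩
    · simp [h0]
    · have hsub : S i ⊆ (fun k => g * k) '' {k | α k m = m ∧ α k n = n} := by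
        intro g' hg'
        have key : ∀ a, T.dist u a + T.dist a w = T.dist u w → E < T.dist u a → E < T.dist a w →
            T.dist u (α g a) = T.dist u (α g' a) → α (g⁻¹ * g') a = a := fun a h1 h2 h3 h4 => by
          rw [act_mul, ← eq_of_between_of_dist_eq hT (hbetween g a hg.1 hg.2.1 h1 h2 h3)
            (hbetween g' a hg'.1 hg'.2.1 h1 h2 h3) h4, act_inv_act]
        exact ⟨g⁻¹ * g', ⟨key m (by omega) (by omega) (by omega) (hg.2.2.1.trans hg'.2.2.1.symm),
          key n (by omega) (by omega) (by omega) (hg.2.2.2.trans hg'.2.2.2.symm)⟩,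
          mul_inv_cancel_left g g'⟩
      exact (Set.encard_le_encard hsub).trans ((Set.encard_image_le _ _).trans
        (hK m n (SimpleGraph.dist_eq_one_iff_adj.1 hn1)))
  have hcover : {g : Γ | dist x (treeAction hT α g x) ≤ ε ∧ dist y (treeAction hT α g y) ≤ ε} ⊆
      ⋃ i, S i := by
    rintro g ⟨hgx, hgy⟩
    have h1 := hmove g x u hu hgx
    have h2 := hmove g y w hw hgy
    have h3 := hle g m h1
    have h4 := hle g n h1
    exact Set.mem_iUnion.2 ⟨(⟨T.dist u (α g m), by omega⟩, ⟨T.dist u (α g n), by omega⟩),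
      h1, h2, rfl, rfl⟩
  refine (Set.encard_le_encard hcover).trans ((Set.encard_iUnion_le_of_fintype S).trans ?_)
  refine (Finset.sum_le_sum fun i _ => hS i).trans ?_
  rw [Finset.sum_const, Finset.card_univ, Fintype.card_prod, Fintype.card_fin, Fintype.card_fin,
    nsmul_eq_mul]
  exact_mod_cast Nat.le_succ _

variable {α} {χ : Γ →* Multiplicative ℤ} {η : V → ℤ} {ι : G →* Γ} {o : V}
  (h : IsDihedralSplitting α χ η ι o) {p q₁ q₂ : ℕ} (hG : WST G p q₁ q₂)
include h hG

namespace IsDihedralSplitting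

/-- A finite group normalized by an element without fixed vertices fixes an edge and contains no
translation, because the normalizer of a translation of finite order fixes a vertex. -/
lemma card_le_two_of_normal (hT : T.IsTree) {g : Γ} (hg : ∀ x, α g x ≠ x) {H : Subgroup Γ}
    (hgH : g ∈ H) (F : Subgroup H) [F.Normal] [Finite F] : Nat.card F ≤ 2 := by
  have hfin : Finite (F.map H.subtype) :=
    Finite.of_equiv _ (F.equivMapOfInjective H.subtype H.subtype_injective).toEquiv
  obtain ⟨v, hv⟩ := h.height.exists_fixed_of_finite hT (F.map H.subtype)
  have hF : ∀ f ∈ F, α (f : Γ) v = v := fun f hf => hv _ (Subgroup.mem_map_of_mem _ hf)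
  have hF' : ∀ f ∈ F, α (f : Γ) (α g v) = α g v := fun f hf => by
    have h1 := hF _ (‹F.Normal›.conj_mem' f hf ⟨g, hgH⟩)
    change α (g⁻¹ * f * g) v = v at h1
    rwa [act_mul, act_mul, act_eq_iff, inv_inv] at h1
  have hnt : ∀ f ∈ F, ¬ IsTranslation (f : Γ) := by
    intro f hf ht
    -- a power of `g` centralizes `F`
    obtain ⟨k, hk, hgk⟩ := isOfFinOrder_iff_pow_eq_one.1
      (isOfFinOrder_of_finite (MulAut.conjNormal (H := F) ⟨g, hgH⟩))
    rw [← map_pow] at hgk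
    have h1 := congrArg (fun φ : MulAut F => ((φ ⟨f, hf⟩ : F) : H)) hgk
    simp only [MulAut.conjNormal_apply, MulAut.one_apply] at h1
    have h2 : Commute (g ^ k) (f : Γ) := by
      have h3 := congrArg Subtype.val h1
      simp only [Subgroup.coe_mul, Subgroup.coe_inv, Subgroup.coe_pow] at h3
      exact mul_inv_eq_iff_eq_mul.1 h3
    have h4 := h.exists_fixed_commute hG ht (h.isOfFinOrder_of_fixed hG (hF f hf)) h2
    obtain ⟨x, hx⟩ := (h.isOfFinOrder_iff hG).1 h4
    have h5 := h.height.le_dist_pow hT hg x k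
    rw [hx, SimpleGraph.dist_self] at h5
    omega
  have hinv : ∀ f ∈ F, f ≠ 1 → IsInvolution (f : Γ) := fun f hf hf1 =>
    (h.edge_of_fixed (hg v).symm (hF f hf) (hF' f hf)
      (fun h1 => hf1 (Subtype.ext h1))).resolve_right (hnt f hf)
  have huniq : ∀ f ∈ F, ∀ f' ∈ F, f ≠ 1 → f' ≠ 1 → f = f' := by
    intro f hf f' hf' h1 h1'
    by_contra hne
    exact hnt _ (F.mul_mem hf hf')
      ⟨f, f', ⟨hinv f hf h1, hinv f' hf' h1', fun he => hne (Subtype.ext he)⟩, rfl⟩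
  have hsub : ∃ f : H, (F : Set H) ⊆ {1, f} := by
    by_cases hex : ∃ f ∈ F, f ≠ 1
    · obtain ⟨f, hf, hf1⟩ := hex
      refine ⟨f, fun f' hf' => ?_⟩
      by_cases h1 : f' = 1
      · exact Or.inl h1
      · exact Or.inr (huniq f' hf' f hf h1 hf1)
    · push Not at hex
      exact ⟨1, fun f' hf' => Or.inl (hex f' hf')⟩
  obtain ⟨f, hf⟩ := hsub
  calc Nat.card F = (F : Set H).ncard := rfl
    _ ≤ ({1, f} : Set H).ncard := Set.ncard_le_ncard hf (Set.toFinite _)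
    _ ≤ 2 := (Set.ncard_insert_le _ _).trans (by rw [Set.ncard_singleton])

/-- An element that fixes five consecutive points of an orbit of an element `k` without fixed
vertices is trivial or an involution that commutes with `k`. -/
lemma nu_le_four (hT : T.IsTree) : nu (treeAction hT α) ≤ 4 := by
  refine sInf_le ⟨4, ⟨by norm_num, fun g k hk hell => ?_⟩, rfl⟩
  rw [h.height.isLoxodromic_iff hT] at hk
  obtain ⟨v, hv⟩ := h.height.exists_fixed_of_isEllipticSubgroup hT hell
  have hfix : ∀ i ≤ 4, α g (α (k ^ i) v) = α (k ^ i) v := fun i hi => by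
    have h1 := hv _ (Subgroup.subset_closure ⟨i, hi, rfl⟩)
    rwa [act_mul, act_mul, act_eq_iff, inv_inv] at h1
  have h0 : α g v = v := by simpa only [pow_zero, act_one] using hfix 0 (by norm_num)
  have hdist := h.height.le_dist_pow hT hk v 3
  have hkey : g * g = 1 ∧ Commute g k := by
    by_cases hg1 : g = 1
    · rw [hg1]
      exact ⟨one_mul 1, Commute.one_left k⟩
    have hinv : IsInvolution g := by
      refine (h.edge_of_fixed (hk v).symm h0
        (by simpa only [pow_one] using hfix 1 (by norm_num)) hg1).resolve_right fun ht => ?_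
      have := h.diam g v _ (h.sq_ne_one hG ht) h0 (hfix 3 (by norm_num))
      omega
    refine ⟨hinv.mul_self, ?_⟩
    by_contra hcomm
    -- otherwise `g` and its conjugate by `k` generate a translation that fixes too many vertices
    set g' := k⁻¹ * g * k
    have hinv' : IsInvolution g' := by
      have := (isInvolution_conj k⁻¹).2 hinv
      rwa [inv_inv] at this
    have hne : g ≠ g' := fun he => hcomm (by
      have h1 : k * g = g * k := by
        conv_lhs => rw [he]
        simp only [g']
        group
      exact h1.symm)
    have hfix' : ∀ i ≤ 3, α (g * g') (α (k ^ i) v) = α (k ^ i) v := fun i hi => by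
      have h1 : α g' (α (k ^ i) v) = α (k ^ i) v := by
        rw [act_mul, act_mul, act_eq_iff, inv_inv, ← act_mul α k, ← pow_succ']
        exact hfix (i + 1) (by omega)
      rw [act_mul, h1, hfix i (by omega)]
    have := h.diam (g * g') v _ (h.sq_ne_one hG ⟨g, g', ⟨hinv, hinv', hne⟩, rfl⟩)
      (by simpa only [pow_zero, act_one] using hfix' 0 (by norm_num)) (hfix' 3 le_rfl)
    omega
  exact h.height.isElementary_of_zpow hT hk fun _ => mem_closure_pair_of_commute hkey.1 hkey.2

lemma wst' (hT : T.IsTree) {N : ℕ} (hp : N ≤ p) (hq₁ : N ≤ q₁) (hq₂ : N ≤ q₂)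
    (hne : ¬ IsElementary (treeAction hT α) ⊤) : WST' N p q₁ q₂ hT α where
  no_inversion g _ _ hxy := h.height.no_inversion g hxy
  weakly := h.isWeaklySharplyTwoTransitive hG
  bounded := h.isAlmostBoundedExponent hG
  nonelementary := hne
  acylindrical := by
    obtain ⟨K, hK⟩ := h.finite_edge
    exact isAcylindrical_of_finite_edge α hT hK
  tame := by
    refine ⟨card_ne_four_of_bounded hG.weakly.prime hG.weakly.mod_four
      (h.isAlmostBoundedExponent hG), fun g hg F hF hfin => ?_⟩
    exact h.card_le_two_of_normal hG hT ((h.height.isLoxodromic_iff hT).1 hg)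
      (mem_maximalLoxodromic _ g) F
  tau_le := max_le ((h.nu_le_four hG hT).trans (by norm_num)) (by norm_num)
  omega_eq := Omega_eq_zero _
  le_p := hp
  le_left := hq₁
  le_right := hq₂
  loxodromic g hg := (h.height.isLoxodromic_iff hT).2 fun _ hx =>
    hg (h.isOfFinOrder_of_fixed hG hx)

end IsDihedralSplitting

end Dynamics

/-! ### The Bass–Serre tree of an HNN-extension -/

section HNN

open HNNExtension HNNExtension.NormalWord

variable {G : Type*} [Group G] {A B : Subgroup G} {φ : A ≃* B} {Γ : Type*} [Group Γ]

/-- `Γ` is the HNN-extension of `G` with associated subgroups `A` and `B`, embedding `ι` of the base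
group and stable letter `t`; that is, `t * ι a * t⁻¹ = ι (φ a)` for `a ∈ A`. -/
def IsHNN (φ : A ≃* B) (ι : G →* Γ) (t : Γ) : Prop :=
  ∃ e : HNNExtension G A B φ ≃* Γ, (∀ g, e (HNNExtension.of g) = ι g) ∧ e HNNExtension.t = t

lemma mk_eq_mk_iff (ι : G →* Γ) (g h : Γ) :
    (g : Γ ⧸ ι.range) = h ↔ ∃ b, g * ι b = h := by
  rw [QuotientGroup.eq]
  constructor
  · rintro ⟨b, hb⟩
    exact ⟨b, by rw [hb, mul_inv_cancel_left]⟩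
  · rintro ⟨b, rfl⟩
    exact ⟨b, by rw [inv_mul_cancel_left]⟩

variable {ι : G →* Γ} {t : Γ} (h : IsHNN φ ι t)
include h

namespace IsHNN

lemma injective : Function.Injective ι := by
  obtain ⟨e, he, -⟩ := h
  intro a b hab
  rw [← he, ← he] at hab
  exact HNNExtension.of_injective φ (e.injective hab)

lemma conj (a : A) : t * ι a * t⁻¹ = ι (φ a) := by
  obtain ⟨e, he, rfl⟩ := h
  rw [← he, ← he, ← map_mul, ← map_inv, ← map_mul, HNNExtension.equiv_eq_conj]

lemma conj_zpow {u : ℤˣ} {a : G} (ha : a ∈ toSubgroup A B u) :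
    ∃ b ∈ toSubgroup A B (-u), t ^ (u : ℤ) * ι a = ι b * t ^ (u : ℤ) := by
  rcases Int.units_eq_one_or u with rfl | rfl
  · exact ⟨φ ⟨a, ha⟩, (φ ⟨a, ha⟩).2, by rw [← h.conj ⟨a, ha⟩]; simp⟩
  · refine ⟨φ.symm ⟨a, ha⟩, by simp, ?_⟩
    have := h.conj (φ.symm ⟨a, ha⟩)
    rw [MulEquiv.apply_symm_apply] at this
    change _ = ι a at this
    rw [← this]
    simp [mul_assoc]

/-- The exponent sum of the stable letter. -/
lemma exists_character : ∃ χ : Γ →* Multiplicative ℤ, (∀ g, χ (ι g) = 1) ∧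
    χ t = Multiplicative.ofAdd 1 := by
  obtain ⟨e, he, rfl⟩ := h
  refine ⟨(HNNExtension.lift 1 (Multiplicative.ofAdd 1) (by simp)).comp e.symm.toMonoidHom,
    fun g => ?_, ?_⟩
  · rw [← he]; simp
  · simp

/-- Britton's lemma. -/
lemma eq_nil_of_mem_range (w : ReducedWord G A B)
    (hw : ι w.head * (w.toList.map fun x => t ^ (x.1 : ℤ) * ι x.2).prod ∈ ι.range) :
    w.toList = [] := by
  obtain ⟨e, he, rfl⟩ := h
  refine ReducedWord.toList_eq_nil_of_mem_of_range φ w ?_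
  obtain ⟨g, hg⟩ := hw
  refine ⟨g, e.injective ?_⟩
  rw [he, hg, ReducedWord.prod, map_mul, he, map_list_prod, List.map_map]
  congr 3
  funext x
  simp [he]

lemma mem_toSubgroup {u : ℤˣ} {a b : G} (hab : t ^ (u : ℤ) * ι a * t ^ (-(u : ℤ)) = ι b) :
    a ∈ toSubgroup A B u := by
  by_contra ha
  have := h.eq_nil_of_mem_range ⟨1, [(u, a), (-u, 1)], by simp [ha]⟩
    ⟨b, by rw [← hab]; simp [mul_assoc]⟩
  simp at this

lemma adj_iff {g : Γ} {y : Γ ⧸ ι.range} : (bassSerreGraph ι.range t).Adj g y ↔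
    ∃ (b : G) (u : ℤˣ), y = ((g * ι b * t ^ (u : ℤ) : Γ) : Γ ⧸ ι.range) := by
  rw [bassSerreGraph, SimpleGraph.fromRel_adj]
  constructor
  · rintro ⟨-, ⟨k, h1, rfl⟩ | ⟨k, rfl, h1⟩⟩
    · obtain ⟨b, rfl⟩ := (mk_eq_mk_iff ι _ _).1 h1
      exact ⟨b, 1, by simp⟩
    · obtain ⟨b, hb⟩ := (mk_eq_mk_iff ι _ _).1 h1
      refine ⟨b, -1, ?_⟩
      rw [hb]
      simp
  · rintro ⟨b, u, rfl⟩
    constructor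
    · intro he
      obtain ⟨c, hc⟩ := (mk_eq_mk_iff ι _ _).1 he
      obtain ⟨χ, h1, h2⟩ := h.exists_character
      have := congrArg χ hc
      simp only [map_mul, h1, mul_one, map_zpow, h2] at this
      have := mul_left_cancel ((mul_one (χ g)).trans this)
      rcases Int.units_eq_one_or u with rfl | rfl <;> exact absurd this (by decide)
    · rcases Int.units_eq_one_or u with rfl | rfl
      · exact Or.inl ⟨g * ι b, (mk_eq_mk_iff ι _ _).2 ⟨b, rfl⟩, by simp⟩
      · exact Or.inr ⟨g * ι b * t⁻¹, by simp, (mk_eq_mk_iff ι _ _).2 ⟨b, by simp⟩⟩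

lemma connected : (bassSerreGraph ι.range t).Connected := by
  have hpre : ∀ k g : Γ, (bassSerreGraph ι.range t).Reachable g ((g * k : Γ) : Γ ⧸ ι.range) := by
    intro k
    have h' := h
    obtain ⟨e, he, rfl⟩ := h'
    obtain ⟨k, rfl⟩ := e.surjective k
    induction k using HNNExtension.induction_on with
    | of b =>
      intro g
      rw [he, ← (mk_eq_mk_iff ι g (g * ι b)).2 ⟨b, rfl⟩]
    | t =>
      intro g
      exact (h.adj_iff.2 ⟨1, 1, by simp⟩).reachable
    | mul x y hx hy =>
      intro g
      rw [map_mul, ← mul_assoc]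
      exact (hx g).trans (hy _)
    | inv x hx =>
      intro g
      have := hx (g * e x⁻¹)
      rw [map_inv, inv_mul_cancel_right] at this
      rw [map_inv]
      exact this.symm
  refine ⟨fun x y => ?_⟩
  obtain ⟨g, rfl⟩ := QuotientGroup.mk_surjective x
  obtain ⟨k, rfl⟩ := QuotientGroup.mk_surjective y
  simpa using hpre (g⁻¹ * k) g

/-- Prepending a letter to a reduced word, unless this leads to a backtracking of the corresponding
walks. -/
lemma isChain_cons {g : Γ} {b : G} {u : ℤˣ} (w : ReducedWord G A B)
    (hw : ∀ x ∈ w.toList.head?,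
      ((g * ι b * t ^ (u : ℤ) * ι w.head * t ^ (x.1 : ℤ) : Γ) : Γ ⧸ ι.range) ≠ g) :
    ((u, w.head) :: w.toList).IsChain fun a b => a.2 ∈ toSubgroup A B a.1 → a.1 = b.1 := by
  rw [List.isChain_cons]
  refine ⟨fun x hx hmem => ?_, w.chain⟩
  by_contra hne
  obtain ⟨c, -, hc⟩ := h.conj_zpow hmem
  refine hw x hx ?_
  have hx1 : (x.1 : ℤ) = -(u : ℤ) := by
    rcases Int.units_eq_one_or u with rfl | rfl <;>
    rcases Int.units_eq_one_or x.1 with h1 | h1 <;> simp_all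
  rw [mul_assoc (g * ι b), hc, hx1, eq_comm, mk_eq_mk_iff]
  exact ⟨b * c, by rw [map_mul]; simp [mul_assoc]⟩

/-- Paths of the Bass–Serre tree are described by reduced words. -/
lemma exists_reducedWord_of_isPath {y z : Γ ⧸ ι.range} (p : (bassSerreGraph ι.range t).Walk y z)
    (hp : p.IsPath) (g : Γ) (hg : y = g) : ∃ w : ReducedWord G A B,
      z = ((g * (ι w.head * (w.toList.map fun x => t ^ (x.1 : ℤ) * ι x.2).prod) : Γ) :
        Γ ⧸ ι.range) ∧
      ∀ x ∈ w.toList.head?, ¬ p.Nil ∧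
        p.snd = ((g * ι w.head * t ^ (x.1 : ℤ) : Γ) : Γ ⧸ ι.range) := by
  induction p generalizing g with
  | nil => exact ⟨ReducedWord.empty G A B, by simpa using hg, by simp⟩
  | @cons x y z hxy p ih =>
    subst hg
    rw [SimpleGraph.Walk.cons_isPath_iff] at hp
    obtain ⟨b, u, rfl⟩ := h.adj_iff.1 hxy
    obtain ⟨w, hw1, hw2⟩ := ih hp.1 _ rfl
    refine ⟨⟨b, (u, w.head) :: w.toList, h.isChain_cons (g := g) (b := b) w fun x hx he => ?_⟩,
      ?_, ?_⟩
    · obtain ⟨-, h2⟩ := hw2 x hx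
      rw [he] at h2
      exact hp.2 (h2 ▸ p.getVert_mem_support 1)
    · refine hw1.trans ?_
      simp [mul_assoc]
    · simp

lemma isTree : (bassSerreGraph ι.range t).IsTree := by
  refine ⟨h.connected, fun x c hc => ?_⟩
  cases c with
  | nil => exact hc.ne_nil rfl
  | @cons _ y _ hxy p =>
    rw [SimpleGraph.Walk.cons_isCycle_iff] at hc
    obtain ⟨g, rfl⟩ := QuotientGroup.mk_surjective x
    obtain ⟨b, u, rfl⟩ := h.adj_iff.1 hxy
    obtain ⟨w, hw1, hw2⟩ := h.exists_reducedWord_of_isPath p hc.1 _ rfl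
    have := h.eq_nil_of_mem_range ⟨b, (u, w.head) :: w.toList,
      h.isChain_cons (g := g) (b := b) w fun x hx he => ?_⟩ ?_
    · simp at this
    · obtain ⟨h1, h2⟩ := hw2 x hx
      rw [he] at h2
      refine hc.2 ?_
      rw [Sym2.eq_swap]
      have := p.mk_start_snd_mem_edges h1
      rwa [h2] at this
    · obtain ⟨c, hgc⟩ := (mk_eq_mk_iff ι _ _).1 hw1
      refine ⟨c, mul_left_cancel (a := g) ?_⟩
      rw [hgc]
      simp [mul_assoc]

omit h in
lemma action_mk (γ g : Γ) : bassSerreAction ι.range t γ (g : Γ ⧸ ι.range) = ((γ * g : Γ) :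
    Γ ⧸ ι.range) := rfl

omit h in
lemma character_apply {χ : Γ →* Multiplicative ℤ} (h1 : ∀ g, χ (ι g) = 1)
    (h2 : χ t = Multiplicative.ofAdd 1) (g : Γ) (b : G) (u : ℤˣ) :
    (χ (g * ι b * t ^ (u : ℤ))).toAdd = (χ g).toAdd + u := by
  rw [map_mul χ, map_mul χ, h1, map_zpow, h2, mul_one, toAdd_mul, toAdd_zpow, toAdd_ofAdd,
    smul_eq_mul, mul_one]

lemma exists_isHeight : ∃ (χ : Γ →* Multiplicative ℤ) (η : Γ ⧸ ι.range → ℤ),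
    IsHeight (bassSerreAction ι.range t) χ η ∧ (∀ g, χ (ι g) = 1) ∧ χ t = Multiplicative.ofAdd 1 ∧
      ∀ g : Γ, η g = (χ g).toAdd := by
  obtain ⟨χ, h1, h2⟩ := h.exists_character
  refine ⟨χ, Quotient.lift (fun g => (χ g).toAdd) fun a b hab => ?_, ⟨?_, ?_⟩, h1, h2, fun _ => rfl⟩
  · obtain ⟨c, rfl⟩ := (mk_eq_mk_iff ι a b).1 (Quotient.sound hab)
    simp [h1]
  · intro g v
    obtain ⟨v, rfl⟩ := QuotientGroup.mk_surjective v
    change (χ (g * v)).toAdd = (χ v).toAdd + (χ g).toAdd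
    rw [map_mul, toAdd_mul, add_comm]
  · intro x y hxy
    obtain ⟨g, rfl⟩ := QuotientGroup.mk_surjective x
    obtain ⟨b, u, rfl⟩ := h.adj_iff.1 hxy
    change (χ g).toAdd = (χ (g * ι b * t ^ (u : ℤ))).toAdd + 1 ∨
      (χ (g * ι b * t ^ (u : ℤ))).toAdd = (χ g).toAdd + 1
    rw [character_apply h1 h2]
    rcases Int.units_eq_one_or u with rfl | rfl
    · right; simp
    · left; simp

lemma mem_toSubgroup_of_fixed {g : Γ} {z b : G} {u : ℤˣ}
    (hz : bassSerreAction ι.range t (g * ι z * g⁻¹)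
      ((g * ι b * t ^ (u : ℤ) : Γ) : Γ ⧸ ι.range) = ((g * ι b * t ^ (u : ℤ) : Γ) : Γ ⧸ ι.range)) :
    b⁻¹ * z * b ∈ toSubgroup A B (-u) := by
  rw [action_mk, eq_comm, mk_eq_mk_iff] at hz
  obtain ⟨c, hc⟩ := hz
  refine h.mem_toSubgroup (b := c) ?_
  rw [Units.val_neg, neg_neg, map_mul, map_mul, map_inv]
  refine mul_left_cancel (a := g * ι b * t ^ (u : ℤ)) ?_
  rw [hc]
  simp [mul_assoc]

omit h in
lemma exists_eq_conj_of_fixed {g k : Γ}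
    (hk : bassSerreAction ι.range t k (g : Γ ⧸ ι.range) = g) : ∃ z, k = g * ι z * g⁻¹ := by
  rw [action_mk, eq_comm, mk_eq_mk_iff] at hk
  obtain ⟨z, hz⟩ := hk
  exact ⟨z, by rw [hz, mul_inv_cancel_right]⟩

/-- The stabilizers of the edges are conjugates of `A`. -/
lemma exists_conj_of_edge {x y : Γ ⧸ ι.range} (hxy : (bassSerreGraph ι.range t).Adj x y) :
    ∃ γ : Γ, ∀ k, bassSerreAction ι.range t k x = x → bassSerreAction ι.range t k y = y →
      ∃ a ∈ A, k = γ * ι a * γ⁻¹ := by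
  obtain ⟨g, rfl⟩ := QuotientGroup.mk_surjective x
  obtain ⟨b, u, rfl⟩ := h.adj_iff.1 hxy
  rcases Int.units_eq_one_or u with rfl | rfl
  · refine ⟨g * ι b * t, fun k hk1 hk2 => ?_⟩
    obtain ⟨z, rfl⟩ := exists_eq_conj_of_fixed hk1
    have hz : b⁻¹ * z * b ∈ B := h.mem_toSubgroup_of_fixed hk2
    refine ⟨φ.symm ⟨_, hz⟩, (φ.symm ⟨_, hz⟩).2, ?_⟩
    have h1 := h.conj (φ.symm ⟨_, hz⟩)
    rw [MulEquiv.apply_symm_apply] at h1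
    change _ = ι (b⁻¹ * z * b) at h1
    have h2 : g * ι b * t * ι (φ.symm ⟨_, hz⟩) * (g * ι b * t)⁻¹ =
      g * ι b * (t * ι (φ.symm ⟨_, hz⟩) * t⁻¹) * (g * ι b)⁻¹ := by group
    rw [h2, h1, map_mul, map_mul, map_inv]
    group
  · refine ⟨g * ι b, fun k hk1 hk2 => ?_⟩
    obtain ⟨z, rfl⟩ := exists_eq_conj_of_fixed hk1
    have hz := h.mem_toSubgroup_of_fixed hk2
    rw [neg_neg] at hz
    refine ⟨_, hz, ?_⟩
    rw [map_mul, map_mul, map_inv]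
    group

/-- If an element whose square is not trivial fixes the vertices `x`, `y`, `z` of a path of length
two, then `y` is below `x` (and, by symmetry, below `z`): the edges that go down from `y` are
indexed by the cosets of `A`, those that go up by the cosets of `B`, and by the conditions on the
conjugates an edge that goes down is not fixed together with another edge at `y`. -/
lemma height_ne {χ : Γ →* Multiplicative ℤ} {η : Γ ⧸ ι.range → ℤ}
    (hχ : ∀ g, χ (ι g) = 1) (hχt : χ t = Multiplicative.ofAdd 1)
    (hη : ∀ g : Γ, η g = (χ g).toAdd)
    (hAB : ∀ a ∈ A, a ^ 2 ≠ 1 → ∀ b, b * a * b⁻¹ ∉ B)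
    (hAA : ∀ a ∈ A, a ^ 2 ≠ 1 → ∀ b, b * a * b⁻¹ ∈ A → b ∈ A)
    {x y z : Γ ⧸ ι.range} (hyx : (bassSerreGraph ι.range t).Adj y x)
    (hyz : (bassSerreGraph ι.range t).Adj y z) (hxz : x ≠ z) {k : Γ} (hk : k ^ 2 ≠ 1)
    (hx : bassSerreAction ι.range t k x = x) (hy : bassSerreAction ι.range t k y = y)
    (hz : bassSerreAction ι.range t k z = z) : η y ≠ η x + 1 := by
  intro hyx'
  obtain ⟨g, rfl⟩ := QuotientGroup.mk_surjective y
  obtain ⟨b, u, rfl⟩ := h.adj_iff.1 hyx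
  obtain ⟨c, v, rfl⟩ := h.adj_iff.1 hyz
  obtain ⟨k, rfl⟩ := exists_eq_conj_of_fixed hy
  have hu : u = -1 := by
    rcases Int.units_eq_one_or u with rfl | rfl
    · change η (g : Γ ⧸ ι.range) = _ at hyx'
      rw [hη, hη, character_apply hχ hχt, Units.val_one] at hyx'
      omega
    · rfl
  subst hu
  have hb := h.mem_toSubgroup_of_fixed hx
  rw [neg_neg] at hb
  have hc := h.mem_toSubgroup_of_fixed hz
  have hb2 : (b⁻¹ * k * b) ^ 2 ≠ 1 := by
    intro h1
    apply hk
    have h2 : k ^ 2 = b * (b⁻¹ * k * b) ^ 2 * b⁻¹ := by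
      rw [← conj_pow]
      group
    rw [conj_pow, ← map_pow, h2, h1]
    simp
  have hconj : c⁻¹ * k * c = (c⁻¹ * b) * (b⁻¹ * k * b) * (c⁻¹ * b)⁻¹ := by group
  rw [hconj] at hc
  rcases Int.units_eq_one_or v with rfl | rfl
  · exact hAB _ hb hb2 _ hc
  · rw [neg_neg] at hc
    have hmem := hAA _ hb hb2 _ hc
    apply hxz
    rw [eq_comm, mk_eq_mk_iff]
    refine ⟨φ ⟨_, hmem⟩, ?_⟩
    rw [← h.conj ⟨_, hmem⟩]
    simp [mul_assoc]

/-- An element whose square is not trivial fixes no path of length three: each of the two inner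
vertices would be below the other one. -/
lemma isDihedralSplitting {χ : Γ →* Multiplicative ℤ} {η : Γ ⧸ ι.range → ℤ}
    (hheight : IsHeight (bassSerreAction ι.range t) χ η)
    (hχ : ∀ g, χ (ι g) = 1) (hχt : χ t = Multiplicative.ofAdd 1)
    (hη : ∀ g : Γ, η g = (χ g).toAdd) (hfin : Finite A)
    (hA : ∀ a ∈ A, a ≠ 1 → IsInvolution a ∨ IsTranslation a)
    (hAB : ∀ a ∈ A, a ^ 2 ≠ 1 → ∀ b, b * a * b⁻¹ ∉ B)
    (hAA : ∀ a ∈ A, a ^ 2 ≠ 1 → ∀ b, b * a * b⁻¹ ∈ A → b ∈ A) :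
    IsDihedralSplitting (bassSerreAction ι.range t) χ η ι ((1 : Γ) : Γ ⧸ ι.range) where
  isTree := h.isTree
  height := hheight
  injective := h.injective
  stabilizer := by
    ext g
    rw [mem_vertexStabilizer, action_mk, mul_one, eq_comm, mk_eq_mk_iff]
    simp
  transitive v := by
    obtain ⟨g, rfl⟩ := QuotientGroup.mk_surjective v
    exact ⟨g, by rw [action_mk, mul_one]⟩
  finite_edge := by
    refine ⟨Nat.card A, fun x y hxy => ?_⟩
    obtain ⟨γ, hγ⟩ := h.exists_conj_of_edge hxy
    have hsub : {g | bassSerreAction ι.range t g x = x ∧ bassSerreAction ι.range t g y = y} ⊆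
        (fun a => γ * ι a * γ⁻¹) '' (A : Set G) := by
      rintro k ⟨hk1, hk2⟩
      obtain ⟨a, ha, rfl⟩ := hγ k hk1 hk2
      exact ⟨a, ha, rfl⟩
    refine (Set.encard_le_encard hsub).trans ((Set.encard_image_le _ _).trans ?_)
    rw [← Set.Finite.cast_ncard_eq (Set.toFinite (A : Set G))]
    exact le_rfl
  edge x y hxy g hgx hgy hg1 := by
    obtain ⟨γ, hγ⟩ := h.exists_conj_of_edge hxy
    obtain ⟨a, ha, rfl⟩ := hγ g hgx hgy
    have hinj : Function.Injective (conjEmbedding ι γ) :=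
      (MulAut.conj γ).injective.comp h.injective
    refine (hA a ha fun h1 => hg1 (by simp [h1])).imp (fun hi => ?_) (fun ht => ?_)
    · exact (isInvolution_map hinj).2 hi
    · exact isTranslation_map hinj ht
  diam k x y hk hx hy := by
    have hT := h.isTree
    by_contra! hlt
    obtain ⟨x₁, h1, h1'⟩ := exists_dist_eq_of_le hT (show 1 ≤ _ from hlt.trans' (by norm_num))
    obtain ⟨x₂, h2, h2'⟩ := exists_dist_eq_of_le hT
      (show 1 ≤ (bassSerreGraph ι.range t).dist x₁ y by omega)
    obtain ⟨x₃, h3, h3'⟩ := exists_dist_eq_of_le hT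
      (show 1 ≤ (bassSerreGraph ι.range t).dist x₂ y by omega)
    have f1 := act_eq_of_between hT _ k hx hy (m := x₁) (by omega)
    have f2 := act_eq_of_between hT _ k f1 hy (m := x₂) (by omega)
    have f3 := act_eq_of_between hT _ k f2 hy (m := x₃) (by omega)
    have hne : x ≠ x₂ := by rintro rfl; omega
    have hne' : x₁ ≠ x₃ := by rintro rfl; omega
    have a1 := SimpleGraph.dist_eq_one_iff_adj.1 h1
    have a2 := SimpleGraph.dist_eq_one_iff_adj.1 h2
    have a3 := SimpleGraph.dist_eq_one_iff_adj.1 h3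
    have key := fun x y z => h.height_ne hχ hχt hη hAB hAA (x := x) (y := y) (z := z) (k := k)
    have k2 := key x₂ x₁ x a2 a1.symm hne.symm hk f2 f1 hx
    have k3 := key x₁ x₂ x₃ a2.symm a3 hne' hk f1 f2 f3
    rcases hheight.adj _ _ a2 with h4 | h4 <;> omega

end IsHNN

end HNN

/-! ### Non-elementary actions and translation lengths -/

section NonElementary

lemma SeqInfinity.not_rel_of_le {X : Type*} [MetricSpace X] {u v : SeqInfinity X} (o : X)
    (h : ∀ n, dist (u.1 n) o + dist (v.1 n) o ≤ dist (u.1 n) (v.1 n)) :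
    ¬ SeqInfinity.Rel u v := by
  intro hr
  obtain ⟨n, hn⟩ := (tendsto_atTop.1 (hr o) 1).exists
  have := h n
  simp only [gromovProduct] at hn
  linarith

variable {Γ : Type*} [Group Γ] {V : Type*} {T : SimpleGraph V} {α : Γ →* (T ≃g T)}
  {χ : Γ →* Multiplicative ℤ} {η : V → ℤ} (hη : IsHeight α χ η) {t : Γ}
include hη

omit hη in
lemma toAdd_map_zpow (hχ : χ t = Multiplicative.ofAdd 1) (i : ℤ) : (χ (t ^ i)).toAdd = i := by
  rw [map_zpow χ, hχ, toAdd_zpow, toAdd_ofAdd, smul_eq_mul, mul_one]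

lemma IsHeight.dist_zpow (hT : T.IsTree) (hχ : χ t = Multiplicative.ofAdd 1) {o : V}
    (ho : T.dist o (α t o) = 1) (i j : ℤ) :
    (T.dist (α (t ^ i) o) (α (t ^ j) o) : ℤ) = |i - j| := by
  wlog hij : i ≤ j generalizing i j
  · rw [T.dist_comm, abs_sub_comm]
    exact this j i (by omega)
  obtain ⟨n, rfl⟩ := Int.le.dest hij
  have h1 := hη.abs_sub_le hT (α (t ^ i) o) (α (t ^ (i + n)) o)
  have h2 := dist_act_pow_le hT α t o n
  rw [← dist_act hT α (t ^ i), ← act_mul, ← zpow_natCast, ← zpow_add, ho, mul_one] at h2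
  rw [hη.equivariant, hη.equivariant, toAdd_map_zpow hχ, toAdd_map_zpow hχ] at h1
  rw [show η o + i - (η o + (i + n)) = i - (i + n) by ring] at h1
  refine le_antisymm ?_ h1
  rw [show i - (i + n) = -(n : ℤ) by ring, abs_neg, Nat.abs_cast]
  exact_mod_cast h2

/-- If `t` moves the vertex `o` to a neighbour of larger height, and if `b` fixes `o` but not `t o`,
then the sequences `t ^ n o`, `t ^ (-n) o` and `b t ^ n o` converge to different points. -/
lemma IsHeight.not_isElementary (hT : T.IsTree) (hχ : χ t = Multiplicative.ofAdd 1) {o : V}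
    (ho : T.dist o (α t o) = 1) {b : Γ} (hb : α b o = o) (hbt : α b (α t o) ≠ α t o) :
    ¬ IsElementary (treeAction hT α) ⊤ := by
  have hd := hη.dist_zpow hT hχ ho
  have hb0 : (χ b).toAdd = 0 := by
    have := hη.equivariant b o
    rw [hb] at this
    omega
  have hP : ∀ i j : ℤ, dist (Realization.vertex hT (α (t ^ i) o))
      (Realization.vertex hT (α (t ^ j) o)) = |(i : ℝ) - j| * 1 := fun i j => by
    rw [dist_vertex_vertex, mul_one]
    exact_mod_cast hd i j
  have hQ : ∀ i j : ℕ, dist (Realization.vertex hT (α (b * t ^ i) o))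
      (Realization.vertex hT (α (b * t ^ j) o)) = |(i : ℝ) - j| * 1 := fun i j => by
    rw [dist_vertex_vertex, act_mul, act_mul, dist_act hT, mul_one]
    exact_mod_cast hd i j
  -- the rays `t ^ n o` and `b t ^ n o` diverge at `o`
  have hdiv : ∀ n : ℕ, T.dist (α (t ^ n) o) o + T.dist (α (b * t ^ n) o) o ≤
      T.dist (α (t ^ n) o) (α (b * t ^ n) o) := by
    intro n
    have e1 : ∀ n : ℕ, T.dist (α (t ^ n) o) o = n := fun n => by
      have := hd n 0
      simp only [zpow_natCast, zpow_zero, act_one, sub_zero, Nat.abs_cast] at this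
      exact_mod_cast this
    have e2 : ∀ n : ℕ, T.dist (α (b * t ^ n) o) o = n := fun n => by
      have := dist_act hT α b (α (t ^ n) o) o
      rwa [hb, e1, ← act_mul] at this
    rcases n with _ | n
    · simp [hb]
    have e3 : T.dist (α (t ^ (n + 1)) o) (α t o) = n := by
      have := hd (n + 1) 1
      rw [zpow_one, add_sub_cancel_right, Nat.abs_cast] at this
      exact_mod_cast this
    have e4 : T.dist (α b (α t o)) (α (b * t ^ (n + 1)) o) = n := by
      rw [act_mul, dist_act hT, T.dist_comm, e3]
    have hto := T.dist_comm (u := o) (v := α t o)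
    have hbo : T.dist o (α b (α t o)) = 1 := by
      rw [← ho, ← dist_act hT α b o (α t o), hb]
    have e5 : T.dist (α t o) (α b (α t o)) = 2 := by
      have h1 := tree_dist_triangle hT (α t o) o (α b (α t o))
      have h2 := hT.connected.pos_dist_of_ne hbt.symm
      have h3 : T.dist (α t o) (α b (α t o)) ≠ 1 := fun h3 => by
        have h4 := hη.adj _ _ (SimpleGraph.dist_eq_one_iff_adj.1 h3)
        have h5 := hη.equivariant b (α t o)
        omega
      omega
    have hne : α t o ≠ o := by
      intro h
      rw [h, SimpleGraph.dist_self] at ho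
      omega
    have hne' : o ≠ α b (α t o) := by
      intro h
      rw [← h, SimpleGraph.dist_self] at hbo
      omega
    have f1 := e1 (n + 1)
    have f2 := e2 (n + 1)
    have g1 := dist_eq_of_overlap hT (x := α (t ^ (n + 1)) o) (y := α t o) (z := o)
      (w := α b (α t o)) (by omega) (by omega) hne
    have h6 := T.dist_comm (u := o) (v := α (b * t ^ (n + 1)) o)
    have g2 := dist_eq_of_overlap hT (x := α (t ^ (n + 1)) o) (y := o) (z := α b (α t o))
      (w := α (b * t ^ (n + 1)) o) (by omega) (by omega) hne'
    omega
  have hmem : ∀ g : Γ, Realization.vertex hT (α g o) ∈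
      orbitOf (treeAction hT α) ⊤ (Realization.vertex hT o) := fun g =>
    ⟨g, trivial, treeAction_vertex hT α g o⟩
  refine SharpTwo.not_isElementary (treeAction hT α) (realization_hyperbolic hT)
    (o := Realization.vertex hT o) (u := lineTop _ one_pos hP) (v := lineBot _ one_pos hP)
    (w := raySequence _ one_pos hQ) (fun n => hmem _) (fun n => hmem _) (fun n => hmem _)
    (not_rel_lineTop_lineBot _ one_pos hP) ?_ ?_
  · refine SeqInfinity.not_rel_of_le (Realization.vertex hT o) fun n => ?_
    have := hdiv n
    rw [← zpow_natCast] at this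
    change dist (Realization.vertex hT (α (t ^ (n : ℤ)) o)) _ +
      dist (Realization.vertex hT (α (b * t ^ n) o)) _ ≤
      dist (Realization.vertex hT (α (t ^ (n : ℤ)) o)) (Realization.vertex hT (α (b * t ^ n) o))
    simp only [dist_vertex_vertex]
    exact_mod_cast this
  · refine SeqInfinity.not_rel_of_le (Realization.vertex hT o) fun n => ?_
    change dist (Realization.vertex hT (α (t ^ (-n : ℤ)) o)) _ +
      dist (Realization.vertex hT (α (b * t ^ n) o)) _ ≤
      dist (Realization.vertex hT (α (t ^ (-n : ℤ)) o)) (Realization.vertex hT (α (b * t ^ n) o))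
    simp only [dist_vertex_vertex]
    -- the heights of the two vertices differ by `2 * n`
    have h1 := hη.abs_sub_le hT (α (t ^ (-n : ℤ)) o) (α (b * t ^ n) o)
    have h2 : (T.dist (α (t ^ (-n : ℤ)) o) o : ℤ) = n := by
      have := hd (-n) 0
      simpa using this
    have h3 : (T.dist (α (b * t ^ n) o) o : ℤ) = n := by
      have := hd n 0
      rw [← dist_act hT α b, ← act_mul, ← act_mul, zpow_zero, mul_one, hb] at this
      simpa using this
    rw [hη.equivariant, hη.equivariant, map_mul χ, toAdd_mul, hb0, ← zpow_natCast,
      toAdd_map_zpow hχ, toAdd_map_zpow hχ, zpow_natCast, abs_le] at h1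
    have h4 : (T.dist (α (t ^ (-n : ℤ)) o) o : ℤ) + T.dist (α (b * t ^ n) o) o ≤
        T.dist (α (t ^ (-n : ℤ)) o) (α (b * t ^ n) o) := by
      rw [h2, h3]
      linarith [h1.1]
    exact_mod_cast h4

lemma IsHeight.translationLength_eq_one (hT : T.IsTree) {g : Γ}
    (hχ : χ g = Multiplicative.ofAdd 1) {o : V} (ho : T.dist o (α g o) = 1) :
    translationLength (treeAction hT α) g = 1 := by
  apply le_antisymm
  · have := translationLength_le (treeAction hT α) g (Realization.vertex hT o)
    rwa [treeAction_vertex, dist_vertex_vertex, ho, Nat.cast_one] at this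
  · have := hη.le_translationLength hT g
    rwa [hχ, toAdd_ofAdd, Int.cast_one, abs_one] at this

lemma IsHeight.not_isOfFinOrder (hT : T.IsTree) {g : Γ} (hχ : χ g = Multiplicative.ofAdd 1) :
    ¬ IsOfFinOrder g := fun hg => by
  have := hη.eq_zero_of_isOfFinOrder hT hg
  rw [hχ] at this
  exact absurd this one_ne_zero

lemma IsHeight.not_isTranslation (hT : T.IsTree) {g : Γ} (hχ : χ g = Multiplicative.ofAdd 1) :
    ¬ IsTranslation g := by
  rintro ⟨r, s, ⟨hr, hs, -⟩, rfl⟩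
  have h1 := hη.eq_zero_of_isOfFinOrder hT hr.isOfFinOrder
  have h2 := hη.eq_zero_of_isOfFinOrder hT hs.isOfFinOrder
  have h3 := congrArg Multiplicative.toAdd hχ
  rw [map_mul, toAdd_mul, h1, h2] at h3
  exact absurd h3 (by simp)

end NonElementary

/-! ### Elements of translation length one, and free products -/

section Extensions

variable {G : Type*} [Group G] {A B : Subgroup G} {φ : A ≃* B} {Γ : Type*} [Group Γ]
  {ι : G →* Γ} {t : Γ} (h : IsHNN φ ι t)
include h

namespace IsHNN

lemma dist_base (d : G) : (bassSerreGraph ι.range t).dist ((1 : Γ) : Γ ⧸ ι.range)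
    (bassSerreAction ι.range t (ι d * t) ((1 : Γ) : Γ ⧸ ι.range)) = 1 := by
  rw [SimpleGraph.dist_eq_one_iff_adj, h.adj_iff]
  exact ⟨d, 1, by rw [action_mk]; simp⟩

lemma not_isElementary {χ : Γ →* Multiplicative ℤ} {η : Γ ⧸ ι.range → ℤ}
    (hheight : IsHeight (bassSerreAction ι.range t) χ η) (hχt : χ t = Multiplicative.ofAdd 1)
    (hT : (bassSerreGraph ι.range t).IsTree) {b : G} (hb : b ∉ B) :
    ¬ IsElementary (treeAction hT (bassSerreAction ι.range t)) ⊤ := by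
  have hd := h.dist_base 1
  rw [map_one, one_mul] at hd
  refine hheight.not_isElementary hT hχt hd (b := ι b) ?_ ?_
  · rw [action_mk, eq_comm, mk_eq_mk_iff]
    exact ⟨b, by simp⟩
  · rw [action_mk, action_mk, Ne, eq_comm, mk_eq_mk_iff]
    rintro ⟨c, hc⟩
    refine hb (h.mem_toSubgroup (u := -1) (b := c) ?_)
    rw [mul_one] at hc
    simp only [Units.val_neg, Units.val_one, zpow_neg, zpow_one, neg_neg]
    rw [mul_assoc, ← hc, inv_mul_cancel_left]

/-- The elements `ι d * t` move the base vertex to a neighbour. As the exponent sum of the stable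
letter is one on them, they are of infinite order and not products of two involutions. -/
lemma translationLength_mul {χ : Γ →* Multiplicative ℤ} {η : Γ ⧸ ι.range → ℤ}
    (hheight : IsHeight (bassSerreAction ι.range t) χ η) (hχ : ∀ g, χ (ι g) = 1)
    (hχt : χ t = Multiplicative.ofAdd 1) (hT : (bassSerreGraph ι.range t).IsTree) (d : G) :
    ¬ IsOfFinOrder (ι d * t) ∧ ¬ IsTranslation (ι d * t) ∧
      translationLength (treeAction hT (bassSerreAction ι.range t)) (ι d * t) = 1 := by
  have hg : χ (ι d * t) = Multiplicative.ofAdd 1 := by rw [map_mul, hχ, one_mul, hχt]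
  exact ⟨hheight.not_isOfFinOrder hT hg, hheight.not_isTranslation hT hg,
    hheight.translationLength_eq_one hT hg (h.dist_base d)⟩

end IsHNN

end Extensions

section FreeProduct

variable (G : Type*) [Group G]

/-- The free product of `G` with an infinite cyclic group as an HNN-extension with trivial
associated subgroups. -/
noncomputable def coprodEquiv : HNNExtension G ⊥ ⊥ (MulEquiv.refl (⊥ : Subgroup G)) ≃*
    Monoid.Coprod G (Multiplicative ℤ) :=
  MonoidHom.toMulEquiv
    (HNNExtension.lift Monoid.Coprod.inl (Monoid.Coprod.inr (Multiplicative.ofAdd 1)) (by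
      rintro ⟨a, ha⟩
      rw [Subgroup.mem_bot] at ha
      subst ha
      simp))
    (Monoid.Coprod.lift HNNExtension.of (zpowersHom _ HNNExtension.t))
    (HNNExtension.hom_ext (by ext g; simp) (by simp))
    (Monoid.Coprod.hom_ext (by ext g; simp) (by ext; simp))

lemma isHNN_coprod : IsHNN (MulEquiv.refl (⊥ : Subgroup G))
    (Monoid.Coprod.inl : G →* Monoid.Coprod G (Multiplicative ℤ))
    (Monoid.Coprod.inr (Multiplicative.ofAdd (1 : ℤ))) :=
  ⟨coprodEquiv G, fun g => by simp [coprodEquiv], by simp [coprodEquiv]⟩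

lemma isHNN_of {A B : Subgroup G} (φ : A ≃* B) :
    IsHNN φ (HNNExtension.of : G →* HNNExtension G A B φ) HNNExtension.t :=
  ⟨MulEquiv.refl _, fun _ => rfl, rfl⟩

variable {G}

/-- With trivial associated subgroups, the stabilizers of the edges are trivial. -/
lemma IsHNN.eq_of_fixed {Γ : Type*} [Group Γ] {ι : G →* Γ} {t : Γ}
    (h : IsHNN (MulEquiv.refl (⊥ : Subgroup G)) ι t) {x y : Γ ⧸ ι.range} {k : Γ}
    (hx : bassSerreAction ι.range t k x = x) (hy : bassSerreAction ι.range t k y = y)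
    (hk : k ≠ 1) : x = y := by
  by_contra hxy
  obtain ⟨m, hm, hfix⟩ := exists_adj_fixed h.isTree (bassSerreAction ι.range t) hxy
  obtain ⟨γ, hγ⟩ := h.exists_conj_of_edge hm
  obtain ⟨a, ha, rfl⟩ := hγ k hx (hfix k hx hy)
  rw [Subgroup.mem_bot] at ha
  subst ha
  simp at hk

/-- The HNN-extension with trivial associated subgroups. If `r` is an involution of the base group,
then `r` and `t * r * t⁻¹` generate an infinite dihedral group, since they fix a single vertex each,
and these vertices are adjacent. The stable letter `t` centralizes no involution, since it would
permute the fixed vertices of it. -/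
lemma wst'_of_trivial {Γ : Type*} [Group Γ] {ι : G →* Γ} {t : Γ}
    (h : IsHNN (MulEquiv.refl (⊥ : Subgroup G)) ι t) {N p q₁ q₂ : ℕ} (hp : N ≤ p) (hq₁ : N ≤ q₁)
    (hq₂ : N ≤ q₂) (hG : WST G p q₁ q₂) (hX : (bassSerreGraph ι.range t).IsTree) :
    WST' N p q₁ q₂ hX (bassSerreAction _ _) ∧
      (∃ g, IsTranslation g ∧ ¬ IsOfFinOrder g ∧
        translationLength (treeAction hX (bassSerreAction _ _)) g ≤ 2) ∧
      (∃ g, ¬ IsOfFinOrder g ∧ ¬ IsTranslation g ∧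
        translationLength (treeAction hX (bassSerreAction _ _)) g = 1 ∧
        ∀ i, IsInvolution i → ¬ Commute g i) := by
  obtain ⟨χ, η, hheight, hχ, hχt, hη⟩ := h.exists_isHeight
  have hsplit := h.isDihedralSplitting hheight hχ hχt hη inferInstance
    (fun a ha h1 => absurd (Subgroup.mem_bot.1 ha) h1)
    (fun a ha h1 => absurd (by rw [Subgroup.mem_bot.1 ha, one_pow]) h1)
    (fun a ha h1 => absurd (by rw [Subgroup.mem_bot.1 ha, one_pow]) h1)
  obtain ⟨r, -, ⟨hr, -, -⟩, -⟩ := hG.weakly.exists_affine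
  have hr' : IsInvolution (ι r) := (isInvolution_map h.injective).2 hr
  have hs' : IsInvolution (t * ι r * t⁻¹) := (isInvolution_conj t).2 hr'
  have hd := h.dist_base 1
  rw [map_one, one_mul] at hd
  set o : Γ ⧸ ι.range := ((1 : Γ) : Γ ⧸ ι.range)
  have hro : bassSerreAction ι.range t (ι r) o = o := by
    rw [IsHNN.action_mk, eq_comm, mk_eq_mk_iff]
    exact ⟨r, by simp⟩
  have hso : bassSerreAction ι.range t (t * ι r * t⁻¹) (bassSerreAction ι.range t t o) =
      bassSerreAction ι.range t t o := by
    rw [act_mul, act_inv_act, act_mul, hro]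
  have hto : o ≠ bassSerreAction ι.range t t o := fun he => by
    rw [← he, SimpleGraph.dist_self] at hd
    exact absurd hd zero_ne_one
  -- the fixed point sets of the two involutions are distinct points
  have hdisj : ∀ x, bassSerreAction ι.range t (ι r) x = x →
      bassSerreAction ι.range t (t * ι r * t⁻¹) x ≠ x := fun x h1 h2 =>
    hto ((h.eq_of_fixed hro h1 hr'.ne_one).trans (h.eq_of_fixed h2 hso hs'.ne_one))
  refine ⟨hsplit.wst' hG hX hp hq₁ hq₂ (h.not_isElementary hheight hχt hX (b := r) ?_),
    ⟨ι r * (t * ι r * t⁻¹), ⟨_, _, ⟨hr', hs', fun he => ?_⟩, rfl⟩, fun hfin => ?_, ?_⟩,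
    ⟨t, ?_⟩⟩
  · exact fun h1 => hr.ne_one (Subgroup.mem_bot.1 h1)
  · exact hdisj o hro (by rw [← he, hro])
  · have := finite_dihedral hr' hs' hfin
    obtain ⟨x, hx⟩ := hheight.exists_fixed_of_finite hX (dihedral (ι r) (t * ι r * t⁻¹))
    exact hdisj x (hx _ (left_mem_dihedral _ _)) (hx _ (right_mem_dihedral _ _))
  · have h1 := translationLength_le (treeAction hX (bassSerreAction ι.range t))
      (ι r * (t * ι r * t⁻¹)) (Realization.vertex hX o)
    rw [treeAction_vertex, dist_vertex_vertex] at h1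
    refine h1.trans ?_
    -- the vertices `o` and `t o` are adjacent, and each of them is fixed by one of the involutions
    have h2 := tree_dist_triangle hX o (bassSerreAction ι.range t t o)
      (bassSerreAction ι.range t (t * ι r * t⁻¹) o)
    have h3 := dist_act hX (bassSerreAction ι.range t) (t * ι r * t⁻¹)
      (bassSerreAction ι.range t t o) o
    have h4 := dist_act hX (bassSerreAction ι.range t) (ι r) o
      (bassSerreAction ι.range t (t * ι r * t⁻¹) o)
    rw [hso, SimpleGraph.dist_comm (v := o), hd] at h3
    rw [hro, ← act_mul] at h4
    rw [h4]
    have h5 : (bassSerreGraph ι.range t).dist o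
        (bassSerreAction ι.range t (t * ι r * t⁻¹) o) ≤ 2 := by omega
    exact_mod_cast h5
  · have h1 := h.translationLength_mul hheight hχ hχt hX 1
    rw [map_one, one_mul] at h1
    refine ⟨h1.1, h1.2.1, h1.2.2, fun i hi hti => ?_⟩
    obtain ⟨x, hx⟩ := hheight.exists_fixed_of_isOfFinOrder hX hi.isOfFinOrder
    have hx' : bassSerreAction ι.range t i (bassSerreAction ι.range t t x) =
        bassSerreAction ι.range t t x := by
      rw [← act_mul, ← hti.eq, act_mul, hx]
    have h2 := hheight.equivariant t x
    rw [← h.eq_of_fixed hx hx' hi.ne_one, hχt] at h2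
    simp at h2

end FreeProduct

/-! ### Pairs of minimal and of affine type -/

section MinimalAffine

variable {G : Type*} [Group G] {p : ℕ} {r s r' s' : G}

/-- In a subgroup isomorphic to `AGL(1, 𝔽_p)`, the subgroup generated by a translation is normal. -/
lemma le_normalizer_of_equiv (hp : p.Prime) {z : G} (ho : orderOf z = p) {H : Subgroup G}
    (hz : z ∈ H) (e : H ≃* AGL1 p) : H ≤ Subgroup.normalizer (Subgroup.zpowers z : Set G) := by
  have := Fact.mk hp
  have hconj : ∀ g ∈ H, g * z * g⁻¹ ∈ Subgroup.zpowers z := fun g hg => by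
    have hx : e ⟨z, hz⟩ ^ p = 1 := by
      rw [← map_pow, show (⟨z, hz⟩ : H) ^ p = 1 from
        Subtype.ext (ho ▸ pow_orderOf_eq_one z), map_one]
    obtain ⟨k, hk⟩ := AGL1_conj_mem_zpowers hx (e ⟨g, hg⟩)
    refine ⟨k, ?_⟩
    have hk' : e (⟨z, hz⟩ ^ k) = e (⟨g, hg⟩ * ⟨z, hz⟩ * ⟨g, hg⟩⁻¹) := by
      simpa only [map_zpow, map_mul, map_inv] using hk
    exact congrArg Subtype.val (e.injective hk')
  have hle : ∀ g ∈ H, ∀ x ∈ Subgroup.zpowers z, g * x * g⁻¹ ∈ Subgroup.zpowers z := by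
    rintro g hg _ ⟨k, rfl⟩
    change g * z ^ k * g⁻¹ ∈ _
    rw [← conj_zpow]
    exact zpow_mem (hconj g hg) k
  intro g hg
  rw [Subgroup.mem_normalizer_iff]
  refine fun x => ⟨hle g hg x, fun hx => ?_⟩
  have := hle g⁻¹ (inv_mem hg) _ hx
  rwa [show g⁻¹ * (g * x * g⁻¹) * g⁻¹⁻¹ = x by group] at this

lemma lt_mul_of_three_lt (hp : 3 < p) : 2 * p < (p - 1) * p :=
  Nat.mul_lt_mul_of_pos_right (by omega) (by omega)

/-- The translation subgroup of a pair of `p`-minimal type is not conjugate to that of a pair of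
`p`-affine type, because the normalizer of the latter is larger. -/
lemma IsPAffine.not_conj (h : IsPAffine p r s) (h' : IsPMinimal p r' s') (hp : p.Prime)
    (hp3 : 3 < p) (ho : orderOf (r * s) = p) (b : G) :
    Subgroup.zpowers (b * (r' * s') * b⁻¹) ≠ Subgroup.zpowers (r * s) := by
  intro heq
  obtain ⟨hrs, H, hH, ⟨e⟩⟩ := h
  have := Fact.mk hp
  have hp2 : p ≠ 2 := by omega
  have hN := le_normalizer_of_equiv hp ho
    (hH (mul_mem (left_mem_dihedral r s) (right_mem_dihedral r s))) e
  have hle : H.map (MulAut.conj b⁻¹).toMonoidHom ≤ dihedral r' s' := by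
    rintro _ ⟨g, hg, rfl⟩
    have hg' := Subgroup.mem_normalizer_iff_map_conj_eq.1 (hN hg)
    rw [← h'.2.2, Subgroup.mem_normalizer_iff_map_conj_eq]
    rw [← heq, MonoidHom.map_zpowers] at hg'
    rw [MonoidHom.map_zpowers]
    have h1 := congrArg (Subgroup.map (MulAut.conj b⁻¹).toMonoidHom) hg'
    rw [MonoidHom.map_zpowers, MonoidHom.map_zpowers] at h1
    convert h1 using 2 <;> simp [mul_assoc]
  have := finite_dihedral h'.1.1 h'.1.2.1 (orderOf_pos_iff.1 (h'.2.1 ▸ hp.pos))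
  have h1 := Subgroup.card_le_of_le hle
  rw [Nat.card_congr (H.equivMapOfInjective _ (MulAut.conj b⁻¹).injective).symm.toEquiv,
    Nat.card_congr e.toEquiv, card_AGL1, card_dihedral h'.1 hp hp2 h'.2.1] at h1
  have := lt_mul_of_three_lt hp3
  omega

lemma IsPAffine.exists_notMem (h : IsPAffine p r s) (hp : p.Prime) (hp3 : 3 < p)
    (ho : orderOf (r * s) = p) : ∃ b, b ∉ dihedral r s := by
  obtain ⟨hrs, H, hH, ⟨e⟩⟩ := h
  have := Fact.mk hp
  by_contra! hall
  have := finite_dihedral hrs.1 hrs.2.1 (orderOf_pos_iff.1 (ho ▸ hp.pos))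
  have h1 := Subgroup.card_le_of_le (show H ≤ dihedral r s from fun b _ => hall b)
  rw [Nat.card_congr e.toEquiv, card_AGL1, card_dihedral hrs hp (by omega) ho] at h1
  have := lt_mul_of_three_lt hp3
  omega

/-- The involutions are conjugate, since the product of two of them is of odd order. -/
lemma WST.exists_conj_eq {q₁ q₂ : ℕ} (hG : WST G p q₁ q₂) {i j : G} (hi : IsInvolution i)
    (hj : IsInvolution j) : ∃ d, d * i * d⁻¹ = j := by
  by_cases hij : i = j
  · exact ⟨1, by rw [hij, one_mul, inv_one, mul_one]⟩
  have ho : orderOf (i * j) = p := (hG.weakly.order_translation i j ⟨hi, hj, hij⟩).resolve_right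
    (not_not_intro (hG.torsion _))
  obtain ⟨m, hm⟩ := hG.weakly.prime.odd_of_ne_two hG.ne_two
  refine ⟨(i * j) ^ m, ?_⟩
  -- `i` inverts `i * j`, so that the left hand side is `(i * j) ^ (2 * m) * i`
  have h1 : i * ((i * j) ^ m)⁻¹ = (i * j) ^ m * i := by
    have h2 := conj_pow (a := i) (b := i * j) (i := m)
    rw [hi.inv_eq, hi.mul_mul_left hj, inv_pow] at h2
    rw [h2, ← mul_assoc, ← mul_assoc, hi.mul_self, one_mul]
  have h3 : (i * j) ^ m * (i * j) ^ m * (i * j) = 1 := by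
    rw [← pow_add, ← pow_succ, ← two_mul, ← hm, ← ho, pow_orderOf_eq_one]
  rw [mul_assoc, h1, ← mul_assoc, eq_inv_of_mul_eq_one_left h3, mul_inv_rev, hi.inv_eq, hj.inv_eq,
    mul_assoc, hi.mul_self, mul_one]

/-- The HNN-extension that conjugates a pair of `p`-minimal type to a pair of `p`-affine type. In
the base group, a translation of the minimal dihedral group is conjugated into this group only by
its own elements, and never into the affine dihedral group. -/
lemma wst'_of_minimal_affine {φ : dihedral r' s' ≃* dihedral r s} {Γ : Type*} [Group Γ]
    {ι : G →* Γ} {t : Γ} (h : IsHNN φ ι t) {N q₁ q₂ : ℕ} (hN : 3 < N) (hp : N ≤ p) (hq₁ : N ≤ q₁)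
    (hq₂ : N ≤ q₂) (hG : WST G p q₁ q₂) (haff : IsPAffine p r s) (hmin : IsPMinimal p r' s')
    (hX : (bassSerreGraph ι.range t).IsTree) :
    WST' N p q₁ q₂ hX (bassSerreAction _ _) ∧
      (Nat.card (dihedral r s ⊓ dihedral r' s' : Subgroup G) = 2 →
        ∃ g, ¬ IsOfFinOrder g ∧ ¬ IsTranslation g ∧
          translationLength (treeAction hX (bassSerreAction _ _)) g = 1 ∧
          ∃ i, IsInvolution i ∧ Commute g i) := by
  have hprime := hG.weakly.prime
  have hp2 := hG.ne_two
  have hp3 : 3 < p := hN.trans_le hp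
  have ho : orderOf (r * s) = p := (hG.weakly.order_translation r s haff.1).resolve_right
    (not_not_intro (hG.torsion _))
  have ho' := hmin.2.1
  have h2' := sq_ne_one_of_orderOf hprime hp2 ho'
  obtain ⟨χ, η, hheight, hχ, hχt, hη⟩ := h.exists_isHeight
  have hsq : ∀ a : G, a ^ 2 ≠ 1 → ∀ b, (b * a * b⁻¹) ^ 2 ≠ 1 := fun a ha b hb => by
    rw [conj_pow, conj_eq_one_iff] at hb
    exact ha hb
  have hconj : ∀ a b : G, (Subgroup.zpowers a).map (MulAut.conj b).toMonoidHom =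
      Subgroup.zpowers (b * a * b⁻¹) := fun a b => MonoidHom.map_zpowers _ _
  have hsplit := h.isDihedralSplitting hheight hχ hχt hη
    (finite_dihedral hmin.1.1 hmin.1.2.1 (orderOf_pos_iff.1 (ho' ▸ hprime.pos)))
    (fun a ha h1 => (hmin.1.cases_of_mem h2' ha h1).imp_right And.left)
    (fun a ha ha2 b hb => by
      refine haff.not_conj hmin hprime hp3 ho b ?_
      rw [← hconj, ← zpowers_eq_of_mem_dihedral hmin.1 hprime hp2 ho' ha ha2, hconj,
        zpowers_eq_of_mem_dihedral haff.1 hprime hp2 ho hb (hsq a ha2 b)])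
    (fun a ha ha2 b hb => by
      rw [← hmin.2.2, Subgroup.mem_normalizer_iff_map_conj_eq,
        ← zpowers_eq_of_mem_dihedral hmin.1 hprime hp2 ho' ha ha2]
      refine (hconj a b).trans ?_
      rw [zpowers_eq_of_mem_dihedral hmin.1 hprime hp2 ho' hb (hsq a ha2 b),
        zpowers_eq_of_mem_dihedral hmin.1 hprime hp2 ho' ha ha2])
  obtain ⟨b, hb⟩ := haff.exists_notMem hprime hp3 ho
  refine ⟨hsplit.wst' hG hX hp hq₁ hq₂ (h.not_isElementary hheight hχt hX hb), fun hcard => ?_⟩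
  have := Fact.mk Nat.prime_two
  have := Nat.finite_of_card_ne_zero (hcard ▸ two_ne_zero)
  obtain ⟨x, hx⟩ := exists_prime_orderOf_dvd_card' 2 (dvd_of_eq hcard.symm)
  obtain ⟨i, hiB, hiA⟩ := x
  rw [← Subgroup.orderOf_coe] at hx
  -- `t` conjugates `i` to an involution of the base group, which is conjugate to `i` there
  have hj : IsInvolution (φ ⟨i, hiA⟩ : G) := by
    rw [IsInvolution, Subgroup.orderOf_coe, MulEquiv.orderOf_eq, Subgroup.orderOf_mk]
    exact hx
  obtain ⟨d, hd⟩ := hG.exists_conj_eq hj hx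
  obtain ⟨h1, h2, h3⟩ := h.translationLength_mul hheight hχ hχt hX d
  refine ⟨ι d * t, h1, h2, h3, ι i, (isInvolution_map h.injective).2 hx, ?_⟩
  have h4 := h.conj ⟨i, hiA⟩
  have h5 := congrArg ι hd
  rw [map_mul, map_mul, map_inv, ← h4] at h5
  change ι d * t * ι i = ι i * (ι d * t)
  change _ = ι i at h5
  conv_rhs => rw [← h5]
  group

end MinimalAffine

end SharpTwo

theorem proposition3p1 {G : Type*} [Group G] (N p q₁ q₂ : ℕ) (hN : 3 < N)
    (hp : N ≤ p) (hq₁ : N ≤ q₁) (hq₂ : N ≤ q₂) (hG : WST G p q₁ q₂) :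
    -- the free product `G * ℤ`, an HNN-extension of `G` with trivial associated subgroups
    (∃ hX : (bassSerreGraph (Monoid.Coprod.inl : G →* Monoid.Coprod G (Multiplicative ℤ)).range
        (Monoid.Coprod.inr (Multiplicative.ofAdd (1 : ℤ)))).IsTree,
      WST' N p q₁ q₂ hX (bassSerreAction _ _) ∧
      (∃ g, IsTranslation g ∧ ¬ IsOfFinOrder g ∧
        translationLength (treeAction hX (bassSerreAction _ _)) g ≤ 2) ∧
      (∃ g, ¬ IsOfFinOrder g ∧ ¬ IsTranslation g ∧
        translationLength (treeAction hX (bassSerreAction _ _)) g = 1 ∧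
        ∀ i, IsInvolution i → ¬ Commute g i)) ∧
    -- the HNN-extension `⟨G, t ∣ t⁻¹rt = r', t⁻¹st = s'⟩`
    (∀ r s r' s' : G, IsPAffine p r s → IsPMinimal p r' s' →
      (∃ φ : dihedral r' s' ≃* dihedral r s, MapsPair φ) ∧
      ∀ φ : dihedral r' s' ≃* dihedral r s, MapsPair φ →
        ∃ hX : (bassSerreGraph
            (HNNExtension.of : G →* HNNExtension G (dihedral r' s') (dihedral r s) φ).range
            HNNExtension.t).IsTree,
          WST' N p q₁ q₂ hX (bassSerreAction _ _) ∧
          (Nat.card (dihedral r s ⊓ dihedral r' s' : Subgroup G) = 2 →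
            ∃ g, ¬ IsOfFinOrder g ∧ ¬ IsTranslation g ∧
              translationLength (treeAction hX (bassSerreAction _ _)) g = 1 ∧
              ∃ i, IsInvolution i ∧ Commute g i)) := by
  have h := isHNN_coprod G
  refine ⟨⟨h.isTree, wst'_of_trivial h hp hq₁ hq₂ hG _⟩, fun r s r' s' haff hmin => ⟨?_, ?_⟩⟩
  · exact exists_mapsPair haff.1 hmin.1 hG.weakly.prime hG.ne_two
      ((hG.weakly.order_translation r s haff.1).resolve_right (not_not_intro (hG.torsion _)))
      hmin.2.1
  · intro φ _
    exact ⟨(isHNN_of G φ).isTree,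
      wst'_of_minimal_affine (isHNN_of G φ) hN hp hq₁ hq₂ hG haff hmin _⟩
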